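/- Let $\Delta\subset\mathbb R^n$ be a bounded nonempty open polytope, given by finitely many irredundant inequalities $\delta_k(x)=h_k(x)-c_k>0$ with $h_k$ linear (so that each $\{\delta_k=0\}$ contains a facet $F_k$ of $\Delta$). Let $\mu$ be Lebesgue measure and let $\sigma$ be the measure on $\partial\Delta$ with $d\sigma\wedge dh_k=\pm d\mu$ on $F_k$, i.e. $(n-1)$-dimensional Lebesgue measure divided by $|\nabla h_k|$. Put $u_o=\sum_k\delta_k\log\delta_k$, and let $\mathcal S$ be the set of continuous convex functions $u$ on $\bar\Delta$ such that $u-u_o$ is smooth on $\bar\Delta$. Let $A\in C^\infty(\bar\Delta)$ and $$\mathcal L_A(u)=\int_{\partial\Delta}u\,d\sigma-\int_\Delta Au\,d\mu .$$ Fix $p_o\in\Delta$. Let $\tilde{\mathcal C}$ be the set of continuous convex functions $u$ on $\bar\Delta$ which are smooth in $\Delta$ and satisfy $u\ge u(p_o)=0$, and write $\|u\|_b=\int_{\partial\Delta}u\,d\sigma$. Let $\mathcal C_*$ be the set of functions $u$ that are locally uniform limits in $\Delta$ of sequences $u^{(k)}\in\tilde{\mathcal C}$ with $\|u^{(k)}\|_b<C$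 for some constant $C$, extended to the boundary by $u(q)=\lim_{\Delta\ni\xi\to q}u(\xi)$ (these limits are finite on the open facets, which is $\sigma$-almost all of $\partial\Delta$). For $P>0$ let $\mathcal C_*^P=\{u\in\mathcal C_*:\|u\|_b\le P\}$. Theorem. Suppose that the Abreu equation $$\sum_{i,j}\frac{\partial^2u^{ij}}{\partial x_i\partial x_j}=-A\quad\text{in }\Delta,\qquad (u^{ij})=(u_{ij})^{-1},$$ has a solution in $\mathcal S$. Then $(\Delta,A)$ is relatively strong K-stable: for all sufficiently large $P$, $\mathcal L_A(u)$ is well defined (i.e. $Au\in L^1(\Delta)$) and $\mathcal L_A(u)\ge0$ for every $u\in\mathcal C_*^P$, and every $u\in\mathcal C_*^P$ with $\mathcal L_A(u)=0$ is affine linear on the union $\Delta^*$ of $\Delta$ and its open facets. -/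

import Mathlib

open Set Filter Topology MeasureTheory
open scoped ContDiff

noncomputable section

namespace Abreu

/-- A polytope with nonempty interior and compact closure in `ℝⁿ`, presented by
inequalities `δ_k(x) = h_k(x) - c_k > 0`, where `h_k(x) = ⟪a_k, x⟫` and each hyperplane
`δ_k = 0` contains a facet (i.e. no inequality is redundant). -/
structure Polytope (n m : ℕ) where
  a : Fin m → EuclideanSpace ℝ (Fin n)
  c : Fin m → ℝ
  nonempty : ∃ x, ∀ k, 0 < inner ℝ (a k) x - c k
  bounded : Bornology.IsBounded {x | ∀ k, 0 < inner ℝ (a k) x - c k}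
  facet : ∀ k, ∃ x, inner ℝ (a k) x - c k = 0 ∧ ∀ j, j ≠ k → 0 < inner ℝ (a j) x - c j

namespace Polytope

variable {n m : ℕ} (Δ : Polytope n m)

/-- The affine function `δ_k = h_k - c_k`. -/
def δ (k : Fin m) (x : EuclideanSpace ℝ (Fin n)) : ℝ := inner ℝ (Δ.a k) x - Δ.c k

/-- The open polytope `Δ`. -/
def int : Set (EuclideanSpace ℝ (Fin n)) := {x | ∀ k, 0 < Δ.δ k x}

/-- The closed polytope `Δ̄`. -/
def closed : Set (EuclideanSpace ℝ (Fin n)) := closure Δ.int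

/-- The `k`-th open codimension-one face. -/
def openFacet (k : Fin m) : Set (EuclideanSpace ℝ (Fin n)) :=
  {x | Δ.δ k x = 0 ∧ ∀ j, j ≠ k → 0 < Δ.δ j x}

/-- `Δ*`: the union of `Δ` and its open codimension-one faces. -/
def star : Set (EuclideanSpace ℝ (Fin n)) := Δ.int ∪ ⋃ k, Δ.openFacet k

/-- The measure on the `k`-th facet with `dσ ∧ dh_k = ± dμ`: the `(n-1)`-dimensional Lebesgue
measure of the hyperplane `h_k = c_k`, divided by `‖a_k‖`, restricted to the facet. -/
def facetMeasure (k : Fin m) : Measure (EuclideanSpace ℝ (Fin n)) :=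
  ENNReal.ofReal (‖Δ.a k‖⁻¹) •
    ((volume : Measure (ℝ ∙ Δ.a k)ᗮ).map
      (fun y : (ℝ ∙ Δ.a k)ᗮ => (Δ.c k / ‖Δ.a k‖ ^ 2) • Δ.a k +
        (y : EuclideanSpace ℝ (Fin n)))).restrict (Δ.openFacet k)

/-- The boundary measure `σ` on `∂Δ` (the faces of codimension at least two are null sets). -/
def σ : Measure (EuclideanSpace ℝ (Fin n)) := ∑ k, Δ.facetMeasure k

/-- The Guillemin function `u_o = ∑ δ_k log δ_k` (with `0 log 0 = 0`). -/
def guillemin (x : EuclideanSpace ℝ (Fin n)) : ℝ := ∑ k, Δ.δ k x * Real.log (Δ.δ k x)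

/-- The class `𝒮`: continuous convex `u` on `Δ̄` with `u - u_o` smooth on `Δ̄`. -/
structure MemS (u : EuclideanSpace ℝ (Fin n) → ℝ) : Prop where
  continuousOn : ContinuousOn u Δ.closed
  convexOn : ConvexOn ℝ Δ.closed u
  smooth : ContDiffOn ℝ ∞ (fun x => u x - Δ.guillemin x) Δ.closed

/-- The class `𝒞_∞`: continuous convex functions on `Δ̄` which are smooth in the interior. -/
structure MemCInfty (u : EuclideanSpace ℝ (Fin n) → ℝ) : Prop where
  continuousOn : ContinuousOn u Δ.closed
  convexOn : ConvexOn ℝ Δ.closed u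
  smooth : ContDiffOn ℝ ∞ u Δ.int

/-- The class `𝒞̃`: functions in `𝒞_∞` normalized at `p`, i.e. `u ≥ u(p) = 0` on `Δ̄`. -/
structure MemCTilde (p : EuclideanSpace ℝ (Fin n)) (u : EuclideanSpace ℝ (Fin n) → ℝ) :
    Prop where
  memCInfty : Δ.MemCInfty u
  base : u p = 0
  nonneg : ∀ x ∈ Δ.closed, 0 ≤ u x

/-- `‖u‖_b = ∫_{∂Δ} u dσ`. -/
def bNorm (u : EuclideanSpace ℝ (Fin n) → ℝ) : ℝ := ∫ x, u x ∂Δ.σ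

/-- The class `𝒞_*`: locally uniform limits in `Δ` of sequences in `𝒞̃` of bounded
`‖·‖_b`, with boundary values given by the limits from the interior. The boundary values are
prescribed on the open facets, where these limits are finite; the remaining part of `∂Δ`,
where they may be `+∞`, is `σ`-null, and the values of `u` there play no role. -/
structure MemCStar (p : EuclideanSpace ℝ (Fin n)) (u : EuclideanSpace ℝ (Fin n) → ℝ) :
    Prop where
  approx : ∃ C : ℝ, 0 < C ∧ ∃ U : ℕ → EuclideanSpace ℝ (Fin n) → ℝ,
    (∀ j, Δ.MemCTilde p (U j)) ∧ (∀ j, Δ.bNorm (U j) < C) ∧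
      TendstoLocallyUniformlyOn U u atTop Δ.int
  boundary : ∀ k, ∀ q ∈ Δ.openFacet k, Tendsto u (𝓝[Δ.int] q) (𝓝 (u q))

/-- The class `𝒞_*^P`: elements of `𝒞_*` with `‖u‖_b ≤ P` (in particular `‖u‖_b` is finite). -/
structure MemCStarP (p : EuclideanSpace ℝ (Fin n)) (P : ℝ)
    (u : EuclideanSpace ℝ (Fin n) → ℝ) : Prop where
  memCStar : Δ.MemCStar p u
  integrable : Integrable u Δ.σ
  bNorm_le : Δ.bNorm u ≤ P

/-- The functional `ℒ_A(u) = ∫_{∂Δ} u dσ - ∫_Δ A u dμ`. -/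
def L (A u : EuclideanSpace ℝ (Fin n) → ℝ) : ℝ :=
  (∫ x, u x ∂Δ.σ) - ∫ x in Δ.int, A x * u x

end Polytope

/-- The partial derivative `∂f/∂x_i`. -/
def pderiv {n : ℕ} (i : Fin n) (f : EuclideanSpace ℝ (Fin n) → ℝ)
    (x : EuclideanSpace ℝ (Fin n)) : ℝ :=
  fderiv ℝ f x (EuclideanSpace.single i 1)

/-- The Hessian matrix `(u_ij)`. -/
def hess {n : ℕ} (u : EuclideanSpace ℝ (Fin n) → ℝ) (x : EuclideanSpace ℝ (Fin n)) :
    Matrix (Fin n) (Fin n) ℝ :=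
  Matrix.of fun i j => pderiv i (pderiv j u) x

namespace Polytope

variable {n m : ℕ} (Δ : Polytope n m)

/-- `u` solves the Abreu equation `∑ ∂²u^{ij}/∂x_i∂x_j = -A` in `Δ`, where `(u^{ij})` is the
inverse of the Hessian. As `u` is convex, invertibility of the Hessian means that it is
positive definite. -/
def SolvesAbreu (A u : EuclideanSpace ℝ (Fin n) → ℝ) : Prop :=
  ∀ x ∈ Δ.int, (hess u x).PosDef ∧
    ∑ i, ∑ j, pderiv i (pderiv j (fun y => (hess u y)⁻¹ i j)) x = -A x

/-- `u` is (the restriction to `Δ*` of) an affine linear function. -/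
def IsAffine (u : EuclideanSpace ℝ (Fin n) → ℝ) : Prop :=
  ∃ (b : EuclideanSpace ℝ (Fin n)) (d : ℝ), ∀ x ∈ Δ.star, u x = inner ℝ b x + d

/-- Relative strong K-stability of `(Δ, A)`, with normalization point `p`: for all large `P`,
`ℒ_A` is well defined and nonnegative on `𝒞_*^P`, and `𝒞_*^P` contains no nontrivial extremal
function. -/
def RelStrongKStable (p : EuclideanSpace ℝ (Fin n)) (A : EuclideanSpace ℝ (Fin n) → ℝ) : Prop :=
  ∃ P₀ : ℝ, 0 < P₀ ∧ ∀ P, P₀ ≤ P →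
    (∀ u, Δ.MemCStarP p P u →
      IntegrableOn (fun x => A x * u x) Δ.int ∧ 0 ≤ Δ.L A u) ∧
    (∀ u, Δ.MemCStarP p P u → Δ.L A u = 0 → Δ.IsAffine u)

end Polytope

end Abreu

end

/-! Let `v` solve the equation, with Hessian `V`. Formally, two integrations by parts turn `ℒ_A(u)`
into `∫ tr(V⁻¹ D²u)`, which is nonnegative for convex `u`. The difficulty is the boundary terms.
They are treated without expanding `V⁻¹` near the boundary, and only an upper bound on `det V` is
needed.

The Legendre transform `η = (x - p)·∇v - v`, read as a function of `x`, equals `-∑ δ_k(p) log δ_k`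
up to a bounded error (`exists_legendre_bound`), so it exhausts the polytope; moreover `∇η = V (x -
p)`. Let `G` be a function of `η` that decays from 1 to 0 over a length `S`, and let `ρ` be minus
its derivative. In the divergence of `G (u div V⁻¹ - V⁻¹∇u)` the terms carrying `ρ` then contain `V`
only through the radial derivative of `log det V` (`divergence_identity`). Adding the divergence of
`ρ u (B - log det V)(x - p)`, where `B = C - ∑ log δ_k` dominates `log det V`, trades that
derivative for the radial derivative of `B`. Multiplied by `ρ`, the latter is bounded by densities
that concentrate on the facets as `S → ∞` and contribute at most `∫ u dσ`
(`exists_integral_logDensity_le`).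

What remains carries the factor `B - log det V`. It is absorbed because `(x - p)ᵀ V (x - p)` blows
up at the boundary (`exists_le_radialHess`, `cutoffDensity_absorb`) and because `-log det V ≤ tr V⁻¹
≤ κ⁻¹ tr(V⁻¹ D²u)` when `D²u ≥ κ`. This gives `setIntegral_trace_absorbed_le`; letting `ε → 0` and
then `κ → 0` yields `∫ φ tr(V⁻¹ D²w) ≤ ℒ_A(w)` for nonnegative convex `w` smooth up to the boundary
(`setIntegral_trace_le_L`).

A general `u` in `𝒞_*` is reached through its dilations about `p`: they are uniform limits on the
closed polytope of such `w`, and they lie below `u`, so dominated convergence applies once `u` is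
known to be integrable. Integrability follows from a trace inequality and Fatou. For rigidity, on a
ball in the interior `tr D²w` is controlled by `tr(V⁻¹ D²w)`, so `ℒ_A(u) = 0` and `u(z) = 0` force
`u = 0` near `z`. The zero set is therefore open and closed in the polytope, and it contains `p`. -/

noncomputable section

/-! ### Inequalities for positive (semi)definite matrices -/

namespace Matrix

variable {ι : Type*} [Fintype ι] [DecidableEq ι]

theorem PosSemidef.exists_eq_conjTranspose_mul_self {A : Matrix ι ι ℝ} (hA : A.PosSemidef) :
    ∃ B : Matrix ι ι ℝ, A = Bᴴ * B := by
  open scoped MatrixOrder in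
  have h : 0 ≤ A := hA.nonneg
  open scoped MatrixOrder in
  exact CStarAlgebra.nonneg_iff_eq_star_mul_self.mp h

theorem PosSemidef.trace_mul_nonneg {A B : Matrix ι ι ℝ} (hA : A.PosSemidef)
    (hB : B.PosSemidef) : 0 ≤ (A * B).trace := by
  obtain ⟨C, rfl⟩ := hA.exists_eq_conjTranspose_mul_self
  rw [Matrix.mul_assoc, Matrix.trace_mul_comm]
  exact (hB.mul_mul_conjTranspose_same C).trace_nonneg

/-- Apply `log λ ≤ λ - 1` to each eigenvalue. For an inverse Hessian this bounds `-log det` of the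
Hessian by a trace. -/
theorem PosDef.log_det_le_trace_sub_card {A : Matrix ι ι ℝ} (hA : A.PosDef) :
    Real.log A.det ≤ A.trace - Fintype.card ι := by
  have hpos := hA.eigenvalues_pos
  have h1 : A.det = ∏ i, hA.1.eigenvalues i := by
    simpa using hA.1.det_eq_prod_eigenvalues
  have h2 : A.trace = ∑ i, hA.1.eigenvalues i := by
    simpa using hA.1.trace_eq_sum_eigenvalues
  rw [h1, h2, Real.log_prod (fun i _ => (hpos i).ne')]
  have : ∑ i, Real.log (hA.1.eigenvalues i) ≤ ∑ i, (hA.1.eigenvalues i - 1) :=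
    Finset.sum_le_sum fun i _ => Real.log_le_sub_one_of_pos (hpos i)
  simpa [Finset.sum_sub_distrib] using this

/-- Write `W⁻¹ = Cᴴ C`. The matrix `C V Cᴴ` has determinant `det V / det W`, and its trace `tr(W⁻¹
V)` is at most `tr 1` because `W - V ≥ 0`; the preceding bound makes the logarithm of its
determinant nonpositive. -/
theorem PosDef.det_le_of_sub_posSemidef {V W : Matrix ι ι ℝ} (hV : V.PosDef) (hW : W.PosDef)
    (h : (W - V).PosSemidef) : V.det ≤ W.det := by
  obtain ⟨C, hC⟩ := hW.inv.posSemidef.exists_eq_conjTranspose_mul_self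
  have hWd : 0 < W.det := hW.det_pos
  have hWu : IsUnit W.det := hWd.ne'.isUnit
  have hdet : (Cᴴ.det) * C.det = W.det⁻¹ := by
    rw [← det_mul, ← hC, det_nonsing_inv, Ring.inverse_eq_inv']
  have hCu : IsUnit C.det := by
    refine IsUnit.mk0 _ fun h0 => ?_
    rw [h0, mul_zero] at hdet
    exact (inv_pos.2 hWd).ne hdet
  have hP : (C * V * Cᴴ).PosDef := by
    refine hV.mul_mul_conjTranspose_same ?_
    exact Matrix.vecMul_injective_of_isUnit ((isUnit_iff_isUnit_det C).2 hCu)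
  have htr : (C * V * Cᴴ).trace ≤ Fintype.card ι := by
    have h1 : (C * V * Cᴴ).trace = (W⁻¹ * V).trace := by
      rw [hC, Matrix.trace_mul_comm, ← Matrix.mul_assoc]
    have h2 := hW.inv.posSemidef.trace_mul_nonneg h
    rw [Matrix.mul_sub, nonsing_inv_mul _ hWu, trace_sub, trace_one] at h2
    linarith
  have hlog := hP.log_det_le_trace_sub_card
  have hdP : (C * V * Cᴴ).det = V.det / W.det := by
    rw [det_mul, det_mul, mul_comm C.det, mul_assoc, mul_comm C.det, hdet, div_eq_mul_inv]
  have h3 : Real.log (C * V * Cᴴ).det ≤ 0 := by linarith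
  rw [hdP, Real.log_nonpos_iff (div_pos hV.det_pos hWd).le, div_le_one hWd] at h3
  exact h3

/-- With `y = W⁻¹ a` one has `a·y = y·Wy ≥ C |y|²`; combine this with `|a - C y|² ≥ 0`. -/
theorem dotProduct_inv_mulVec_le {W : Matrix ι ι ℝ} {C : ℝ} (hC : 0 < C) (hW : W.PosDef)
    (h : (W - C • (1 : Matrix ι ι ℝ)).PosSemidef) (a : ι → ℝ) :
    a ⬝ᵥ (W⁻¹ *ᵥ a) ≤ (a ⬝ᵥ a) / C := by
  set y := W⁻¹ *ᵥ a with hy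
  have hWy : W *ᵥ y = a := by
    rw [hy, mulVec_mulVec, mul_nonsing_inv _ hW.det_pos.ne'.isUnit, one_mulVec]
  have h1 := h.dotProduct_mulVec_nonneg y
  simp only [star_trivial, sub_mulVec, dotProduct_sub, hWy, smul_mulVec, one_mulVec,
    dotProduct_smul, smul_eq_mul] at h1
  have h2 : 0 ≤ (a - C • y) ⬝ᵥ (a - C • y) := by
    simpa using dotProduct_star_self_nonneg (a - C • y)
  simp only [sub_dotProduct, dotProduct_sub, smul_dotProduct, dotProduct_smul, smul_eq_mul] at h2
  rw [dotProduct_comm y a] at *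
  rw [le_div_iff₀ hC]
  nlinarith

theorem posDef_smul_one_add_sum {κ : Type*} {C : ℝ} (hC : 0 < C) {s : Finset κ} {t : κ → ℝ}
    (ht : ∀ k ∈ s, 0 ≤ t k) (a : κ → ι → ℝ) :
    (C • (1 : Matrix ι ι ℝ) + ∑ k ∈ s, t k • vecMulVec (a k) (a k)).PosDef ∧
    (C • (1 : Matrix ι ι ℝ) + ∑ k ∈ s, t k • vecMulVec (a k) (a k) -
      C • (1 : Matrix ι ι ℝ)).PosSemidef := by
  have h : (∑ k ∈ s, t k • vecMulVec (a k) (a k)).PosSemidef := by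
    refine posSemidef_sum _ fun k hk => ?_
    have := posSemidef_vecMulVec_self_star (a k)
    rw [star_trivial] at this
    exact this.smul (ht k hk)
  refine ⟨(PosDef.one.smul hC).add_posSemidef h, ?_⟩
  rwa [add_sub_cancel_left]

/-- By the matrix determinant lemma, each rank-one update multiplies the determinant by `1 + t
a·W⁻¹a`, where `W ≥ C`. This controls the model Hessian `∑ a_k a_kᵀ / δ_k` by a product over the
facets. -/
theorem det_smul_one_add_sum_le {κ : Type*} {C : ℝ} (hC : 0 < C) (s : Finset κ) {t : κ → ℝ}
    (ht : ∀ k ∈ s, 0 ≤ t k) (a : κ → ι → ℝ) :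
    (C • (1 : Matrix ι ι ℝ) + ∑ k ∈ s, t k • vecMulVec (a k) (a k)).det ≤
      C ^ Fintype.card ι * ∏ k ∈ s, (1 + t k * (a k ⬝ᵥ a k) / C) := by
  classical
  induction s using Finset.induction_on with
  | empty => simp
  | insert k s hk ih =>
    have ht' : ∀ j ∈ s, 0 ≤ t j := fun j hj => ht j (Finset.mem_insert_of_mem hj)
    have htk : 0 ≤ t k := ht k (Finset.mem_insert_self _ _)
    obtain ⟨hpd, hps⟩ := posDef_smul_one_add_sum hC ht' a
    set W := C • (1 : Matrix ι ι ℝ) + ∑ k ∈ s, t k • vecMulVec (a k) (a k) with hW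
    have h1 : C • (1 : Matrix ι ι ℝ) + ∑ k ∈ insert k s, t k • vecMulVec (a k) (a k) =
        W + replicateCol Unit (t k • a k) * replicateRow Unit (a k) := by
      rw [Finset.sum_insert hk, hW, ← vecMulVec_eq, smul_vecMulVec]
      abel
    rw [h1, det_add_replicateCol_mul_replicateRow hpd.det_pos.ne'.isUnit, Finset.prod_insert hk,
      mul_comm (1 + _), ← mul_assoc]
    have h2 : (1 + replicateRow Unit (a k) * W⁻¹ * replicateCol Unit (t k • a k)).det =
        1 + t k * (a k ⬝ᵥ (W⁻¹ *ᵥ a k)) := by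
      rw [det_unique, add_apply, one_apply_eq, Matrix.mul_assoc, ← replicateCol_mulVec,
        replicateRow_mul_replicateCol_apply, mulVec_smul, dotProduct_smul, smul_eq_mul]
    rw [h2]
    have h3 := dotProduct_inv_mulVec_le hC hpd hps (a k)
    have h4 : 0 ≤ a k ⬝ᵥ (W⁻¹ *ᵥ a k) := by
      simpa using hpd.inv.posSemidef.dotProduct_mulVec_nonneg (a k)
    refine mul_le_mul (ih ht') ?_ (by positivity) ((hpd.det_pos.le).trans (ih ht'))
    rw [mul_div_assoc]
    gcongr

/-- Cauchy–Schwarz applied to each row of a factor `R` with `X = Rᴴ R`. -/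
theorem PosSemidef.trace_smul_one_sub {X : Matrix ι ι ℝ} (hX : X.PosSemidef) :
    (X.trace • (1 : Matrix ι ι ℝ) - X).PosSemidef := by
  obtain ⟨R, rfl⟩ := hX.exists_eq_conjTranspose_mul_self
  refine PosSemidef.of_dotProduct_mulVec_nonneg ?_ fun x => ?_
  · refine IsHermitian.sub ?_ hX.1
    simp [IsHermitian]
  · simp only [star_trivial, sub_mulVec, dotProduct_sub, smul_mulVec, one_mulVec,
      dotProduct_smul, smul_eq_mul, sub_nonneg]
    have h1 : x ⬝ᵥ ((Rᴴ * R) *ᵥ x) = ∑ i, (∑ j, R i j * x j) ^ 2 := by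
      rw [← mulVec_mulVec, dotProduct_mulVec, conjTranspose_eq_transpose_of_trivial,
        vecMul_transpose]
      simp [dotProduct, mulVec, sq]
    have h2 : (Rᴴ * R).trace = ∑ i, ∑ j, R i j ^ 2 := by
      rw [Finset.sum_comm]
      simp [trace, mul_apply, sq]
    have h3 : x ⬝ᵥ x = ∑ j, x j ^ 2 := by simp [dotProduct, sq]
    rw [h1, h2, h3, Finset.sum_mul]
    exact Finset.sum_le_sum fun i _ => Finset.sum_mul_sq_le_sq_mul_sq _ _ _

/-- The reason is `V⁻¹ ≥ (tr V)⁻¹`. It turns control of `tr(V⁻¹ D²w)` into control of `tr D²w`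
wherever `V` is bounded. -/
theorem PosDef.trace_le_trace_mul_trace_inv_mul {V U : Matrix ι ι ℝ} (hV : V.PosDef)
    (hU : U.PosSemidef) : U.trace ≤ V.trace * (V⁻¹ * U).trace := by
  have hVu : IsUnit V.det := hV.det_pos.ne'.isUnit
  obtain ⟨S, hS⟩ := hV.posSemidef.exists_eq_conjTranspose_mul_self
  have hX := (posSemidef_self_mul_conjTranspose S).trace_smul_one_sub
  have htr : (S * Sᴴ).trace = V.trace := by rw [trace_mul_comm, ← hS]
  have hVV : V * V⁻¹ = 1 := mul_nonsing_inv _ hVu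
  have hSd : Sᴴ * (S * V⁻¹) = 1 := by rw [← Matrix.mul_assoc, ← hS, hVV]
  have hSS : S * V⁻¹ * Sᴴ = 1 := mul_eq_one_comm.1 hSd
  have hinvH : (V⁻¹)ᴴ = V⁻¹ := hV.inv.1
  -- With `V = Sᴴ S`, conjugate `tr(V) - S Sᴴ ≥ 0` by `S V⁻¹`.
  have key : ((V.trace) • V⁻¹ - 1).PosSemidef := by
    have := hX.conjTranspose_mul_mul_same (S * V⁻¹)
    rw [htr, conjTranspose_mul, hinvH] at this
    convert this using 1
    rw [Matrix.mul_sub, Matrix.sub_mul]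
    congr 1
    · rw [Matrix.mul_smul, Matrix.smul_mul, Matrix.mul_one, Matrix.mul_assoc, hSd, Matrix.mul_one]
    · have e1 : V⁻¹ * Sᴴ * (S * Sᴴ) * (S * V⁻¹) = V⁻¹ * (Sᴴ * S) * (Sᴴ * (S * V⁻¹)) := by
        simp only [Matrix.mul_assoc]
      rw [e1, hSd, ← hS, nonsing_inv_mul _ hVu, Matrix.mul_one]
  have := key.trace_mul_nonneg hU
  rw [Matrix.sub_mul, Matrix.smul_mul, Matrix.one_mul, trace_sub, trace_smul, smul_eq_mul] at this
  linarith

end Matrix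

namespace Abreu

variable {n : ℕ}

/-! ### Rules for partial derivatives -/

section pderiv

variable {f g : EuclideanSpace ℝ (Fin n) → ℝ} {x : EuclideanSpace ℝ (Fin n)} {i j k : Fin n}

theorem pderiv_congr (h : f =ᶠ[𝓝 x] g) : pderiv i f x = pderiv i g x := by
  unfold pderiv; rw [h.fderiv_eq]

theorem pderiv_const (c : ℝ) : pderiv i (fun _ => c) x = 0 := by
  simp [pderiv]

theorem pderiv_add (hf : DifferentiableAt ℝ f x) (hg : DifferentiableAt ℝ g x) :
    pderiv i (fun y => f y + g y) x = pderiv i f x + pderiv i g x := by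
  unfold pderiv; rw [fderiv_fun_add hf hg]; rfl

theorem pderiv_sub (hf : DifferentiableAt ℝ f x) (hg : DifferentiableAt ℝ g x) :
    pderiv i (fun y => f y - g y) x = pderiv i f x - pderiv i g x := by
  unfold pderiv; rw [fderiv_fun_sub hf hg]; rfl

theorem pderiv_sum {ι : Type*} {s : Finset ι} {F : ι → EuclideanSpace ℝ (Fin n) → ℝ}
    (hF : ∀ a ∈ s, DifferentiableAt ℝ (F a) x) :
    pderiv i (fun y => ∑ a ∈ s, F a y) x = ∑ a ∈ s, pderiv i (F a) x := by
  unfold pderiv; rw [fderiv_fun_sum hF]; simp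

theorem pderiv_mul (hf : DifferentiableAt ℝ f x) (hg : DifferentiableAt ℝ g x) :
    pderiv i (fun y => f y * g y) x = f x * pderiv i g x + pderiv i f x * g x := by
  unfold pderiv; rw [fderiv_fun_mul hf hg]; simp; ring

theorem pderiv_comp {h : ℝ → ℝ} {h' : ℝ} (hh : HasDerivAt h h' (f x))
    (hf : DifferentiableAt ℝ f x) : pderiv i (fun y => h (f y)) x = h' * pderiv i f x := by
  have := hh.comp_hasFDerivAt x hf.hasFDerivAt
  unfold pderiv
  rw [show (fun y => h (f y)) = h ∘ f from rfl, this.fderiv]; simp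

theorem pderiv_coord_sub (p : EuclideanSpace ℝ (Fin n)) :
    pderiv i (fun y => y j - p j) x = if i = j then 1 else 0 := by
  have h : HasFDerivAt (fun y : EuclideanSpace ℝ (Fin n) => y j - p j)
      (EuclideanSpace.proj j : EuclideanSpace ℝ (Fin n) →L[ℝ] ℝ) x :=
    (EuclideanSpace.proj j : EuclideanSpace ℝ (Fin n) →L[ℝ] ℝ).hasFDerivAt.sub_const _
  unfold pderiv; rw [h.fderiv]; simp [eq_comm]

theorem fderiv_eq_sum_pderiv (v : EuclideanSpace ℝ (Fin n)) :
    fderiv ℝ f x v = ∑ i, v i * pderiv i f x := by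
  have h : v = ∑ i, v i • EuclideanSpace.single i (1 : ℝ) := by
    ext j; simp [Pi.single_apply]
  conv_lhs => rw [h]
  simp [pderiv]

theorem ContDiffOn.pderiv_of_isOpen {s : Set (EuclideanSpace ℝ (Fin n))} (hs : IsOpen s)
    (hf : ContDiffOn ℝ ∞ f s) (i : Fin n) : ContDiffOn ℝ ∞ (pderiv i f) s := by
  have := hf.fderiv_of_isOpen hs (m := ∞) (by simp)
  exact this.clm_apply contDiffOn_const

theorem pderiv_comm {s : Set (EuclideanSpace ℝ (Fin n))} (hs : IsOpen s)
    (hf : ContDiffOn ℝ ∞ f s) (hx : x ∈ s) :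
    pderiv i (pderiv j f) x = pderiv j (pderiv i f) x := by
  have hfx : ContDiffAt ℝ ∞ f x := hf.contDiffAt (hs.mem_nhds hx)
  have h := hfx.isSymmSndFDerivAt (by simp; exact WithTop.coe_le_coe.2 le_top)
  have hd : DifferentiableAt ℝ (fderiv ℝ f) x :=
    ((hfx.fderiv_right (m := 1) (by norm_cast)).differentiableAt one_ne_zero)
  have key : ∀ a b : Fin n, pderiv a (pderiv b f) x =
      fderiv ℝ (fderiv ℝ f) x (EuclideanSpace.single a 1) (EuclideanSpace.single b 1) := by
    intro a b
    unfold pderiv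
    rw [fderiv_clm_apply hd (differentiableAt_const _)]
    simp
  rw [key, key, h.eq]

end pderiv

/-! ### Derivatives of determinants -/

section Det

variable {ι : Type*} [Fintype ι] [DecidableEq ι]

theorem differentiableAt_det {V : (EuclideanSpace ℝ (Fin n)) → Matrix ι ι ℝ}
    {x : EuclideanSpace ℝ (Fin n)}
    (hV : ∀ i j, DifferentiableAt ℝ (fun y => V y i j) x) :
    DifferentiableAt ℝ (fun y => (V y).det) x := by
  simp only [Matrix.det_apply]
  refine DifferentiableAt.fun_sum fun σ _ => DifferentiableAt.const_smul ?_ _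
  exact (HasFDerivAt.finsetProd fun i _ =>
      (hV (σ i) i).hasFDerivAt).differentiableAt

/-- Jacobi's formula. -/
theorem pderiv_det {V : (EuclideanSpace ℝ (Fin n)) → Matrix ι ι ℝ}
    {x : EuclideanSpace ℝ (Fin n)} {k : Fin n}
    (hV : ∀ i j, DifferentiableAt ℝ (fun y => V y i j) x) :
    pderiv k (fun y => (V y).det) x =
      ∑ i, ∑ j, (V x).adjugate j i * pderiv k (fun y => V y i j) x := by
  have h1 : pderiv k (fun y => (V y).det) x =
      ∑ i, ((V x).updateRow i (fun j => pderiv k (fun y => V y i j) x)).det := by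
    have hprod : ∀ σ : Equiv.Perm ι, DifferentiableAt ℝ (fun y => ∏ i, V y (σ i) i) x :=
      fun σ => (HasFDerivAt.finsetProd fun i _ =>
      (hV (σ i) i).hasFDerivAt).differentiableAt
    simp only [Matrix.det_apply']
    rw [pderiv_sum fun σ _ => ((hprod σ).const_mul _), Finset.sum_comm]
    refine Finset.sum_congr rfl fun σ _ => ?_
    rw [pderiv_mul (differentiableAt_const _) (hprod σ), pderiv_const, zero_mul, add_zero,
      ← Finset.mul_sum]
    congr 1
    unfold pderiv
    rw [fderiv_finsetProd fun i _ => hV _ _]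
    simp only [FunLike.coe_sum, Finset.sum_apply, FunLike.coe_smul,
      Pi.smul_apply, smul_eq_mul]
    rw [← Equiv.sum_comp σ⁻¹]
    refine Finset.sum_congr rfl fun i _ => ?_
    rw [← Finset.mul_prod_erase _ _ (Finset.mem_univ (σ⁻¹ i)), mul_comm]
    congr 1
    · simp
    · refine Finset.prod_congr rfl fun j hj => ?_
      rw [Matrix.updateRow_ne]
      rintro rfl
      simp at hj
  rw [h1]
  refine Finset.sum_congr rfl fun i _ => ?_
  rw [← Matrix.cramer_transpose_apply, Matrix.cramer_eq_adjugate_mulVec, Matrix.mulVec,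
    dotProduct]
  refine Finset.sum_congr rfl fun j _ => ?_
  rw [← Matrix.adjugate_transpose, Matrix.transpose_apply]

theorem pderiv_log_det {V : (EuclideanSpace ℝ (Fin n)) → Matrix ι ι ℝ}
    {x : EuclideanSpace ℝ (Fin n)} {k : Fin n}
    (hV : ∀ i j, DifferentiableAt ℝ (fun y => V y i j) x) (hdet : 0 < (V x).det) :
    pderiv k (fun y => Real.log (V y).det) x =
      ∑ i, ∑ j, (V x)⁻¹ j i * pderiv k (fun y => V y i j) x := by
  rw [pderiv_comp (Real.hasDerivAt_log hdet.ne') (differentiableAt_det hV), pderiv_det hV,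
    Finset.mul_sum]
  refine Finset.sum_congr rfl fun i _ => ?_
  rw [Finset.mul_sum]
  refine Finset.sum_congr rfl fun j _ => ?_
  rw [Matrix.inv_def, Ring.inverse_eq_inv', Matrix.smul_apply, smul_eq_mul, mul_assoc]

end Det

/-! ### Divergence theorem for compactly supported fields -/

section CompactSupport

variable {s K : Set (EuclideanSpace ℝ (Fin n))} {f : EuclideanSpace ℝ (Fin n) → ℝ}

theorem integrableOn_of_continuousOn_of_eqOn_zero (hK : IsCompact K) (hKs : K ⊆ s)
    (hs : IsOpen s) (hf : ContinuousOn f s) (h0 : ∀ x ∈ s, x ∉ K → f x = 0) :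
    IntegrableOn f s := by
  have h1 : IntegrableOn f K := (hf.mono hKs).integrableOn_compact hK
  exact (h1.of_forall_sdiff_eq_zero hs.measurableSet fun x hx => h0 x hx.1 hx.2)

/-- Extension by zero is `C¹` with compact support on the whole space, where one integrates by parts
against the constant 1. -/
theorem setIntegral_pderiv_eq_zero (hK : IsCompact K) (hKs : K ⊆ s) (hs : IsOpen s)
    (hf : ContDiffOn ℝ 1 f s) (h0 : ∀ x ∈ s, x ∉ K → f x = 0) (i : Fin n) :
    ∫ x in s, pderiv i f x = 0 := by
  set F := s.indicator f with hF
  have hloc : ∀ x ∈ s, F =ᶠ[𝓝 x] f := fun x hx => by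
    filter_upwards [hs.mem_nhds hx] with y hy
    exact indicator_of_mem hy f
  have hloc0 : ∀ x ∉ K, F =ᶠ[𝓝 x] fun _ => 0 := fun x hx => by
    filter_upwards [hK.isClosed.isOpen_compl.mem_nhds hx] with y hy
    by_cases hys : y ∈ s
    · rw [hF, indicator_of_mem hys, h0 y hys hy]
    · rw [hF, indicator_of_notMem hys]
  have hFC : ContDiff ℝ 1 F := by
    rw [contDiff_iff_contDiffAt]
    intro x
    by_cases hx : x ∈ K
    · exact (hf.contDiffAt (hs.mem_nhds (hKs hx))).congr_of_eventuallyEq (hloc x (hKs hx))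
    · exact contDiffAt_const.congr_of_eventuallyEq (hloc0 x hx)
  have hsupp : HasCompactSupport F := HasCompactSupport.intro hK fun x hx =>
    (hloc0 x hx).self_of_nhds
  have hd0 : ∀ x ∉ s, pderiv i F x = 0 := fun x hx => by
    rw [pderiv_congr (hloc0 x fun h => hx (hKs h)), pderiv_const]
  have hcd : Continuous (pderiv i F) := by
    have := hFC.continuous_fderiv one_ne_zero
    exact this.clm_apply continuous_const
  have hcs : HasCompactSupport (pderiv i F) := HasCompactSupport.intro hK fun x hx => by
    rw [pderiv_congr (hloc0 x hx), pderiv_const]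
  have h1 : ∫ x, (1 : ℝ) * fderiv ℝ F x (EuclideanSpace.single i 1) =
      -∫ x, fderiv ℝ (fun _ => (1 : ℝ)) x (EuclideanSpace.single i 1) * F x := by
    refine integral_mul_fderiv_eq_neg_fderiv_mul_of_integrable ?_ ?_ ?_ ?_ ?_
    · simp
    · simp only [one_mul]
      exact hcd.integrable_of_hasCompactSupport hcs
    · simpa using hFC.continuous.integrable_of_hasCompactSupport hsupp
    · exact fun x _ => differentiableAt_const _
    · exact fun x _ => hFC.differentiable one_ne_zero x
  have h2 : ∫ x, pderiv i F x = 0 := by simpa [pderiv] using h1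
  rw [← h2, ← setIntegral_eq_integral_of_forall_compl_eq_zero hd0]
  exact setIntegral_congr_fun hs.measurableSet fun x hx => (pderiv_congr (hloc x hx)).symm

theorem integrableOn_pderiv (hK : IsCompact K) (hKs : K ⊆ s) (hs : IsOpen s)
    (hf : ContDiffOn ℝ 1 f s) (h0 : ∀ x ∈ s, x ∉ K → f x = 0) (i : Fin n) :
    IntegrableOn (pderiv i f) s := by
  refine integrableOn_of_continuousOn_of_eqOn_zero hK hKs hs ?_ ?_
  · have := hf.continuousOn_fderiv_of_isOpen hs le_rfl
    exact this.clm_apply continuousOn_const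
  · intro x hx hxK
    have : f =ᶠ[𝓝 x] fun _ => 0 := by
      filter_upwards [hs.mem_nhds hx, hK.isClosed.isOpen_compl.mem_nhds hxK] with y hy hyK
      exact h0 y hy hyK
    rw [pderiv_congr this, pderiv_const]

/-- The divergence theorem for a vector field with compact support in an open set. -/
theorem setIntegral_divergence_eq_zero (hK : IsCompact K) (hKs : K ⊆ s) (hs : IsOpen s)
    {X : Fin n → EuclideanSpace ℝ (Fin n) → ℝ} (hX : ∀ i, ContDiffOn ℝ 1 (X i) s)
    (h0 : ∀ i, ∀ x ∈ s, x ∉ K → X i x = 0) :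
    IntegrableOn (fun x => ∑ i, pderiv i (X i) x) s ∧ ∫ x in s, ∑ i, pderiv i (X i) x = 0 := by
  have hint := fun i => integrableOn_pderiv hK hKs hs (hX i) (h0 i) i
  refine ⟨integrable_finsetSum _ fun i _ => hint i, ?_⟩
  rw [integral_finsetSum _ fun i _ => hint i]
  exact Finset.sum_eq_zero fun i _ => setIntegral_pderiv_eq_zero hK hKs hs (hX i) (h0 i) i

end CompactSupport

/-! ### Truncated powers -/

section PosPart

/-- All cutoffs below are truncated powers. Their derivatives are again truncated powers, so
successive derivatives can be compared with one another, which `cutoffDensity_absorb` relies on. -/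
theorem hasDerivAt_max_zero_pow (k : ℕ) (t : ℝ) :
    HasDerivAt (fun t : ℝ => (max t 0) ^ (k + 2)) (((k + 2 : ℕ) : ℝ) * (max t 0) ^ (k + 1)) t := by
  rcases lt_trichotomy t 0 with ht | rfl | ht
  · have : (fun t : ℝ => (max t 0) ^ (k + 2)) =ᶠ[𝓝 t] fun _ => 0 := by
      filter_upwards [Iio_mem_nhds ht] with y hy
      simp [max_eq_right (le_of_lt (mem_Iio.1 hy))]
    rw [max_eq_right ht.le]
    simpa using (hasDerivAt_const t (0 : ℝ)).congr_of_eventuallyEq this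
  · simp only [max_self, ne_eq, Nat.add_eq_zero_iff, one_ne_zero, and_false, not_false_eq_true,
      zero_pow, mul_zero]
    rw [hasDerivAt_iff_isLittleO_nhds_zero]
    simp only [zero_add, max_self, ne_eq, Nat.add_eq_zero_iff, OfNat.ofNat_ne_zero, and_false,
      not_false_eq_true, zero_pow, sub_zero, smul_zero]
    have h1 : (fun h : ℝ => (max h 0) ^ (k + 2)) =O[𝓝 0] fun h : ℝ => h ^ (k + 2) :=
      Asymptotics.isBigO_of_le _ fun h => by
        rw [norm_pow, norm_pow]
        gcongr
        rcases le_total h 0 with h0 | h0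
        · simp [max_eq_right h0]
        · simp [max_eq_left h0]
    refine h1.trans_isLittleO ?_
    have := Asymptotics.isLittleO_pow_pow (𝕜 := ℝ) (m := 1) (n := k + 2) (by omega)
    simpa using this
  · have : (fun t : ℝ => (max t 0) ^ (k + 2)) =ᶠ[𝓝 t] fun t => t ^ (k + 2) := by
      filter_upwards [Ioi_mem_nhds ht] with y hy
      rw [max_eq_left (le_of_lt (mem_Ioi.1 hy))]
    rw [max_eq_left ht.le]
    exact (hasDerivAt_pow (k + 2) t).congr_of_eventuallyEq this

theorem contDiff_max_zero_pow (k : ℕ) : ContDiff ℝ 1 (fun t : ℝ => (max t 0) ^ (k + 2)) := by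
  rw [contDiff_one_iff_deriv]
  refine ⟨fun t => (hasDerivAt_max_zero_pow k t).differentiableAt, ?_⟩
  have : deriv (fun t : ℝ => (max t 0) ^ (k + 2)) =
      fun t => ((k + 2 : ℕ) : ℝ) * (max t 0) ^ (k + 1) := by
    ext t; exact (hasDerivAt_max_zero_pow k t).deriv
  rw [this]
  fun_prop

end PosPart

end Abreu

/-! ### Elementary geometry of the polytope -/

namespace Abreu
namespace Polytope

variable {n m : ℕ} (Δ : Polytope n m)

theorem continuous_δ (k : Fin m) : Continuous (Δ.δ k) := by
  unfold δ; fun_prop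

theorem δ_lineMap (k : Fin m) (x y : EuclideanSpace ℝ (Fin n)) (t : ℝ) :
    Δ.δ k (x + t • (y - x)) = (1 - t) * Δ.δ k x + t * Δ.δ k y := by
  simp only [δ, inner_add_right, inner_smul_right, inner_sub_right]; ring

theorem δ_eq_add (k : Fin m) (x y : EuclideanSpace ℝ (Fin n)) :
    Δ.δ k x = Δ.δ k y + ∑ i, Δ.a k i * (x i - y i) := by
  have h : inner ℝ (Δ.a k) (x - y) = ∑ i, Δ.a k i * (x i - y i) := by
    simp [PiLp.inner_apply, mul_comm]
  rw [← h, inner_sub_right]; unfold δ; ring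

theorem isOpen_int : IsOpen Δ.int := by
  have h : Δ.int = ⋂ k, {x | 0 < Δ.δ k x} := by ext x; simp [int]
  rw [h]
  exact isOpen_iInter_of_finite fun k => isOpen_lt continuous_const (Δ.continuous_δ k)

theorem isBounded_int : Bornology.IsBounded Δ.int := Δ.bounded

theorem nonempty_int : Δ.int.Nonempty := Δ.nonempty

theorem convex_int : Convex ℝ Δ.int := by
  rw [convex_iff_forall_pos]
  intro x hx y hy a b ha hb hab k
  have := Δ.δ_lineMap k x y b
  have h2 : a • x + b • y = x + b • (y - x) := by
    rw [show a = 1 - b by linarith]; module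
  rw [h2, this, show 1 - b = a by linarith]
  have := hx k; have := hy k
  positivity

theorem lineMap_mem_int {x y : EuclideanSpace ℝ (Fin n)} (hx : x ∈ Δ.int)
    (hy : ∀ k, 0 ≤ Δ.δ k y) {t : ℝ} (h0 : 0 ≤ t) (h1 : t < 1) : x + t • (y - x) ∈ Δ.int := by
  intro k
  rw [Δ.δ_lineMap]
  have := hx k
  have := hy k
  have : 0 < 1 - t := by linarith
  positivity

theorem mem_closed_iff {x : EuclideanSpace ℝ (Fin n)} : x ∈ Δ.closed ↔ ∀ k, 0 ≤ Δ.δ k x := by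
  constructor
  · intro hx k
    have hc : IsClosed {x | 0 ≤ Δ.δ k x} := isClosed_le continuous_const (Δ.continuous_δ k)
    exact closure_minimal (fun y hy => (hy k).le) hc hx
  · intro hx
    obtain ⟨p, hp⟩ := Δ.nonempty_int
    have h1 : Tendsto (fun t : ℝ => p + t • (x - p)) (𝓝[<] 1) (𝓝 x) := by
      have : Tendsto (fun t : ℝ => p + t • (x - p)) (𝓝 1) (𝓝 (p + (1 : ℝ) • (x - p))) :=
        Continuous.tendsto (by fun_prop) 1
      simpa using this.mono_left nhdsWithin_le_nhds
    refine mem_closure_of_tendsto h1 ?_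
    filter_upwards [Ioo_mem_nhdsLT (show (0 : ℝ) < 1 by norm_num)] with t ht
    exact Δ.lineMap_mem_int hp hx ht.1.le ht.2

theorem int_subset_closed : Δ.int ⊆ Δ.closed := subset_closure

theorem isCompact_closed : IsCompact Δ.closed := Δ.isBounded_int.isCompact_closure

theorem convex_closed : Convex ℝ Δ.closed := Δ.convex_int.closure

theorem uniqueDiffOn_closed : UniqueDiffOn ℝ Δ.closed := by
  refine uniqueDiffOn_convex Δ.convex_closed ?_
  exact Δ.nonempty_int.mono (interior_maximal Δ.int_subset_closed Δ.isOpen_int)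

theorem openFacet_subset_closed (k : Fin m) : Δ.openFacet k ⊆ Δ.closed := by
  intro x hx
  rw [mem_closed_iff]
  intro j
  by_cases h : j = k
  · rw [h, hx.1]
  · exact (hx.2 j h).le

theorem measurableSet_openFacet (k : Fin m) : MeasurableSet (Δ.openFacet k) := by
  have : Δ.openFacet k = {x | Δ.δ k x = 0} ∩ ⋂ j, ⋂ (_ : j ≠ k), {x | 0 < Δ.δ j x} := by
    ext x; simp [openFacet]
  rw [this]
  refine (isClosed_eq (Δ.continuous_δ k) continuous_const).measurableSet.inter ?_
  refine MeasurableSet.iInter fun j => MeasurableSet.iInter fun _ => ?_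
  exact (isOpen_lt continuous_const (Δ.continuous_δ j)).measurableSet

theorem star_subset_closed : Δ.star ⊆ Δ.closed :=
  union_subset Δ.int_subset_closed (iUnion_subset Δ.openFacet_subset_closed)

theorem a_ne_zero (k : Fin m) : Δ.a k ≠ 0 := by
  intro h
  obtain ⟨x, hx⟩ := Δ.nonempty
  obtain ⟨y, hy, -⟩ := Δ.facet k
  have h1 := hx k
  simp only [h, inner_zero_left] at h1 hy
  linarith

theorem exists_δ_le : ∃ R : ℝ, 1 ≤ R ∧ ∀ x ∈ Δ.closed, ∀ k, Δ.δ k x ≤ R := by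
  have h : ∀ k, ∃ R : ℝ, ∀ x ∈ Δ.closed, Δ.δ k x ≤ R := fun k => by
    obtain ⟨R, hR⟩ := Δ.isCompact_closed.bddAbove_image (Δ.continuous_δ k).continuousOn
    exact ⟨R, fun x hx => hR (mem_image_of_mem _ hx)⟩
  choose R hR using h
  refine ⟨1 + ∑ k, |R k|, ?_, fun x hx k => ?_⟩
  · have : 0 ≤ ∑ k, |R k| := Finset.sum_nonneg fun k _ => abs_nonneg _
    linarith
  · have h1 := Finset.single_le_sum (f := fun k => |R k|) (fun k _ => abs_nonneg _)
      (Finset.mem_univ k)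
    have h2 := hR k x hx
    have h3 := le_abs_self (R k)
    linarith

theorem isCompact_le_δ (c : Fin m → ℝ) : IsCompact {x ∈ Δ.closed | ∀ k, c k ≤ Δ.δ k x} := by
  refine Δ.isCompact_closed.inter_right (t := {x | ∀ k, c k ≤ Δ.δ k x}) ?_
  have h : {x | ∀ k, c k ≤ Δ.δ k x} = ⋂ k, {x | c k ≤ Δ.δ k x} := by ext x; simp
  rw [h]
  exact isClosed_iInter fun k => isClosed_le continuous_const (Δ.continuous_δ k)

theorem hasFDerivAt_δ (k : Fin m) (x : EuclideanSpace ℝ (Fin n)) :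
    HasFDerivAt (Δ.δ k) (innerSL ℝ (Δ.a k)) x := by
  unfold δ
  exact (innerSL ℝ (Δ.a k)).hasFDerivAt.sub_const _

theorem differentiableAt_δ (k : Fin m) (x : EuclideanSpace ℝ (Fin n)) :
    DifferentiableAt ℝ (Δ.δ k) x := (Δ.hasFDerivAt_δ k x).differentiableAt

theorem contDiff_δ (k : Fin m) : ContDiff ℝ ∞ (Δ.δ k) := by
  unfold δ
  exact (innerSL ℝ (Δ.a k)).contDiff.sub contDiff_const

theorem pderiv_δ (i : Fin n) (k : Fin m) (x : EuclideanSpace ℝ (Fin n)) :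
    pderiv i (Δ.δ k) x = Δ.a k i := by
  unfold pderiv
  rw [(Δ.hasFDerivAt_δ k x).fderiv]
  simp [PiLp.inner_apply]

section Bounds

variable {Δ}

/-- The derivative within the closed polytope is again smooth there, since that set has unique
differentials; it agrees with the ordinary derivative in the interior, and compactness bounds it. -/
theorem exists_abs_le_of_contDiffOn_closed {g : EuclideanSpace ℝ (Fin n) → ℝ}
    (hg : ContDiffOn ℝ ∞ g Δ.closed) : ∃ C : ℝ, 0 ≤ C ∧ ∀ x ∈ Δ.int,
      |g x| ≤ C ∧ (∀ i, |pderiv i g x| ≤ C) ∧ ∀ i j, |pderiv i (pderiv j g) x| ≤ C := by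
  have hb : ∀ g : EuclideanSpace ℝ (Fin n) → ℝ, ContDiffOn ℝ ∞ g Δ.closed →
      ∃ C : ℝ, 0 ≤ C ∧ ∀ x ∈ Δ.int, |g x| ≤ C := fun g hg => by
    obtain ⟨C, hC⟩ := Δ.isCompact_closed.exists_bound_of_continuousOn hg.continuousOn
    exact ⟨max C 0, le_max_right _ _, fun x hx =>
      (hC x (Δ.int_subset_closed hx)).trans (le_max_left _ _)⟩
  have hd : ∀ g : EuclideanSpace ℝ (Fin n) → ℝ, ContDiffOn ℝ ∞ g Δ.closed → ∀ i : Fin n,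
      ∃ h : EuclideanSpace ℝ (Fin n) → ℝ, ContDiffOn ℝ ∞ h Δ.closed ∧
        ∀ x ∈ Δ.int, pderiv i g x = h x := fun g hg i => by
    refine ⟨fun x => fderivWithin ℝ g Δ.closed x (EuclideanSpace.single i 1), ?_, ?_⟩
    · have := hg.fderivWithin Δ.uniqueDiffOn_closed (m := ∞) (by simp)
      exact this.clm_apply contDiffOn_const
    · intro x hx
      unfold pderiv
      beta_reduce
      rw [fderivWithin_of_mem_nhds]
      exact mem_of_superset (Δ.isOpen_int.mem_nhds hx) Δ.int_subset_closed
  choose! D hD1 hD2 using hd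
  choose! B hB0 hB using hb
  have e2 : ∀ x ∈ Δ.int, ∀ i j, pderiv i (pderiv j g) x = D (D g j) i x := fun x hx i j => by
    rw [← hD2 _ (hD1 g hg j) i x hx]
    refine pderiv_congr ?_
    filter_upwards [Δ.isOpen_int.mem_nhds hx] with y hy
    exact hD2 g hg j y hy
  have s1 : 0 ≤ ∑ i, B (D g i) := Finset.sum_nonneg fun i _ => hB0 _ (hD1 g hg i)
  have s2 : 0 ≤ ∑ i, ∑ j, B (D (D g j) i) := Finset.sum_nonneg fun i _ =>
    Finset.sum_nonneg fun j _ => hB0 _ (hD1 _ (hD1 g hg j) i)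
  refine ⟨B g + ∑ i, B (D g i) + ∑ i, ∑ j, B (D (D g j) i), ?_, fun x hx => ⟨?_, ?_, ?_⟩⟩
  · have := hB0 g hg
    linarith
  · have := hB g hg x hx
    linarith
  · intro i
    rw [hD2 g hg i x hx]
    have h1 := hB _ (hD1 g hg i) x hx
    have h2 := Finset.single_le_sum (f := fun i => B (D g i)) (fun i _ => hB0 _ (hD1 g hg i))
      (Finset.mem_univ i)
    have := hB0 g hg
    linarith
  · intro i j
    rw [e2 x hx i j]
    have h1 := hB _ (hD1 _ (hD1 g hg j) i) x hx
    have h2 := Finset.single_le_sum (f := fun j => B (D (D g j) i))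
      (fun j _ => hB0 _ (hD1 _ (hD1 g hg j) i)) (Finset.mem_univ j)
    have h3 := Finset.single_le_sum (f := fun i => ∑ j, B (D (D g j) i))
      (fun i _ => Finset.sum_nonneg fun j _ => hB0 _ (hD1 _ (hD1 g hg j) i)) (Finset.mem_univ i)
    have := hB0 g hg
    linarith

theorem exists_coord_sub_le (p : EuclideanSpace ℝ (Fin n)) :
    ∃ C : ℝ, 0 ≤ C ∧ ∀ x ∈ Δ.closed, ∀ i, |x i - p i| ≤ C := by
  obtain ⟨C, hC⟩ := Δ.isCompact_closed.exists_bound_of_continuousOn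
    (f := fun x => x - p) (by fun_prop)
  refine ⟨max C 0, le_max_right _ _, fun x hx i => ?_⟩
  have h1 := PiLp.norm_apply_le (x - p) i
  simp only [PiLp.sub_apply, Real.norm_eq_abs] at h1
  exact (h1.trans (hC x hx)).trans (le_max_left _ _)

end Bounds

end Polytope
-- Boundary asymptotics of functions in the class `𝒮`
/-- The Legendre transform of `v` centred at `p`, as a function of the original variable. -/
def legendre {n : ℕ} (p : EuclideanSpace ℝ (Fin n)) (v : EuclideanSpace ℝ (Fin n) → ℝ)
    (x : EuclideanSpace ℝ (Fin n)) : ℝ :=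
  ∑ j, (x j - p j) * pderiv j v x - v x

/-- The Hessian of `v` at `x` evaluated on the radial vector `x - p`. -/
def radialHess {n : ℕ} (p : EuclideanSpace ℝ (Fin n)) (v : EuclideanSpace ℝ (Fin n) → ℝ)
    (x : EuclideanSpace ℝ (Fin n)) : ℝ :=
  ∑ i, ∑ j, hess v x i j * ((x i - p i) * (x j - p j))

namespace Polytope

variable {n m : ℕ} (Δ : Polytope n m)

theorem contDiffOn_guillemin : ContDiffOn ℝ ∞ Δ.guillemin Δ.int := by
  unfold guillemin
  refine ContDiffOn.sum fun k _ => ?_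
  refine (Δ.contDiff_δ k).contDiffOn.mul ?_
  exact (Δ.contDiff_δ k).contDiffOn.log fun x hx => (hx k).ne'

theorem pderiv_guillemin {x : EuclideanSpace ℝ (Fin n)} (hx : x ∈ Δ.int) (i : Fin n) :
    pderiv i Δ.guillemin x = ∑ k, Δ.a k i * (Real.log (Δ.δ k x) + 1) := by
  have hd := fun k => Δ.differentiableAt_δ k x
  have hl : ∀ k, DifferentiableAt ℝ (fun y => Real.log (Δ.δ k y)) x :=
    fun k => (hd k).log (hx k).ne'
  unfold guillemin
  rw [pderiv_sum fun k _ => (hd k).fun_mul (hl k)]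
  refine Finset.sum_congr rfl fun k _ => ?_
  rw [pderiv_mul (hd k) (hl k), pderiv_comp (Real.hasDerivAt_log (hx k).ne') (hd k), pderiv_δ]
  have := (hx k).ne'
  field_simp
  ring

theorem pderiv_pderiv_guillemin {x : EuclideanSpace ℝ (Fin n)} (hx : x ∈ Δ.int) (i j : Fin n) :
    pderiv i (pderiv j Δ.guillemin) x = ∑ k, Δ.a k i * Δ.a k j / Δ.δ k x := by
  have hd := fun k => Δ.differentiableAt_δ k x
  have hl : ∀ k, DifferentiableAt ℝ (fun y => Real.log (Δ.δ k y)) x :=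
    fun k => (hd k).log (hx k).ne'
  have h : pderiv j Δ.guillemin =ᶠ[𝓝 x] fun y => ∑ k, Δ.a k j * (Real.log (Δ.δ k y) + 1) := by
    filter_upwards [Δ.isOpen_int.mem_nhds hx] with y hy
    exact Δ.pderiv_guillemin hy j
  rw [pderiv_congr h, pderiv_sum fun k _ => ((hl k).add_const _).const_mul _]
  refine Finset.sum_congr rfl fun k _ => ?_
  rw [pderiv_mul (differentiableAt_const _) ((hl k).add_const _), pderiv_const,
    pderiv_add (hl k) (differentiableAt_const _), pderiv_const,
    pderiv_comp (Real.hasDerivAt_log (hx k).ne') (hd k), pderiv_δ]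
  have := (hx k).ne'
  field_simp
  ring

variable {Δ} {v : EuclideanSpace ℝ (Fin n) → ℝ}

namespace MemS

theorem contDiffOn_int (hv : Δ.MemS v) : ContDiffOn ℝ ∞ v Δ.int := by
  have := (hv.smooth.mono Δ.int_subset_closed).add Δ.contDiffOn_guillemin
  exact this.congr fun x _ => by simp

theorem pderiv_eq (hv : Δ.MemS v) {x : EuclideanSpace ℝ (Fin n)} (hx : x ∈ Δ.int) (i : Fin n) :
    pderiv i v x = ∑ k, Δ.a k i * (Real.log (Δ.δ k x) + 1) +
      pderiv i (fun x => v x - Δ.guillemin x) x := by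
  have h1 := (hv.contDiffOn_int.contDiffAt (Δ.isOpen_int.mem_nhds hx)).differentiableAt
    (by simp)
  have h2 := (Δ.contDiffOn_guillemin.contDiffAt (Δ.isOpen_int.mem_nhds hx)).differentiableAt
    (by simp)
  rw [pderiv_sub h1 h2, Δ.pderiv_guillemin hx]; ring

theorem hess_eq (hv : Δ.MemS v) {x : EuclideanSpace ℝ (Fin n)} (hx : x ∈ Δ.int) (i j : Fin n) :
    hess v x i j = ∑ k, Δ.a k i * Δ.a k j / Δ.δ k x +
      hess (fun x => v x - Δ.guillemin x) x i j := by
  have h1 := ((ContDiffOn.pderiv_of_isOpen Δ.isOpen_int hv.contDiffOn_int j).contDiffAt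
    (Δ.isOpen_int.mem_nhds hx)).differentiableAt (by simp)
  have h2 := ((ContDiffOn.pderiv_of_isOpen Δ.isOpen_int Δ.contDiffOn_guillemin j).contDiffAt
    (Δ.isOpen_int.mem_nhds hx)).differentiableAt (by simp)
  have h : pderiv j (fun x => v x - Δ.guillemin x) =ᶠ[𝓝 x]
      fun y => pderiv j v y - pderiv j Δ.guillemin y := by
    filter_upwards [Δ.isOpen_int.mem_nhds hx] with y hy
    rw [hv.pderiv_eq hy, Δ.pderiv_guillemin hy]; ring
  simp only [hess, Matrix.of_apply]
  rw [pderiv_congr h, pderiv_sub h1 h2, Δ.pderiv_pderiv_guillemin hx]; ring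

/-- Since `a_k·(x - p) = δ_k(x) - δ_k(p)`, the facet `k` contributes `-δ_k(p) log δ_k + δ_k -
δ_k(p)` to the transform of `u_o`: the products `δ_k log δ_k` cancel. The smooth remainder `v - u_o`
contributes a bounded amount. -/
theorem exists_legendre_bound (hv : Δ.MemS v) {p : EuclideanSpace ℝ (Fin n)} (hp : p ∈ Δ.int) :
    ∃ C : ℝ, 0 ≤ C ∧ ∀ x ∈ Δ.int,
      |legendre p v x + ∑ k, Δ.δ k p * Real.log (Δ.δ k x)| ≤ C := by
  obtain ⟨C, hC0, hC⟩ := exists_abs_le_of_contDiffOn_closed hv.smooth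
  obtain ⟨B, hB0, hB⟩ := exists_coord_sub_le (Δ := Δ) p
  obtain ⟨R, hR1, hR⟩ := Δ.exists_δ_le
  refine ⟨m * R + n * (B * C) + C, by positivity, fun x hx => ?_⟩
  obtain ⟨c0, c1, -⟩ := hC x hx
  have hxc := Δ.int_subset_closed hx
  have e : legendre p v x + ∑ k, Δ.δ k p * Real.log (Δ.δ k x) = ∑ k, (Δ.δ k x - Δ.δ k p) +
      ∑ j, (x j - p j) * pderiv j (fun x => v x - Δ.guillemin x) x -
        (v x - Δ.guillemin x) := by
    have e1 : ∑ j, (x j - p j) * pderiv j v x =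
        ∑ k, (Δ.δ k x - Δ.δ k p) * (Real.log (Δ.δ k x) + 1) +
        ∑ j, (x j - p j) * pderiv j (fun x => v x - Δ.guillemin x) x := by
      have : ∀ k, (Δ.δ k x - Δ.δ k p) * (Real.log (Δ.δ k x) + 1) =
          ∑ j, (x j - p j) * (Δ.a k j * (Real.log (Δ.δ k x) + 1)) := fun k => by
        rw [Δ.δ_eq_add k x p, add_sub_cancel_left, Finset.sum_mul]
        exact Finset.sum_congr rfl fun j _ => by ring
      simp only [this]
      rw [Finset.sum_comm, ← Finset.sum_add_distrib]
      refine Finset.sum_congr rfl fun j _ => ?_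
      rw [hv.pderiv_eq hx, mul_add, Finset.mul_sum]
    have e2 : ∑ k, (Δ.δ k x - Δ.δ k p) * (Real.log (Δ.δ k x) + 1) = Δ.guillemin x -
        ∑ k, Δ.δ k p * Real.log (Δ.δ k x) + ∑ k, (Δ.δ k x - Δ.δ k p) := by
      unfold guillemin
      rw [← Finset.sum_sub_distrib, ← Finset.sum_add_distrib]
      exact Finset.sum_congr rfl fun k _ => by ring
    unfold legendre
    rw [e1, e2]; ring
  have b1 : |∑ k, (Δ.δ k x - Δ.δ k p)| ≤ m * R := by
    refine (Finset.abs_sum_le_sum_abs _ _).trans ?_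
    refine (Finset.sum_le_card_nsmul _ _ R fun k _ => ?_).trans (by simp)
    have := hR x hxc k; have := hR p (Δ.int_subset_closed hp) k
    have := hx k; have := hp k
    rw [abs_le]; constructor <;> linarith
  have b2 : |∑ j, (x j - p j) * pderiv j (fun x => v x - Δ.guillemin x) x| ≤ n * (B * C) := by
    refine (Finset.abs_sum_le_sum_abs _ _).trans ?_
    refine (Finset.sum_le_card_nsmul _ _ (B * C) fun j _ => ?_).trans (by simp)
    rw [abs_mul]
    exact mul_le_mul (hB x hxc j) (c1 j) (abs_nonneg _) hB0
  rw [e]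
  refine (abs_sub _ _).trans ?_
  refine add_le_add ((abs_add_le _ _).trans (add_le_add b1 b2)) c0

/-- The Hessian of `u_o` is `∑ a_k a_kᵀ / δ_k`, and pairing `a_k` with `x - p` gives `δ_k(x) -
δ_k(p)`. -/
theorem exists_radialHess_bound (hv : Δ.MemS v) (p : EuclideanSpace ℝ (Fin n)) :
    ∃ C : ℝ, 0 ≤ C ∧ ∀ x ∈ Δ.int,
      |radialHess p v x - ∑ k, (Δ.δ k x - Δ.δ k p) ^ 2 / Δ.δ k x| ≤ C := by
  obtain ⟨C, hC0, hC⟩ := exists_abs_le_of_contDiffOn_closed hv.smooth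
  obtain ⟨B, hB0, hB⟩ := exists_coord_sub_le (Δ := Δ) p
  refine ⟨n * (n * (C * (B * B))), by positivity, fun x hx => ?_⟩
  obtain ⟨-, -, c2⟩ := hC x hx
  have hxc := Δ.int_subset_closed hx
  have e : radialHess p v x - ∑ k, (Δ.δ k x - Δ.δ k p) ^ 2 / Δ.δ k x =
      ∑ i, ∑ j, hess (fun x => v x - Δ.guillemin x) x i j * ((x i - p i) * (x j - p j)) := by
    have e1 : ∑ k, (Δ.δ k x - Δ.δ k p) ^ 2 / Δ.δ k x =
        ∑ i, ∑ j, (∑ k, Δ.a k i * Δ.a k j / Δ.δ k x) * ((x i - p i) * (x j - p j)) := by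
      have : ∀ k, (Δ.δ k x - Δ.δ k p) ^ 2 / Δ.δ k x =
          ∑ i, ∑ j, Δ.a k i * Δ.a k j / Δ.δ k x * ((x i - p i) * (x j - p j)) := fun k => by
        rw [Δ.δ_eq_add k x p, add_sub_cancel_left, ← Δ.δ_eq_add k x p, sq, Finset.sum_mul_sum,
          Finset.sum_div]
        refine Finset.sum_congr rfl fun i _ => ?_
        rw [Finset.sum_div]
        exact Finset.sum_congr rfl fun j _ => by ring
      simp only [this, Finset.sum_mul]
      rw [Finset.sum_comm]
      refine Finset.sum_congr rfl fun i _ => ?_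
      rw [Finset.sum_comm]
    rw [e1, radialHess, ← Finset.sum_sub_distrib]
    refine Finset.sum_congr rfl fun i _ => ?_
    rw [← Finset.sum_sub_distrib]
    refine Finset.sum_congr rfl fun j _ => ?_
    rw [hv.hess_eq hx]; ring
  rw [e]
  refine (Finset.abs_sum_le_sum_abs _ _).trans ?_
  refine (Finset.sum_le_card_nsmul _ _ (n * (C * (B * B))) fun i _ => ?_).trans (by simp)
  refine (Finset.abs_sum_le_sum_abs _ _).trans ?_
  refine (Finset.sum_le_card_nsmul _ _ (C * (B * B)) fun j _ => ?_).trans (by simp)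
  rw [abs_mul, abs_mul]
  exact mul_le_mul (c2 i j) (mul_le_mul (hB x hxc i) (hB x hxc j) (abs_nonneg _) hB0)
    (by positivity) hC0

/-- The Hessian is at most `c + ∑ a_k a_kᵀ / δ_k`, whose determinant is at most a constant times `∏
δ_k⁻¹`. No matching lower bound on the determinant is required later. -/
theorem exists_log_det_le (hv : Δ.MemS v) : ∃ C : ℝ, ∀ x ∈ Δ.int, (hess v x).PosDef →
    Real.log (hess v x).det ≤ C - ∑ k, Real.log (Δ.δ k x) := by
  obtain ⟨C, hC0, hC⟩ := exists_abs_le_of_contDiffOn_closed hv.smooth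
  obtain ⟨R, hR1, hR⟩ := Δ.exists_δ_le
  -- A symmetric form with entries bounded by `C` is at most `n C`; the extra 1 keeps `c` positive.
  set c : ℝ := n * C + 1 with hc
  have hc0 : 0 < c := by positivity
  set q : Fin m → ℝ := fun k => (Δ.a k : Fin n → ℝ) ⬝ᵥ (Δ.a k : Fin n → ℝ) with hq
  have hq0 : ∀ k, 0 ≤ q k := fun k => by
    simpa [hq] using dotProduct_star_self_nonneg (Δ.a k : Fin n → ℝ)
  refine ⟨n * Real.log c + ∑ k, Real.log (R + q k / c), fun x hx hpd => ?_⟩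
  obtain ⟨-, -, c2⟩ := hC x hx
  set W : Matrix (Fin n) (Fin n) ℝ := c • 1 + ∑ k, (Δ.δ k x)⁻¹ •
    Matrix.vecMulVec (Δ.a k : Fin n → ℝ) (Δ.a k : Fin n → ℝ) with hW
  have ht : ∀ k ∈ Finset.univ, 0 ≤ (Δ.δ k x)⁻¹ := fun k _ => (inv_pos.2 (hx k)).le
  have hWpd : W.PosDef := (Matrix.posDef_smul_one_add_sum hc0 ht _).1
  have hWdet := Matrix.det_smul_one_add_sum_le hc0 Finset.univ ht
    (fun k => (Δ.a k : Fin n → ℝ))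
  rw [← hW] at hWdet
  have hsub : (W - hess v x).PosSemidef := by
    refine Matrix.PosSemidef.of_dotProduct_mulVec_nonneg (hWpd.1.sub hpd.1) fun y => ?_
    have e : W - hess v x = c • 1 - hess (fun x => v x - Δ.guillemin x) x := by
      ext i j
      rw [Matrix.sub_apply, hv.hess_eq hx, hW, Matrix.add_apply, Matrix.sum_apply,
        Matrix.sub_apply]
      have : ∑ k, ((Δ.δ k x)⁻¹ •
          Matrix.vecMulVec (Δ.a k : Fin n → ℝ) (Δ.a k : Fin n → ℝ)) i j =
          ∑ k, Δ.a k i * Δ.a k j / Δ.δ k x :=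
        Finset.sum_congr rfl fun k _ => by
          simp [Matrix.vecMulVec_apply]; ring
      rw [this]; ring
    rw [e]
    simp only [star_trivial, Matrix.sub_mulVec, dotProduct_sub, Matrix.smul_mulVec,
      Matrix.one_mulVec, dotProduct_smul, smul_eq_mul, sub_nonneg]
    have h1 : y ⬝ᵥ (hess (fun x => v x - Δ.guillemin x) x).mulVec y ≤
        ∑ i, ∑ j, C * ((y i ^ 2 + y j ^ 2) / 2) := by
      simp only [dotProduct, Matrix.mulVec, Finset.mul_sum]
      refine Finset.sum_le_sum fun i _ => Finset.sum_le_sum fun j _ => ?_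
      have h2 := c2 i j
      have h3 : y i * (hess (fun x => v x - Δ.guillemin x) x i j * y j) ≤
          |hess (fun x => v x - Δ.guillemin x) x i j| * |y i * y j| := by
        rw [← abs_mul]
        exact (le_abs_self _).trans_eq (by congr 1; ring)
      refine h3.trans (mul_le_mul h2 ?_ (abs_nonneg _) hC0)
      rw [abs_le]; constructor <;> nlinarith [sq_nonneg (y i + y j), sq_nonneg (y i - y j)]
    have h4 : ∑ i, ∑ j, C * ((y i ^ 2 + y j ^ 2) / 2) = n * C * (y ⬝ᵥ y) := by
      simp only [dotProduct, ← Finset.mul_sum, ← Finset.sum_div, Finset.sum_add_distrib,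
        Finset.sum_const, Finset.card_univ, Fintype.card_fin, nsmul_eq_mul, ← sq]
      ring
    have h5 : 0 ≤ y ⬝ᵥ y := by simpa using dotProduct_star_self_nonneg y
    rw [hc]; nlinarith
  have h1 := (hpd.det_le_of_sub_posSemidef hWpd hsub).trans hWdet
  rw [Fintype.card_fin] at h1
  have hfac : ∀ k, 1 + (Δ.δ k x)⁻¹ * q k / c ≤ (R + q k / c) / Δ.δ k x := fun k => by
    have h2 := hx k
    have h3 := hR x (Δ.int_subset_closed hx) k
    rw [le_div_iff₀ h2]
    have : (1 + (Δ.δ k x)⁻¹ * q k / c) * Δ.δ k x = Δ.δ k x + q k / c := by field_simp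
    rw [this]; linarith
  have hpos : ∀ k, 0 < R + q k / c := fun k => by have := hq0 k; positivity
  have h2 : (hess v x).det ≤ c ^ n * ∏ k, ((R + q k / c) / Δ.δ k x) := by
    refine h1.trans (mul_le_mul_of_nonneg_left ?_ (by positivity))
    refine Finset.prod_le_prod (fun k _ => ?_) fun k _ => hfac k
    have := hq0 k; have := hx k
    positivity
  refine (Real.log_le_log hpd.det_pos h2).trans_eq ?_
  have hne : ∀ k ∈ Finset.univ, (R + q k / c) / Δ.δ k x ≠ 0 :=
    fun k _ => (div_pos (hpos k) (hx k)).ne'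
  rw [Real.log_mul (by positivity) (Finset.prod_ne_zero_iff.2 hne), Real.log_pow,
    Real.log_prod hne, add_sub_assoc, ← Finset.sum_sub_distrib]
  congr 1
  exact Finset.sum_congr rfl fun k _ => Real.log_div (hpos k).ne' (hx k).ne'

end MemS
end Polytope
-- Slicing by hyperplanes parallel to a facet
theorem measurable_indicator_of_continuousOn {X : Type*} [TopologicalSpace X] [MeasurableSpace X]
    [OpensMeasurableSpace X] {s : Set X} (hs : MeasurableSet s) {u : X → ℝ}
    (hu : ContinuousOn u s) : Measurable (s.indicator u) := by
  classical
  have := hu.measurable_piecewise (g := fun _ => (0 : ℝ)) continuousOn_const hs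
  rwa [show (fun _ : X => (0 : ℝ)) = 0 from rfl, piecewise_eq_indicator] at this

namespace Polytope

variable {n m : ℕ} (Δ : Polytope n m) (k : Fin m)

/-- The parametrization of the hyperplane `δ_k = s` by the orthogonal complement of `a_k`. -/
def slice (s : ℝ) (y : (ℝ ∙ Δ.a k)ᗮ) : EuclideanSpace ℝ (Fin n) :=
  ((Δ.c k + s) / ‖Δ.a k‖ ^ 2) • Δ.a k + (y : EuclideanSpace ℝ (Fin n))

theorem norm_a_pos : 0 < ‖Δ.a k‖ := norm_pos_iff.2 (Δ.a_ne_zero k)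

theorem inner_a_coe (y : (ℝ ∙ Δ.a k)ᗮ) : inner ℝ (Δ.a k) (y : EuclideanSpace ℝ (Fin n)) = 0 :=
  Submodule.mem_orthogonal_singleton_iff_inner_right.1 y.2

theorem δ_slice (s : ℝ) (y : (ℝ ∙ Δ.a k)ᗮ) : Δ.δ k (Δ.slice k s y) = s := by
  have := (Δ.norm_a_pos k).ne'
  simp only [δ, slice, inner_add_right, inner_smul_right, inner_a_coe, real_inner_self_eq_norm_sq]
  field_simp
  ring

theorem continuous_slice : Continuous fun z : ℝ × (ℝ ∙ Δ.a k)ᗮ => Δ.slice k z.1 z.2 := by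
  unfold slice; fun_prop

theorem norm_le_norm_slice (s : ℝ) (y : (ℝ ∙ Δ.a k)ᗮ) : ‖y‖ ≤ ‖Δ.slice k s y‖ := by
  have h : inner ℝ (Δ.slice k s y) (y : EuclideanSpace ℝ (Fin n)) = ‖y‖ * ‖y‖ := by
    simp only [slice, inner_add_left, inner_smul_left, inner_a_coe, real_inner_self_eq_norm_sq]
    simp [sq]
  have h2 := real_inner_le_norm (Δ.slice k s y) (y : EuclideanSpace ℝ (Fin n))
  rw [h, Submodule.coe_norm] at h2
  rcases (norm_nonneg y).eq_or_lt with h0 | h0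
  · rw [← h0]; exact norm_nonneg _
  · exact le_of_mul_le_mul_right h2 h0

theorem exists_slice_eq {x : EuclideanSpace ℝ (Fin n)} (hx : Δ.δ k x = 0) :
    ∃ y, Δ.slice k 0 y = x := by
  refine ⟨⟨x - ((Δ.c k + 0) / ‖Δ.a k‖ ^ 2) • Δ.a k, ?_⟩, by simp [slice]⟩
  rw [Submodule.mem_orthogonal_singleton_iff_inner_right]
  have := (Δ.norm_a_pos k).ne'
  simp only [δ] at hx
  rw [inner_sub_right, inner_smul_right, real_inner_self_eq_norm_sq]
  field_simp
  linarith

/-- In the unit normal direction the slice of level `s` sits at height `(c_k + s)/‖a_k‖`, so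
Lebesgue measure disintegrates with the factor `‖a_k‖⁻¹`, the normalization used in `facetMeasure`.
-/
theorem measurePreserving_slice :
    MeasurePreserving (fun z : ℝ × (ℝ ∙ Δ.a k)ᗮ => Δ.slice k z.1 z.2)
      ((ENNReal.ofReal ‖Δ.a k‖⁻¹ • (volume : Measure ℝ)).prod volume) volume := by
  have ha := Δ.norm_a_pos k
  have hu : ‖(‖Δ.a k‖⁻¹ • Δ.a k)‖ = 1 := by
    rw [norm_smul, norm_inv, norm_norm, inv_mul_cancel₀ ha.ne']
  have h1 : MeasurePreserving (fun s : ℝ => ‖Δ.a k‖⁻¹ * s + Δ.c k / ‖Δ.a k‖)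
      (ENNReal.ofReal ‖Δ.a k‖⁻¹ • (volume : Measure ℝ)) volume := by
    have e1 : MeasurePreserving (fun s : ℝ => ‖Δ.a k‖⁻¹ * s)
        (ENNReal.ofReal ‖Δ.a k‖⁻¹ • (volume : Measure ℝ)) volume := by
      refine ⟨by fun_prop, ?_⟩
      have := Real.smul_map_volume_mul_left (a := ‖Δ.a k‖⁻¹) (inv_ne_zero ha.ne')
      rw [abs_of_pos (inv_pos.2 ha)] at this
      rw [Measure.map_smul, this]
    exact (measurePreserving_add_right volume (Δ.c k / ‖Δ.a k‖)).comp e1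
  have hspan : (ℝ ∙ (‖Δ.a k‖⁻¹ • Δ.a k)) = (ℝ ∙ Δ.a k) :=
    Submodule.span_singleton_smul_eq (IsUnit.mk0 _ (inv_ne_zero ha.ne')) _
  let e := (LinearIsometryEquiv.toSpanUnitSingleton (𝕜 := ℝ) (‖Δ.a k‖⁻¹ • Δ.a k) hu).trans
    (LinearIsometryEquiv.ofEq _ _ hspan)
  have he : ∀ t : ℝ, (e t : EuclideanSpace ℝ (Fin n)) = t • (‖Δ.a k‖⁻¹ • Δ.a k) := fun t => rfl
  have h3 := (e.measurePreserving.comp h1).prod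
    (MeasurePreserving.id (volume : Measure (ℝ ∙ Δ.a k)ᗮ))
  have h4 := (WithLp.volume_preserving_toLp (ℝ ∙ Δ.a k) (ℝ ∙ Δ.a k)ᗮ).comp h3
  have h5 := (ℝ ∙ Δ.a k).orthogonalDecomposition.symm.measurePreserving.comp h4
  have hfun : (fun z : ℝ × (ℝ ∙ Δ.a k)ᗮ => Δ.slice k z.1 z.2) = fun z =>
      (ℝ ∙ Δ.a k).orthogonalDecomposition.symm
        (WithLp.toLp 2 (e (‖Δ.a k‖⁻¹ * z.1 + Δ.c k / ‖Δ.a k‖), z.2)) := by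
    ext1 z
    rw [show (ℝ ∙ Δ.a k).orthogonalDecomposition.symm
        (WithLp.toLp 2 (e (‖Δ.a k‖⁻¹ * z.1 + Δ.c k / ‖Δ.a k‖), z.2)) =
        (e (‖Δ.a k‖⁻¹ * z.1 + Δ.c k / ‖Δ.a k‖) : EuclideanSpace ℝ (Fin n)) + z.2 from rfl, he]
    simp only [slice, smul_smul]
    congr 2
    field_simp
    ring
  rw [hfun]
  exact h5

theorem integral_eq_integral_slice {f : EuclideanSpace ℝ (Fin n) → ℝ} (hf : Integrable f) :
    ∫ x, f x = ∫ s, ‖Δ.a k‖⁻¹ * ∫ y, f (Δ.slice k s y) := by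
  have hmp := Δ.measurePreserving_slice k
  have hi : Integrable (fun z : ℝ × (ℝ ∙ Δ.a k)ᗮ => f (Δ.slice k z.1 z.2)) _ :=
    hmp.integrable_comp_of_integrable hf
  have h1 : ∫ x, f x = ∫ z, f (Δ.slice k z.1 z.2)
      ∂((ENNReal.ofReal ‖Δ.a k‖⁻¹ • (volume : Measure ℝ)).prod volume) := by
    rw [← integral_map hmp.measurable.aemeasurable, hmp.map_eq]
    rw [hmp.map_eq]; exact hf.aestronglyMeasurable
  rw [h1, integral_prod _ hi, integral_smul_measure, integral_const_mul,
    ENNReal.toReal_ofReal (inv_nonneg.2 (norm_nonneg _)), smul_eq_mul]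

theorem measurableEmbedding_slice (s : ℝ) : MeasurableEmbedding (Δ.slice k s) := by
  have h1 : Topology.IsClosedEmbedding (Subtype.val : (ℝ ∙ Δ.a k)ᗮ → EuclideanSpace ℝ (Fin n)) :=
    (Submodule.closed_of_finiteDimensional _).isClosedEmbedding_subtypeVal
  exact ((Homeomorph.addLeft (((Δ.c k + s) / ‖Δ.a k‖ ^ 2) •
    Δ.a k)).isClosedEmbedding.comp h1).measurableEmbedding

theorem facetMeasure_eq : Δ.facetMeasure k = ENNReal.ofReal ‖Δ.a k‖⁻¹ •
    ((volume : Measure (ℝ ∙ Δ.a k)ᗮ).map (Δ.slice k 0)).restrict (Δ.openFacet k) := by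
  have h : Δ.slice k 0 = fun y : (ℝ ∙ Δ.a k)ᗮ => (Δ.c k / ‖Δ.a k‖ ^ 2) • Δ.a k +
      (y : EuclideanSpace ℝ (Fin n)) := by
    funext y; simp [slice]
  rw [h, facetMeasure]

theorem integral_facetMeasure (u : EuclideanSpace ℝ (Fin n) → ℝ) :
    ∫ x, u x ∂Δ.facetMeasure k =
      ‖Δ.a k‖⁻¹ * ∫ y, (Δ.openFacet k).indicator u (Δ.slice k 0 y) := by
  rw [facetMeasure_eq, integral_smul_measure,
    ENNReal.toReal_ofReal (inv_nonneg.2 (norm_nonneg _)), smul_eq_mul,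
    ← integral_indicator (Δ.measurableSet_openFacet k),
    (Δ.measurableEmbedding_slice k 0).integral_map]

theorem ae_facetMeasure_mem : ∀ᵐ x ∂Δ.facetMeasure k, x ∈ Δ.openFacet k := by
  rw [facetMeasure_eq]
  exact Measure.ae_smul_measure (ae_restrict_mem (Δ.measurableSet_openFacet k)) _

theorem exists_norm_slice_bound : ∃ R : ℝ, ∀ s y, Δ.slice k s y ∈ Δ.closed → ‖y‖ ≤ R := by
  obtain ⟨R, hR⟩ := Δ.isCompact_closed.isBounded.exists_norm_le
  exact ⟨R, fun s y h => (Δ.norm_le_norm_slice k s y).trans (hR _ h)⟩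

instance : IsFiniteMeasure (Δ.facetMeasure k) := by
  obtain ⟨R, hR⟩ := Δ.exists_norm_slice_bound k
  constructor
  rw [facetMeasure_eq, Measure.smul_apply, Measure.restrict_apply_univ,
    (Δ.measurableEmbedding_slice k 0).map_apply, smul_eq_mul]
  refine ENNReal.mul_lt_top ENNReal.ofReal_lt_top ?_
  refine (measure_mono (t := Metric.closedBall 0 R) fun y hy => ?_).trans_lt
    measure_closedBall_lt_top
  rw [mem_closedBall_zero_iff]
  exact hR 0 y (Δ.openFacet_subset_closed k hy)

instance : IsFiniteMeasure Δ.σ := by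
  unfold σ
  rw [← Measure.sum_fintype]
  infer_instance

theorem ae_σ_mem : ∀ᵐ x ∂Δ.σ, ∃ k, x ∈ Δ.openFacet k := by
  unfold σ
  rw [← Measure.sum_fintype, ae_iff, Measure.sum_apply_eq_zero]
  intro k
  rw [← ae_iff]
  filter_upwards [Δ.ae_facetMeasure_mem k] with x hx using ⟨k, hx⟩

theorem ae_σ_mem_closed : ∀ᵐ x ∂Δ.σ, x ∈ Δ.closed := by
  filter_upwards [Δ.ae_σ_mem] with x ⟨k, hx⟩ using Δ.openFacet_subset_closed k hx

theorem integral_σ_eq_sum {u : EuclideanSpace ℝ (Fin n) → ℝ} (hu : Integrable u Δ.σ) :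
    ∫ x, u x ∂Δ.σ = ∑ k, ∫ x, u x ∂Δ.facetMeasure k := by
  unfold σ at *
  exact integral_finsetSum_measure fun k _ => (integrable_finsetSum_measure.1 hu) k (by simp)

theorem integrable_σ_of_continuousOn {u : EuclideanSpace ℝ (Fin n) → ℝ}
    (hu : ContinuousOn u Δ.closed) : Integrable u Δ.σ := by
  have h1 : Δ.σ.restrict Δ.closed = Δ.σ :=
    Measure.restrict_eq_self_of_ae_mem Δ.ae_σ_mem_closed
  have h2 : IntegrableOn u Δ.closed Δ.σ := hu.integrableOn_compact Δ.isCompact_closed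
  rwa [IntegrableOn, h1] at h2

/-- Irredundancy provides a point of the hyperplane with `δ_j > 0`, so `δ_j = 0` cuts out of it the
empty set or a proper affine subspace, which is null. -/
theorem ae_δ_slice_ne_zero {j : Fin m} (hj : j ≠ k) :
    ∀ᵐ y : (ℝ ∙ Δ.a k)ᗮ, Δ.δ j (Δ.slice k 0 y) ≠ 0 := by
  by_cases hex : ∃ y₁, Δ.δ j (Δ.slice k 0 y₁) = 0
  swap
  · push Not at hex
    exact Eventually.of_forall hex
  obtain ⟨y₁, hy₁⟩ := hex
  obtain ⟨x, hx0, hx⟩ := Δ.facet k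
  obtain ⟨y₀, rfl⟩ := Δ.exists_slice_eq k hx0
  have h0 : Δ.δ j (Δ.slice k 0 y₀) ≠ 0 := (hx j hj).ne'
  let ℓ : (ℝ ∙ Δ.a k)ᗮ →ₗ[ℝ] ℝ := (innerₛₗ ℝ (Δ.a j)).comp (Submodule.subtype _)
  have hℓ : ∀ y, Δ.δ j (Δ.slice k 0 y) = ℓ (y - y₁) := fun y => by
    have h : ℓ (y - y₁) = Δ.δ j (Δ.slice k 0 y) - Δ.δ j (Δ.slice k 0 y₁) := by
      simp [ℓ, δ, slice, inner_add_right, inner_sub_right]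
    rw [h, hy₁, sub_zero]
  have hs : AffineSubspace.mk' y₁ (LinearMap.ker ℓ) ≠ ⊤ := by
    intro h
    have : y₀ ∈ AffineSubspace.mk' y₁ (LinearMap.ker ℓ) := h ▸ AffineSubspace.mem_top ..
    rw [AffineSubspace.mem_mk', vsub_eq_sub, LinearMap.mem_ker, ← hℓ] at this
    exact h0 this
  have := Measure.addHaar_affineSubspace volume _ hs
  rw [ae_iff]
  refine measure_mono_null (fun y hy => ?_) this
  simp only [not_not, ne_eq, mem_ofPred_eq] at hy
  rw [SetLike.mem_coe, AffineSubspace.mem_mk', vsub_eq_sub, LinearMap.mem_ker, ← hℓ, hy]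

/-- Dominated convergence. For almost every `y` the limit point either violates some inequality
strictly, and then so do the nearby slices, or lies on the open facet, and then the nearby slices
lie in the interior. -/
theorem tendsto_integral_slice {u : EuclideanSpace ℝ (Fin n) → ℝ} (hu : ContinuousOn u Δ.closed) :
    Tendsto (fun s => ‖Δ.a k‖⁻¹ * ∫ y, Δ.int.indicator u (Δ.slice k s y)) (𝓝[>] 0)
      (𝓝 (∫ x, u x ∂Δ.facetMeasure k)) := by
  rw [integral_facetMeasure]
  refine Tendsto.const_mul _ ?_
  obtain ⟨B, hB⟩ := Δ.isCompact_closed.exists_bound_of_continuousOn hu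
  obtain ⟨R, hR⟩ := Δ.exists_norm_slice_bound k
  have hum := measurable_indicator_of_continuousOn Δ.isOpen_int.measurableSet
    (hu.mono Δ.int_subset_closed)
  refine tendsto_integral_filter_of_dominated_convergence
    ((Metric.closedBall 0 R).indicator fun _ => max B 0) ?_ ?_ ?_ ?_
  · filter_upwards with s
    exact (hum.comp (Δ.measurableEmbedding_slice k s).measurable).aestronglyMeasurable
  · filter_upwards with s
    filter_upwards with y
    by_cases h : Δ.slice k s y ∈ Δ.int
    · have hc := Δ.int_subset_closed h
      rw [indicator_of_mem h, indicator_of_mem (mem_closedBall_zero_iff.2 (hR s y hc))]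
      exact (hB _ hc).trans (le_max_left _ _)
    · rw [indicator_of_notMem h, norm_zero]
      exact indicator_nonneg (fun _ _ => le_max_right _ _) _
  · rw [integrable_indicator_iff measurableSet_closedBall]
    exact integrableOn_const measure_closedBall_lt_top.ne
  · have : ∀ᵐ y : (ℝ ∙ Δ.a k)ᗮ, ∀ j, j ≠ k → Δ.δ j (Δ.slice k 0 y) ≠ 0 := by
      rw [ae_all_iff]
      intro j
      by_cases hj : j = k
      · simp [hj]
      · filter_upwards [Δ.ae_δ_slice_ne_zero k hj] with y hy _ using hy
    filter_upwards [this] with y hy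
    have hsl : Tendsto (fun s => Δ.slice k s y) (𝓝[>] 0) (𝓝 (Δ.slice k 0 y)) := by
      have : Continuous fun s => Δ.slice k s y :=
        (Δ.continuous_slice k).comp (Continuous.prodMk_left y)
      exact (this.tendsto 0).mono_left nhdsWithin_le_nhds
    have hδ : ∀ j, Tendsto (fun s => Δ.δ j (Δ.slice k s y)) (𝓝[>] 0)
        (𝓝 (Δ.δ j (Δ.slice k 0 y))) := fun j => ((Δ.continuous_δ j).tendsto _).comp hsl
    by_cases hneg : ∃ j, j ≠ k ∧ Δ.δ j (Δ.slice k 0 y) < 0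
    · obtain ⟨j, hj, hlt⟩ := hneg
      rw [indicator_of_notMem fun h : Δ.slice k 0 y ∈ Δ.openFacet k =>
        absurd (h.2 j hj) (not_lt.2 hlt.le)]
      refine tendsto_const_nhds.congr' ?_
      filter_upwards [(hδ j).eventually (gt_mem_nhds hlt)] with s hs
      rw [indicator_of_notMem fun h : Δ.slice k s y ∈ Δ.int => absurd (h j) (not_lt.2 hs.le)]
    · push Not at hneg
      have hF : Δ.slice k 0 y ∈ Δ.openFacet k :=
        ⟨Δ.δ_slice k 0 y, fun j hj => lt_of_le_of_ne (hneg j hj) (hy j hj).symm⟩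
      have hint : ∀ᶠ s in 𝓝[>] (0 : ℝ), Δ.slice k s y ∈ Δ.int := by
        have : ∀ᶠ s in 𝓝[>] (0 : ℝ), ∀ j, 0 < Δ.δ j (Δ.slice k s y) := by
          rw [eventually_all]
          intro j
          by_cases hj : j = k
          · subst hj
            filter_upwards [self_mem_nhdsWithin] with s hs
            rw [Δ.δ_slice]; exact hs
          · exact (hδ j).eventually (lt_mem_nhds (hF.2 j hj))
        exact this
      rw [indicator_of_mem hF]
      have h1 : Tendsto (fun s => u (Δ.slice k s y)) (𝓝[>] 0) (𝓝 (u (Δ.slice k 0 y))) := by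
        refine (hu _ (Δ.openFacet_subset_closed k hF)).tendsto.comp ?_
        refine tendsto_nhdsWithin_iff.2 ⟨hsl, ?_⟩
        filter_upwards [hint] with s hs using Δ.int_subset_closed hs
      refine h1.congr' ?_
      filter_upwards [hint] with s hs
      rw [indicator_of_mem hs]

end Polytope
-- Logarithmic densities concentrating on a facet
/-- A family of probability densities on `(0, ∞)` (up to a factor tending to one), spread out on
a logarithmic scale of length `S`, which concentrates at `0` as `S → ∞`. -/
def logDensity (d C S s : ℝ) : ℝ :=
  3 / S * max (1 + (d * Real.log s + C) / S) 0 ^ 2 * (d / s)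

/-- The distribution function of `logDensity`. -/
def logDistrib (d C S s : ℝ) : ℝ := max (1 + (d * Real.log s + C) / S) 0 ^ 3

section LogDensity

variable {d C S : ℝ}

theorem logDensity_nonneg (hd : 0 < d) (hS : 0 < S) {s : ℝ} (hs : 0 ≤ s) :
    0 ≤ logDensity d C S s := by
  unfold logDensity; positivity

theorem exists_logDensity_eq_zero (hd : 0 < d) (hS : 0 < S) :
    ∃ α : ℝ, 0 < α ∧ ∀ s, 0 ≤ s → s ≤ α → logDensity d C S s = 0 := by
  refine ⟨Real.exp (-(S + C) / d), Real.exp_pos _, fun s hs hsα => ?_⟩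
  rcases hs.eq_or_lt with rfl | hs
  -- At `s = 0` the density vanishes by the convention `d / 0 = 0`.
  · simp [logDensity]
  have h1 : Real.log s ≤ -(S + C) / d := by
    rw [← Real.log_exp (-(S + C) / d)]; exact Real.log_le_log hs hsα
  have h2 : 1 + (d * Real.log s + C) / S ≤ 0 := by
    have : d * Real.log s ≤ -(S + C) := by
      rw [le_div_iff₀ hd] at h1; linarith
    have : (d * Real.log s + C) / S ≤ -1 := by
      rw [div_le_iff₀ hS]; linarith
    linarith
  simp [logDensity, max_eq_right h2]

theorem hasDerivAt_logDistrib (hS : 0 < S) {s : ℝ} (hs : 0 < s) :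
    HasDerivAt (logDistrib d C S) (logDensity d C S s) s := by
  have h1 : HasDerivAt (fun s => 1 + (d * Real.log s + C) / S) (d * s⁻¹ / S) s :=
    ((((Real.hasDerivAt_log hs.ne').const_mul d).add_const C).div_const S).const_add 1
  have h2 := (hasDerivAt_max_zero_pow 1 (1 + (d * Real.log s + C) / S)).comp s h1
  have e : logDensity d C S s = ((1 + 2 : ℕ) : ℝ) * max (1 + (d * Real.log s + C) / S) 0 ^ (1 + 1) *
      (d * s⁻¹ / S) := by
    unfold logDensity
    push_cast
    field_simp
  rw [e]
  exact h2

theorem continuousOn_logDensity (hd : 0 < d) (hS : 0 < S) :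
    ContinuousOn (logDensity d C S) (Ici 0) := by
  intro s hs
  rcases (mem_Ici.1 hs).eq_or_lt with rfl | hs
  · obtain ⟨α, hα, h⟩ := exists_logDensity_eq_zero (C := C) hd hS
    have : logDensity d C S =ᶠ[𝓝[Ici 0] 0] fun _ => 0 := by
      filter_upwards [self_mem_nhdsWithin, mem_nhdsWithin_of_mem_nhds (Iio_mem_nhds hα)]
        with y hy hyα using h y hy (le_of_lt hyα)
    refine ContinuousWithinAt.congr_of_eventuallyEq (f := fun _ => 0) ?_ this (h 0 le_rfl hα.le)
    exact continuousWithinAt_const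
  · refine ContinuousAt.continuousWithinAt ?_
    unfold logDensity
    have := hs.ne'
    fun_prop (disch := assumption)

theorem intervalIntegrable_logDensity (hd : 0 < d) (hS : 0 < S) {a b : ℝ} (ha : 0 ≤ a)
    (hb : 0 ≤ b) : IntervalIntegrable (logDensity d C S) volume a b := by
  refine ((continuousOn_logDensity hd hS).mono ?_).intervalIntegrable
  intro x hx
  exact (le_min ha hb).trans hx.1

theorem integral_logDensity (hd : 0 < d) (hS : 0 < S) {a b : ℝ} (ha : 0 < a) (hab : a ≤ b) :
    ∫ s in a..b, logDensity d C S s = logDistrib d C S b - logDistrib d C S a := by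
  refine intervalIntegral.integral_eq_sub_of_hasDerivAt (fun s hs => ?_)
    (intervalIntegrable_logDensity hd hS ha.le (ha.le.trans hab))
  rw [uIcc_of_le hab] at hs
  exact hasDerivAt_logDistrib hS (ha.trans_le hs.1)

theorem integral_logDensity_zero_le (hd : 0 < d) (hS : 0 < S) {b : ℝ} (hb : 0 < b) :
    ∫ s in 0..b, logDensity d C S s ≤ logDistrib d C S b := by
  obtain ⟨α, hα, h⟩ := exists_logDensity_eq_zero (C := C) hd hS
  have hmin : 0 < min α b := lt_min hα hb
  rw [← intervalIntegral.integral_add_adjacent_intervals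
    (intervalIntegrable_logDensity hd hS le_rfl hmin.le)
    (intervalIntegrable_logDensity hd hS hmin.le hb.le),
    integral_logDensity hd hS hmin (min_le_right _ _)]
  have h0 : ∫ s in 0..min α b, logDensity d C S s = 0 := by
    rw [intervalIntegral.integral_congr (g := fun _ => (0 : ℝ))]
    · simp
    · intro s hs
      rw [uIcc_of_le hmin.le] at hs
      exact h s hs.1 (hs.2.trans (min_le_left _ _))
  have : 0 ≤ logDistrib d C S (min α b) := by unfold logDistrib; positivity
  linarith

/-- The limit does not depend on `s`, so the mass between two fixed positive levels tends to 0: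
everything accumulates at the facet. -/
theorem tendsto_logDistrib (d C s : ℝ) :
    Tendsto (fun S => logDistrib d C S s) atTop (𝓝 1) := by
  have h1 : Tendsto (fun S : ℝ => 1 + (d * Real.log s + C) / S) atTop (𝓝 (1 + 0)) :=
    tendsto_const_nhds.add (tendsto_const_nhds.div_atTop tendsto_id)
  have h2 := (h1.max (tendsto_const_nhds (x := (0 : ℝ)))).pow 3
  simpa [logDistrib] using h2

end LogDensity

namespace Polytope

variable {n m : ℕ} (Δ : Polytope n m) (k : Fin m)

theorem exists_integral_slice_le {u : EuclideanSpace ℝ (Fin n) → ℝ}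
    (hu : ContinuousOn u Δ.closed) :
    ∃ B : ℝ, 0 ≤ B ∧ ∀ s, ‖Δ.a k‖⁻¹ * ∫ y, Δ.int.indicator u (Δ.slice k s y) ≤ B := by
  obtain ⟨B, hB⟩ := Δ.isCompact_closed.exists_bound_of_continuousOn hu
  obtain ⟨R, hR⟩ := Δ.exists_norm_slice_bound k
  have hint : Integrable ((Metric.closedBall (0 : (ℝ ∙ Δ.a k)ᗮ) R).indicator
      fun _ => max B 0) := by
    rw [integrable_indicator_iff measurableSet_closedBall]
    exact integrableOn_const measure_closedBall_lt_top.ne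
  refine ⟨‖Δ.a k‖⁻¹ * ∫ y, (Metric.closedBall (0 : (ℝ ∙ Δ.a k)ᗮ) R).indicator
    (fun _ => max B 0) y, ?_, fun s => ?_⟩
  · refine mul_nonneg (inv_nonneg.2 (norm_nonneg _)) (integral_nonneg fun y => ?_)
    exact indicator_nonneg (fun _ _ => le_max_right _ _) _
  · refine mul_le_mul_of_nonneg_left ?_ (inv_nonneg.2 (norm_nonneg _))
    refine (le_abs_self _).trans ?_
    rw [← Real.norm_eq_abs]
    refine norm_integral_le_of_norm_le hint (Eventually.of_forall fun y => ?_)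
    by_cases h : Δ.slice k s y ∈ Δ.int
    · have hc := Δ.int_subset_closed h
      rw [indicator_of_mem h, indicator_of_mem (mem_closedBall_zero_iff.2 (hR s y hc))]
      exact (hB _ hc).trans (le_max_left _ _)
    · rw [indicator_of_notMem h, norm_zero]
      exact indicator_nonneg (fun _ _ => le_max_right _ _) _

theorem continuousOn_logDensity_δ_mul {d C S : ℝ} (hd : 0 < d) (hS : 0 < S)
    {u : EuclideanSpace ℝ (Fin n) → ℝ} (hu : ContinuousOn u Δ.closed) :
    ContinuousOn (fun x => logDensity d C S (Δ.δ k x) * u x) Δ.closed := by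
  refine ContinuousOn.mul ?_ hu
  exact (continuousOn_logDensity hd hS).comp (Δ.continuous_δ k).continuousOn
    fun x hx => Δ.mem_closed_iff.1 hx k

/-- Slicing reduces the integral to `∫ logDensity(s) I(s) ds`, where `I(s)` is the integral of `u`
over the slice of level `s`. Near `0` the values `I(s)` are close to the facet integral; on the
remaining levels `I` is bounded and the mass of the density tends to 0. -/
theorem exists_integral_logDensity_le {d : ℝ} (hd : 0 < d) (C : ℝ)
    {u : EuclideanSpace ℝ (Fin n) → ℝ} (hu : ContinuousOn u Δ.closed)
    (hu0 : ∀ x ∈ Δ.int, 0 ≤ u x) {ε : ℝ} (hε : 0 < ε) :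
    ∀ᶠ S in atTop, ∫ x in Δ.int, logDensity d C S (Δ.δ k x) * u x ≤
      ∫ x, u x ∂Δ.facetMeasure k + ε := by
  set I : ℝ → ℝ := fun s => ‖Δ.a k‖⁻¹ * ∫ y, Δ.int.indicator u (Δ.slice k s y) with hI
  set I₀ := ∫ x, u x ∂Δ.facetMeasure k with hI₀
  obtain ⟨B, hB0, hB⟩ := Δ.exists_integral_slice_le k hu
  obtain ⟨R, hR1, hR⟩ := Δ.exists_δ_le
  have hIn : ∀ s, 0 ≤ I s := fun s => mul_nonneg (inv_nonneg.2 (norm_nonneg _))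
    (integral_nonneg fun y => indicator_nonneg hu0 _)
  have hI0 : 0 ≤ I₀ := by
    refine ge_of_tendsto (Δ.tendsto_integral_slice k hu) (Eventually.of_forall hIn)
  have hev := (Δ.tendsto_integral_slice k hu).eventually
    (gt_mem_nhds (show I₀ < I₀ + ε / 2 by linarith))
  obtain ⟨s₀, hs₀, hs₀I⟩ := mem_nhdsGT_iff_exists_Ioc_subset.1 hev
  set s₁ := min s₀ R with hs₁
  have hs₁0 : 0 < s₁ := lt_min hs₀ (by linarith)
  have hs₁R : s₁ ≤ R := min_le_right _ _
  have hlim : Tendsto (fun S => (I₀ + ε / 2) * logDistrib d C S s₁ +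
      B * (logDistrib d C S R - logDistrib d C S s₁)) atTop
      (𝓝 ((I₀ + ε / 2) * 1 + B * (1 - 1))) :=
    ((tendsto_logDistrib d C s₁).const_mul _).add
      (((tendsto_logDistrib d C R).sub (tendsto_logDistrib d C s₁)).const_mul _)
  filter_upwards [hlim.eventually (gt_mem_nhds (show (I₀ + ε / 2) * 1 + B * (1 - 1) < I₀ + ε by
    linarith)), eventually_gt_atTop 0] with S hS hS0
  refine le_trans ?_ hS.le
  have hi1 := intervalIntegrable_logDensity (C := C) hd hS0 le_rfl hs₁0.le
  have hi2 := intervalIntegrable_logDensity (C := C) hd hS0 hs₁0.le (hs₁0.le.trans hs₁R)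
  have hcont := Δ.continuousOn_logDensity_δ_mul k (C := C) hd hS0 hu
  have hint : Integrable (Δ.int.indicator fun x => logDensity d C S (Δ.δ k x) * u x) := by
    rw [integrable_indicator_iff Δ.isOpen_int.measurableSet]
    exact (hcont.integrableOn_compact Δ.isCompact_closed).mono_set Δ.int_subset_closed
  rw [← integral_indicator Δ.isOpen_int.measurableSet, Δ.integral_eq_integral_slice k hint]
  have hfac : ∀ s, ‖Δ.a k‖⁻¹ * ∫ y, Δ.int.indicator
      (fun x => logDensity d C S (Δ.δ k x) * u x) (Δ.slice k s y) = logDensity d C S s * I s := by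
    intro s
    have : ∀ y, Δ.int.indicator (fun x => logDensity d C S (Δ.δ k x) * u x) (Δ.slice k s y) =
        logDensity d C S s * Δ.int.indicator u (Δ.slice k s y) := fun y => by
      by_cases h : Δ.slice k s y ∈ Δ.int
      · simp only [indicator_of_mem h, Δ.δ_slice]
      · simp only [indicator_of_notMem h, mul_zero]
    simp only [this, integral_const_mul, hI]
    ring
  have hI_zero : ∀ s, s ∉ Ioc 0 R → I s = 0 := fun s hs => by
    have : ∀ y, Δ.int.indicator u (Δ.slice k s y) = 0 := fun y => by
      refine indicator_of_notMem (fun h => hs ?_) _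
      have h1 := h k
      have h2 := hR _ (Δ.int_subset_closed h) k
      rw [Δ.δ_slice] at h1 h2
      exact ⟨h1, h2⟩
    simp [hI, this]
  simp only [hfac]
  set g : ℝ → ℝ := fun s => (Ioc 0 s₁).indicator (fun s => (I₀ + ε / 2) * logDensity d C S s) s +
    (Ioc s₁ R).indicator (fun s => B * logDensity d C S s) s with hg
  have hg1 : Integrable ((Ioc 0 s₁).indicator fun s => (I₀ + ε / 2) * logDensity d C S s) := by
    rw [integrable_indicator_iff measurableSet_Ioc]
    exact ((intervalIntegrable_iff_integrableOn_Ioc_of_le hs₁0.le).1 hi1).const_mul _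
  have hg2 : Integrable ((Ioc s₁ R).indicator fun s => B * logDensity d C S s) := by
    rw [integrable_indicator_iff measurableSet_Ioc]
    exact ((intervalIntegrable_iff_integrableOn_Ioc_of_le hs₁R).1 hi2).const_mul _
  have hle : ∫ s, logDensity d C S s * I s ≤ ∫ s, g s := by
    refine integral_mono_of_nonneg (Eventually.of_forall fun s => ?_) (hg1.add hg2)
      (Eventually.of_forall fun s => ?_)
    · by_cases hs : s ∈ Ioc 0 R
      · exact mul_nonneg (logDensity_nonneg hd hS0 hs.1.le) (hIn s)
      · simp [hI_zero s hs]
    · simp only [hg]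
      by_cases hs : s ∈ Ioc 0 R
      · have hq := logDensity_nonneg (C := C) hd hS0 hs.1.le
        by_cases hs2 : s ≤ s₁
        · rw [indicator_of_mem (show s ∈ Ioc 0 s₁ from ⟨hs.1, hs2⟩),
            indicator_of_notMem fun h => absurd h.1 (not_lt.2 hs2), add_zero, mul_comm]
          refine mul_le_mul_of_nonneg_right ?_ hq
          exact le_of_lt (hs₀I ⟨hs.1, hs2.trans (min_le_left _ _)⟩)
        · push Not at hs2
          rw [indicator_of_notMem fun h => absurd h.2 (not_le.2 hs2),
            indicator_of_mem (show s ∈ Ioc s₁ R from ⟨hs2, hs.2⟩), zero_add, mul_comm]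
          exact mul_le_mul_of_nonneg_right (hB s) hq
      · rw [hI_zero s hs, mul_zero, indicator_of_notMem fun h => hs ⟨h.1, h.2.trans hs₁R⟩,
          indicator_of_notMem fun h => hs ⟨hs₁0.trans h.1, h.2⟩, add_zero]
  refine hle.trans ?_
  simp only [hg]
  rw [integral_add hg1 hg2, integral_indicator measurableSet_Ioc,
    integral_indicator measurableSet_Ioc, integral_const_mul, integral_const_mul,
    ← intervalIntegral.integral_of_le hs₁0.le, ← intervalIntegral.integral_of_le hs₁R,
    integral_logDensity hd hS0 hs₁0 hs₁R]
  gcongr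
  exact integral_logDensity_zero_le hd hS0 hs₁0

/-- In slice coordinates the function is dominated by `|log s|` on a bounded interval times the
indicator of a ball. -/
theorem integrableOn_log_δ : IntegrableOn (fun x => Real.log (Δ.δ k x)) Δ.int := by
  obtain ⟨R, hR1, hR⟩ := Δ.exists_δ_le
  obtain ⟨R', hR'⟩ := Δ.exists_norm_slice_bound k
  have hcont : ContinuousOn (fun x => Real.log (Δ.δ k x)) Δ.int :=
    (Δ.continuous_δ k).continuousOn.log fun x hx => (hx k).ne'
  have hm := measurable_indicator_of_continuousOn Δ.isOpen_int.measurableSet hcont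
  rw [← integrable_indicator_iff Δ.isOpen_int.measurableSet,
    ← (Δ.measurePreserving_slice k).integrable_comp hm.aestronglyMeasurable]
  have h1 : Integrable ((Ioc 0 R).indicator fun s => Real.log s)
      (ENNReal.ofReal ‖Δ.a k‖⁻¹ • (volume : Measure ℝ)) := by
    refine Integrable.smul_measure ?_ ENNReal.ofReal_ne_top
    rw [integrable_indicator_iff measurableSet_Ioc,
      ← intervalIntegrable_iff_integrableOn_Ioc_of_le (by linarith)]
    exact intervalIntegral.intervalIntegrable_log'
  have h2 : Integrable ((Metric.closedBall (0 : (ℝ ∙ Δ.a k)ᗮ) R').indicator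
      fun _ => (1 : ℝ)) := by
    rw [integrable_indicator_iff measurableSet_closedBall]
    exact integrableOn_const measure_closedBall_lt_top.ne
  refine (h1.mul_prod h2).mono
    (hm.comp (Δ.measurePreserving_slice k).measurable).aestronglyMeasurable
    (Eventually.of_forall fun z => ?_)
  simp only [Function.comp_apply]
  by_cases h : Δ.slice k z.1 z.2 ∈ Δ.int
  · have hc := Δ.int_subset_closed h
    have e1 := h k
    have e2 := hR _ hc k
    rw [Δ.δ_slice] at e1 e2
    rw [indicator_of_mem h, Δ.δ_slice, indicator_of_mem (show z.1 ∈ Ioc 0 R from ⟨e1, e2⟩),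
      indicator_of_mem (mem_closedBall_zero_iff.2 (hR' _ _ hc)), mul_one]
  · rw [indicator_of_notMem h, norm_zero]
    exact norm_nonneg _

end Polytope
-- Radial derivatives and the divergence identity
variable {n m : ℕ}

/-- The derivative of `f` in the direction of the radial vector field `x - p`. -/
def radialDeriv (p : EuclideanSpace ℝ (Fin n)) (f : EuclideanSpace ℝ (Fin n) → ℝ)
    (x : EuclideanSpace ℝ (Fin n)) : ℝ :=
  ∑ i, (x i - p i) * pderiv i f x

section RadialDeriv

variable {p x : EuclideanSpace ℝ (Fin n)} {f g : EuclideanSpace ℝ (Fin n) → ℝ}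

theorem radialDeriv_mul (hf : DifferentiableAt ℝ f x) (hg : DifferentiableAt ℝ g x) :
    radialDeriv p (fun y => f y * g y) x =
      f x * radialDeriv p g x + radialDeriv p f x * g x := by
  simp only [radialDeriv, Finset.mul_sum, Finset.sum_mul, ← Finset.sum_add_distrib]
  refine Finset.sum_congr rfl fun i _ => ?_
  rw [pderiv_mul hf hg]; ring

theorem radialDeriv_sub (hf : DifferentiableAt ℝ f x) (hg : DifferentiableAt ℝ g x) :
    radialDeriv p (fun y => f y - g y) x = radialDeriv p f x - radialDeriv p g x := by
  simp only [radialDeriv, ← Finset.sum_sub_distrib]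
  refine Finset.sum_congr rfl fun i _ => ?_
  rw [pderiv_sub hf hg]; ring

theorem radialDeriv_comp {h : ℝ → ℝ} {h' : ℝ} (hh : HasDerivAt h h' (f x))
    (hf : DifferentiableAt ℝ f x) :
    radialDeriv p (fun y => h (f y)) x = h' * radialDeriv p f x := by
  simp only [radialDeriv, Finset.mul_sum]
  refine Finset.sum_congr rfl fun i _ => ?_
  rw [pderiv_comp hh hf]; ring

theorem radialDeriv_eq_fderiv : radialDeriv p f x = fderiv ℝ f x (x - p) := by
  rw [fderiv_eq_sum_pderiv]; rfl

theorem differentiableAt_coord (j : Fin n) :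
    DifferentiableAt ℝ (fun y : EuclideanSpace ℝ (Fin n) => y j - p j) x :=
  ((EuclideanSpace.proj j : EuclideanSpace ℝ (Fin n) →L[ℝ] ℝ).differentiableAt).sub_const _

theorem contDiff_coord (j : Fin n) {k : WithTop ℕ∞} :
    ContDiff ℝ k (fun y : EuclideanSpace ℝ (Fin n) => y j - p j) :=
  ((EuclideanSpace.proj j : EuclideanSpace ℝ (Fin n) →L[ℝ] ℝ).contDiff).sub contDiff_const

theorem divergence_radial (hf : DifferentiableAt ℝ f x) :
    ∑ i, pderiv i (fun y => (y i - p i) * f y) x = n * f x + radialDeriv p f x := by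
  have : ∀ i, pderiv i (fun y => (y i - p i) * f y) x =
      (x i - p i) * pderiv i f x + f x := fun i => by
    rw [pderiv_mul (differentiableAt_coord i) hf, pderiv_coord_sub]; simp
  simp only [this, Finset.sum_add_distrib, radialDeriv]
  simp; ring

/-- The divergence theorem for the field `f · (x - p)`: an integral that can be added at no cost. -/
theorem setIntegral_radial_eq_zero {s K : Set (EuclideanSpace ℝ (Fin n))} (hK : IsCompact K)
    (hKs : K ⊆ s) (hs : IsOpen s) (hf : ContDiffOn ℝ 1 f s) (h0 : ∀ x ∈ s, x ∉ K → f x = 0) :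
    IntegrableOn (fun x => n * f x + radialDeriv p f x) s ∧
      ∫ x in s, (n * f x + radialDeriv p f x) = 0 := by
  have h := setIntegral_divergence_eq_zero hK hKs hs (X := fun i y => (y i - p i) * f y)
    (fun i => (contDiff_coord i).contDiffOn.mul hf) fun i x hx hxK => by simp [h0 x hx hxK]
  have e : EqOn (fun x => ∑ i, pderiv i (fun y => (y i - p i) * f y) x)
      (fun x => n * f x + radialDeriv p f x) s := fun x hx =>
    divergence_radial ((hf.contDiffAt (hs.mem_nhds hx)).differentiableAt one_ne_zero)
  exact ⟨h.1.congr_fun e hs.measurableSet, (setIntegral_congr_fun hs.measurableSet e) ▸ h.2⟩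

end RadialDeriv

section MatrixSmooth

variable {ι : Type*} [Fintype ι] [DecidableEq ι] {s : Set (EuclideanSpace ℝ (Fin n))}
  {V : EuclideanSpace ℝ (Fin n) → Matrix ι ι ℝ} {N : WithTop ℕ∞}

theorem contDiffOn_det (hV : ∀ i j, ContDiffOn ℝ N (fun y => V y i j) s) :
    ContDiffOn ℝ N (fun y => (V y).det) s := by
  simp only [Matrix.det_apply']
  exact ContDiffOn.sum fun σ _ => contDiffOn_const.mul (contDiffOn_prod fun i _ => hV _ _)

theorem contDiffOn_inv (hV : ∀ i j, ContDiffOn ℝ N (fun y => V y i j) s)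
    (hdet : ∀ x ∈ s, (V x).det ≠ 0) (i j : ι) : ContDiffOn ℝ N (fun y => (V y)⁻¹ i j) s := by
  simp only [Matrix.inv_def, Ring.inverse_eq_inv', Matrix.smul_apply, smul_eq_mul,
    Matrix.adjugate_apply]
  refine ((contDiffOn_det hV).inv hdet).mul (contDiffOn_det fun a b => ?_)
  by_cases h : a = j
  · subst h
    simp only [Matrix.updateRow_self]
    exact contDiffOn_const
  · simp only [Matrix.updateRow_ne h]
    exact hV a b

end MatrixSmooth

section Legendre

variable {p x : EuclideanSpace ℝ (Fin n)} {s : Set (EuclideanSpace ℝ (Fin n))}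
  {v : EuclideanSpace ℝ (Fin n) → ℝ}

theorem contDiffOn_hess (hs : IsOpen s) (hv : ContDiffOn ℝ ∞ v s) (i j : Fin n) :
    ContDiffOn ℝ ∞ (fun y => hess v y i j) s :=
  ContDiffOn.pderiv_of_isOpen hs (ContDiffOn.pderiv_of_isOpen hs hv j) i

theorem hess_comm (hs : IsOpen s) (hv : ContDiffOn ℝ ∞ v s) (hx : x ∈ s) (i j : Fin n) :
    hess v x i j = hess v x j i := pderiv_comm hs hv hx

theorem contDiffOn_legendre (hs : IsOpen s) (hv : ContDiffOn ℝ ∞ v s) :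
    ContDiffOn ℝ ∞ (legendre p v) s := by
  unfold legendre
  refine (ContDiffOn.sum fun j _ => ?_).sub hv
  exact (contDiff_coord j).contDiffOn.mul (ContDiffOn.pderiv_of_isOpen hs hv j)

/-- The gradient of `v` cancels and leaves `∇η = V (x - p)`. Cutting off by `η` is useful because
`V⁻¹∇η` is then the radial field, with no trace of `V`. -/
theorem pderiv_legendre (hs : IsOpen s) (hv : ContDiffOn ℝ ∞ v s) (hx : x ∈ s) (i : Fin n) :
    pderiv i (legendre p v) x = ∑ j, hess v x i j * (x j - p j) := by
  have hd : ∀ {f : EuclideanSpace ℝ (Fin n) → ℝ}, ContDiffOn ℝ ∞ f s → DifferentiableAt ℝ f x :=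
    fun hf => (hf.contDiffAt (hs.mem_nhds hx)).differentiableAt (by simp)
  have hv' := fun j => hd (ContDiffOn.pderiv_of_isOpen hs hv j)
  unfold legendre
  rw [pderiv_sub (DifferentiableAt.fun_sum fun j _ =>
    (differentiableAt_coord (p := p) j).fun_mul (hv' j))
    (hd hv), pderiv_sum fun j _ => (differentiableAt_coord (p := p) j).fun_mul (hv' j)]
  have : ∀ j, pderiv i (fun y => (y j - p j) * pderiv j v y) x =
      hess v x i j * (x j - p j) + if i = j then pderiv j v x else 0 := fun j => by
    rw [pderiv_mul (differentiableAt_coord j) (hv' j), pderiv_coord_sub]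
    simp only [hess, Matrix.of_apply, ite_mul, one_mul, zero_mul]; ring
  simp only [this, Finset.sum_add_distrib]
  simp

theorem radialDeriv_legendre (hs : IsOpen s) (hv : ContDiffOn ℝ ∞ v s) (hx : x ∈ s) :
    radialDeriv p (legendre p v) x = radialHess p v x := by
  unfold radialDeriv radialHess
  refine Finset.sum_congr rfl fun i _ => ?_
  rw [pderiv_legendre hs hv hx, Finset.mul_sum]
  exact Finset.sum_congr rfl fun j _ => by ring

theorem radialHess_nonneg (h : (hess v x).PosSemidef) : 0 ≤ radialHess p v x := by
  have := h.dotProduct_mulVec_nonneg (fun i => x i - p i)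
  simp only [star_trivial, dotProduct, Matrix.mulVec, Finset.mul_sum] at this
  refine this.trans_eq ?_
  unfold radialHess
  exact Finset.sum_congr rfl fun i _ => Finset.sum_congr rfl fun j _ => by ring

end Legendre

section Inverse

variable {p x : EuclideanSpace ℝ (Fin n)} {s : Set (EuclideanSpace ℝ (Fin n))}
  {v u : EuclideanSpace ℝ (Fin n) → ℝ}

theorem contDiffOn_hess_inv (hs : IsOpen s) (hv : ContDiffOn ℝ ∞ v s)
    (hpd : ∀ x ∈ s, (hess v x).PosDef) (i j : Fin n) :
    ContDiffOn ℝ ∞ (fun y => (hess v y)⁻¹ i j) s :=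
  contDiffOn_inv (contDiffOn_hess hs hv) (fun x hx => (hpd x hx).det_pos.ne') i j

theorem contDiffOn_log_det (hs : IsOpen s) (hv : ContDiffOn ℝ ∞ v s)
    (hpd : ∀ x ∈ s, (hess v x).PosDef) :
    ContDiffOn ℝ ∞ (fun y => Real.log (hess v y).det) s :=
  (contDiffOn_det (contDiffOn_hess hs hv)).log fun x hx => (hpd x hx).det_pos.ne'

/-- The divergence of the inverse Hessian. -/
def divInvHess (v : EuclideanSpace ℝ (Fin n) → ℝ) (i : Fin n)
    (x : EuclideanSpace ℝ (Fin n)) : ℝ :=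
  ∑ j, pderiv j (fun y => (hess v y)⁻¹ i j) x

theorem contDiffOn_divInvHess (hs : IsOpen s) (hv : ContDiffOn ℝ ∞ v s)
    (hpd : ∀ x ∈ s, (hess v x).PosDef) (i : Fin n) : ContDiffOn ℝ ∞ (divInvHess v i) s :=
  ContDiffOn.sum fun j _ => ContDiffOn.pderiv_of_isOpen hs (contDiffOn_hess_inv hs hv hpd i j) j

/-- Differentiate `V⁻¹ V = 1`, use the symmetry of the third derivatives of `v`, and recognise
Jacobi's formula for `log det`. -/
theorem sum_divInvHess_mul_hess (hs : IsOpen s) (hv : ContDiffOn ℝ ∞ v s)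
    (hpd : ∀ x ∈ s, (hess v x).PosDef) (hx : x ∈ s) (k : Fin n) :
    ∑ i, divInvHess v i x * hess v x i k =
      -pderiv k (fun y => Real.log (hess v y).det) x := by
  have hd : ∀ {f : EuclideanSpace ℝ (Fin n) → ℝ}, ContDiffOn ℝ ∞ f s → DifferentiableAt ℝ f x :=
    fun hf => (hf.contDiffAt (hs.mem_nhds hx)).differentiableAt (by simp)
  have hV := fun i j => hd (contDiffOn_hess hs hv i j)
  have hM := fun i j => hd (contDiffOn_hess_inv hs hv hpd i j)
  have hsymm : ∀ i j, (hess v x)⁻¹ i j = (hess v x)⁻¹ j i := fun i j => by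
    simpa using (hpd x hx).inv.1.apply j i
  have key : ∀ j, ∑ i, pderiv j (fun y => (hess v y)⁻¹ i j) x * hess v x i k =
      -∑ i, (hess v x)⁻¹ i j * pderiv j (fun y => hess v y i k) x := fun j => by
    have h1 : (fun y => ∑ i, (hess v y)⁻¹ i j * hess v y i k) =ᶠ[𝓝 x]
        fun _ => (1 : Matrix (Fin n) (Fin n) ℝ) j k := by
      filter_upwards [hs.mem_nhds hx] with y hy
      have hyd := (hpd y hy).det_pos.ne'.isUnit
      rw [← Matrix.nonsing_inv_mul _ hyd, Matrix.mul_apply]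
      refine Finset.sum_congr rfl fun i _ => ?_
      congr 1
      simpa using (hpd y hy).inv.1.apply j i
    have h2 := pderiv_congr (i := j) h1
    rw [pderiv_const, pderiv_sum fun i _ => (hM i j).fun_mul (hV i k)] at h2
    rw [← Finset.sum_neg_distrib, ← sub_eq_zero, ← Finset.sum_sub_distrib, ← h2]
    refine Finset.sum_congr rfl fun i _ => ?_
    rw [pderiv_mul (hM i j) (hV i k)]; ring
  have hthird : ∀ i j, pderiv j (fun y => hess v y i k) x = pderiv k (fun y => hess v y j i) x := by
    intro i j
    have h1 : (fun y => hess v y i k) =ᶠ[𝓝 x] pderiv k (pderiv i v) := by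
      filter_upwards [hs.mem_nhds hx] with y hy
      exact hess_comm hs hv hy i k
    rw [pderiv_congr h1, pderiv_comm hs (ContDiffOn.pderiv_of_isOpen hs hv i) hx]
    rfl
  rw [pderiv_log_det hV (hpd x hx).det_pos]
  simp only [divInvHess, Finset.sum_mul]
  rw [Finset.sum_comm]
  simp only [key, Finset.sum_neg_distrib]
  congr 1
  refine Finset.sum_congr rfl fun j _ => Finset.sum_congr rfl fun i _ => ?_
  rw [hthird]

/-- The divergence of the vector field `G (u b - V⁻¹ ∇u)`, where `b` is the divergence of the
inverse Hessian `V⁻¹` of `v` and `G` is a function of the Legendre transform of `v`. -/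
theorem divergence_identity (hs : IsOpen s) (hv : ContDiffOn ℝ ∞ v s)
    (hpd : ∀ x ∈ s, (hess v x).PosDef) (hu : ContDiffOn ℝ ∞ u s) (hx : x ∈ s)
    {h : ℝ → ℝ} {h' : ℝ} (hh : HasDerivAt h h' (legendre p v x)) :
    ∑ i, pderiv i (fun y => h (legendre p v y) *
      (u y * divInvHess v i y - ∑ j, (hess v y)⁻¹ j i * pderiv j u y)) x =
    h (legendre p v x) * (u x * ∑ i, pderiv i (divInvHess v i) x -
      ((hess v x)⁻¹ * hess u x).trace) -
    h' * (u x * radialDeriv p (fun y => Real.log (hess v y).det) x + radialDeriv p u x) := by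
  have hd : ∀ {f : EuclideanSpace ℝ (Fin n) → ℝ}, ContDiffOn ℝ ∞ f s → DifferentiableAt ℝ f x :=
    fun hf => (hf.contDiffAt (hs.mem_nhds hx)).differentiableAt (by simp)
  have hη := hd (contDiffOn_legendre (p := p) hs hv)
  have hb := fun i => hd (contDiffOn_divInvHess hs hv hpd i)
  have hM := fun i j => hd (contDiffOn_hess_inv hs hv hpd i j)
  have hu1 := fun j => hd (ContDiffOn.pderiv_of_isOpen hs hu j)
  have hud := hd hu
  have hG : DifferentiableAt ℝ (fun y => h (legendre p v y)) x :=
    (hh.comp_hasFDerivAt x hη.hasFDerivAt).differentiableAt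
  have hsum : ∀ i, DifferentiableAt ℝ (fun y => ∑ j, (hess v y)⁻¹ j i * pderiv j u y) x :=
    fun i => DifferentiableAt.fun_sum fun j _ => (hM j i).fun_mul (hu1 j)
  have e1 : ∀ i, pderiv i (fun y => h (legendre p v y) *
      (u y * divInvHess v i y - ∑ j, (hess v y)⁻¹ j i * pderiv j u y)) x =
      h (legendre p v x) * (u x * pderiv i (divInvHess v i) x + pderiv i u x * divInvHess v i x -
        ∑ j, ((hess v x)⁻¹ j i * hess u x i j +
          pderiv i (fun y => (hess v y)⁻¹ j i) x * pderiv j u x)) +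
      h' * pderiv i (legendre p v) x * (u x * divInvHess v i x -
        ∑ j, (hess v x)⁻¹ j i * pderiv j u x) := fun i => by
    rw [pderiv_mul hG ((hud.fun_mul (hb i)).fun_sub (hsum i)), pderiv_comp hh hη,
      pderiv_sub (hud.fun_mul (hb i)) (hsum i), pderiv_mul hud (hb i),
      pderiv_sum fun j _ => (hM j i).fun_mul (hu1 j)]
    congr 3
    refine Finset.sum_congr rfl fun j _ => ?_
    rw [pderiv_mul (hM j i) (hu1 j)]; rfl
  -- The first-order terms in `u` produced by the two halves of the field coincide and cancel.
  have e2 : ∑ i, ∑ j, pderiv i (fun y => (hess v y)⁻¹ j i) x * pderiv j u x =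
      ∑ i, pderiv i u x * divInvHess v i x := by
    rw [Finset.sum_comm]
    refine Finset.sum_congr rfl fun j _ => ?_
    rw [divInvHess, Finset.mul_sum]
    exact Finset.sum_congr rfl fun i _ => by ring
  have e3 : ∑ i, ∑ j, (hess v x)⁻¹ j i * hess u x i j = ((hess v x)⁻¹ * hess u x).trace := by
    rw [Finset.sum_comm]
    simp [Matrix.trace, Matrix.mul_apply]
  -- Here `∇η = V (x - p)` meets `Vb = -∇ log det V`.
  have e4 : ∑ i, pderiv i (legendre p v) x * divInvHess v i x =
      -radialDeriv p (fun y => Real.log (hess v y).det) x := by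
    simp only [pderiv_legendre hs hv hx, Finset.sum_mul]
    rw [Finset.sum_comm, radialDeriv, ← Finset.sum_neg_distrib]
    refine Finset.sum_congr rfl fun k _ => ?_
    rw [← mul_neg, ← sum_divInvHess_mul_hess hs hv hpd hx, Finset.mul_sum]
    exact Finset.sum_congr rfl fun i _ => by ring
  -- Here `V⁻¹` cancels the `V` in `∇η`.
  have e5 : ∑ i, pderiv i (legendre p v) x * ∑ j, (hess v x)⁻¹ j i * pderiv j u x =
      radialDeriv p u x := by
    have hinv : ∀ j k, ∑ i, (hess v x)⁻¹ j i * hess v x i k =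
        (1 : Matrix (Fin n) (Fin n) ℝ) j k := fun j k => by
      rw [← Matrix.nonsing_inv_mul _ (hpd x hx).det_pos.ne'.isUnit, Matrix.mul_apply]
    calc ∑ i, pderiv i (legendre p v) x * ∑ j, (hess v x)⁻¹ j i * pderiv j u x
        = ∑ i, ∑ j, ∑ k, (hess v x)⁻¹ j i * hess v x i k * ((x k - p k) * pderiv j u x) := by
          refine Finset.sum_congr rfl fun i _ => ?_
          rw [pderiv_legendre hs hv hx, Finset.mul_sum]
          refine Finset.sum_congr rfl fun j _ => ?_
          rw [Finset.sum_mul]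
          exact Finset.sum_congr rfl fun k _ => by ring
      _ = ∑ j, ∑ k, (1 : Matrix (Fin n) (Fin n) ℝ) j k * ((x k - p k) * pderiv j u x) := by
          rw [Finset.sum_comm]
          refine Finset.sum_congr rfl fun j _ => ?_
          rw [Finset.sum_comm]
          refine Finset.sum_congr rfl fun k _ => ?_
          rw [← Finset.sum_mul, hinv]
      _ = radialDeriv p u x := by
          simp [radialDeriv, Matrix.one_apply]
  rw [Finset.sum_congr rfl fun i _ => e1 i]
  simp only [Finset.sum_add_distrib, Finset.sum_sub_distrib, ← Finset.mul_sum, mul_assoc,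
    mul_sub]
  rw [e2, e3, e5]
  have e6 : ∑ i, pderiv i (legendre p v) x * (u x * divInvHess v i x) =
      -(u x * radialDeriv p (fun y => Real.log (hess v y).det) x) := by
    rw [← mul_neg, ← e4, Finset.mul_sum]
    exact Finset.sum_congr rfl fun i _ => by ring
  rw [e6]
  ring

end Inverse

/-! ### The cutoff and its derivatives -/

/-- A cutoff function which decreases slowly from `1` at `η₀` to `0` at `η₀ + S`. -/
def cutoff (η₀ S s : ℝ) : ℝ := max (1 - (s - η₀) / S) 0 ^ 3

/-- Minus the derivative of `cutoff`. -/
def cutoffDensity (η₀ S s : ℝ) : ℝ := 3 / S * max (1 - (s - η₀) / S) 0 ^ 2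

section Cutoff

variable {η₀ S : ℝ}

theorem hasDerivAt_cutoff (hS : 0 < S) (s : ℝ) :
    HasDerivAt (cutoff η₀ S) (-cutoffDensity η₀ S s) s := by
  have h1 : HasDerivAt (fun s => 1 - (s - η₀) / S) (-(1 / S)) s :=
    (((hasDerivAt_id s).sub_const η₀).div_const S).const_sub 1
  have h2 := (hasDerivAt_max_zero_pow 1 (1 - (s - η₀) / S)).comp s h1
  have e : -cutoffDensity η₀ S s = ((1 + 2 : ℕ) : ℝ) * max (1 - (s - η₀) / S) 0 ^ (1 + 1) *
      -(1 / S) := by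
    unfold cutoffDensity
    push_cast
    field_simp
  rw [e]
  exact h2

theorem hasDerivAt_cutoffDensity (hS : 0 < S) (s : ℝ) :
    HasDerivAt (cutoffDensity η₀ S) (-(6 / S ^ 2 * max (1 - (s - η₀) / S) 0)) s := by
  have h1 : HasDerivAt (fun s => 1 - (s - η₀) / S) (-(1 / S)) s :=
    (((hasDerivAt_id s).sub_const η₀).div_const S).const_sub 1
  have h2 := ((hasDerivAt_max_zero_pow 0 (1 - (s - η₀) / S)).comp s h1).const_mul (3 / S)
  have e : -(6 / S ^ 2 * max (1 - (s - η₀) / S) 0) = 3 / S * (((0 + 2 : ℕ) : ℝ) *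
      max (1 - (s - η₀) / S) 0 ^ (0 + 1) * -(1 / S)) := by
    push_cast
    field_simp
    ring
  rw [e]
  exact h2

theorem contDiff_cutoff : ContDiff ℝ 1 (cutoff η₀ S) := by
  refine (contDiff_max_zero_pow 1).comp (g := fun t : ℝ => max t 0 ^ (1 + 2)) ?_
  fun_prop

theorem contDiff_cutoffDensity : ContDiff ℝ 1 (cutoffDensity η₀ S) := by
  refine contDiff_const.mul ((contDiff_max_zero_pow 0).comp
    (g := fun t : ℝ => max t 0 ^ (0 + 2)) ?_)
  fun_prop

theorem cutoff_nonneg (s : ℝ) : 0 ≤ cutoff η₀ S s := by unfold cutoff; positivity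

theorem max_cutoff_le_one (hS : 0 < S) {s : ℝ} (hs : η₀ ≤ s) : max (1 - (s - η₀) / S) 0 ≤ 1 := by
  have : 0 ≤ (s - η₀) / S := div_nonneg (by linarith) hS.le
  exact max_le (by linarith) zero_le_one

theorem cutoff_le_one (hS : 0 < S) {s : ℝ} (hs : η₀ ≤ s) : cutoff η₀ S s ≤ 1 :=
  pow_le_one₀ (le_max_right _ _) (max_cutoff_le_one hS hs)

theorem cutoffDensity_nonneg (hS : 0 < S) (s : ℝ) : 0 ≤ cutoffDensity η₀ S s := by
  unfold cutoffDensity; positivity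

theorem cutoffDensity_le (hS : 0 < S) {s : ℝ} (hs : η₀ ≤ s) : cutoffDensity η₀ S s ≤ 3 / S := by
  unfold cutoffDensity
  have h := pow_le_one₀ (n := 2) (le_max_right _ _) (max_cutoff_le_one hS hs)
  have : 0 < 3 / S := by positivity
  nlinarith

theorem max_cutoff_eq_zero (hS : 0 < S) {s : ℝ} (hs : η₀ + S ≤ s) :
    max (1 - (s - η₀) / S) 0 = 0 := by
  refine max_eq_right ?_
  have : 1 ≤ (s - η₀) / S := by rw [le_div_iff₀ hS]; linarith
  linarith

theorem tendsto_cutoff (η₀ s : ℝ) : Tendsto (fun S => cutoff η₀ S s) atTop (𝓝 1) := by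
  have h1 : Tendsto (fun S : ℝ => 1 - (s - η₀) / S) atTop (𝓝 (1 - 0)) :=
    tendsto_const_nhds.sub (tendsto_const_nhds.div_atTop tendsto_id)
  have h2 := (h1.max (tendsto_const_nhds (x := (0 : ℝ)))).pow 3
  simpa [cutoff] using h2

/-- Where the radial Hessian `D` is large, the derivative of the cutoff density dominates. -/
theorem cutoffDensity_absorb {K κ ε c D s : ℝ} (hK : 0 < K) (hκ : 0 < κ) (hε : 0 < ε) (hS : 0 < S)
    (hS1 : 6 * K / ε ≤ S) (hS2 : 2 * (c - η₀) ≤ S) (hD0 : 0 ≤ D)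
    (hD : c ≤ s → 9 * K ^ 2 / (6 * κ * ε) ≤ D) :
    cutoffDensity η₀ S s * K - 6 / S ^ 2 * max (1 - (s - η₀) / S) 0 * D * κ ≤
      ε * cutoff η₀ S s := by
  unfold cutoffDensity cutoff
  set θ := max (1 - (s - η₀) / S) 0 with hθ
  have hθ0 : 0 ≤ θ := le_max_right _ _
  have hS2' : 0 < S ^ 2 := by positivity
  -- The cutoff is `θ³` and its first two derivatives scale as `θ²/S` and `θ/S²`, so one factor `θ`
  -- divides out.
  suffices h : 3 / S * θ * K - 6 / S ^ 2 * D * κ ≤ ε * θ ^ 2 by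
    have := mul_le_mul_of_nonneg_right h hθ0
    nlinarith
  -- For large `θ` the right-hand side alone suffices. For small `θ` the hypotheses on `S` give `θ <
  -- 1/2`, hence `s > η₀ + S/2 ≥ c`, where `D` is large.
  by_cases h1 : 3 * K / (S * ε) ≤ θ
  · have e1 : 3 / S * θ * K ≤ ε * θ ^ 2 := by
      have : 3 / S * θ * K = ε * θ * (3 * K / (S * ε)) := by field_simp
      rw [this, sq, ← mul_assoc]
      exact mul_le_mul_of_nonneg_left h1 (by positivity)
    have e2 : 0 ≤ 6 / S ^ 2 * D * κ := by positivity
    linarith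
  · push Not at h1
    have h2 : θ < 1 / 2 := by
      refine h1.trans_le ?_
      rw [div_le_div_iff₀ (by positivity) (by norm_num)]
      rw [div_le_iff₀ hε] at hS1
      linarith
    have h3 : c ≤ s := by
      have : 1 - (s - η₀) / S < 1 / 2 := (le_max_left _ _).trans_lt h2
      have : 1 / 2 < (s - η₀) / S := by linarith
      rw [lt_div_iff₀ hS] at this
      linarith
    have h4 := hD h3
    have e1 : 3 / S * θ * K ≤ 9 * K ^ 2 / (S ^ 2 * ε) := by
      have : 9 * K ^ 2 / (S ^ 2 * ε) = 3 / S * (3 * K / (S * ε)) * K := by field_simp; ring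
      rw [this]
      gcongr
    have e2 : 9 * K ^ 2 / (S ^ 2 * ε) ≤ 6 / S ^ 2 * D * κ := by
      have : 9 * K ^ 2 / (S ^ 2 * ε) = 6 / S ^ 2 * (9 * K ^ 2 / (6 * κ * ε)) * κ := by
        field_simp
      rw [this]
      gcongr
    have : 0 ≤ ε * θ ^ 2 := by positivity
    linarith

end Cutoff

/-! ### Exhaustion of the polytope by the Legendre transform -/

namespace Polytope

variable {n m : ℕ} {Δ : Polytope n m} {v A : EuclideanSpace ℝ (Fin n) → ℝ}
  {p : EuclideanSpace ℝ (Fin n)}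

namespace MemS

/-- Since `δ_k ≤ R`, each term `-δ_k(p) log δ_k` is bounded below; dropping all of them, or all but
one, costs only a constant. -/
theorem exists_legendre_lower (hv : Δ.MemS v) (hp : p ∈ Δ.int) : ∃ η₀ C : ℝ, ∀ x ∈ Δ.int,
    η₀ ≤ legendre p v x ∧ ∀ k, -(Δ.δ k p * Real.log (Δ.δ k x)) - C ≤ legendre p v x := by
  obtain ⟨C, hC0, hC⟩ := hv.exists_legendre_bound hp
  obtain ⟨R, hR1, hR⟩ := Δ.exists_δ_le
  set Lg := ∑ k, Δ.δ k p * Real.log R with hLg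
  have hle : ∀ x ∈ Δ.int, ∀ k, 0 ≤ Δ.δ k p * Real.log R - Δ.δ k p * Real.log (Δ.δ k x) := by
    intro x hx k
    have := Real.log_le_log (hx k) (hR x (Δ.int_subset_closed hx) k)
    have := mul_le_mul_of_nonneg_left this (hp k).le
    linarith
  have hsum : ∀ x ∈ Δ.int, ∑ k, (Δ.δ k p * Real.log R - Δ.δ k p * Real.log (Δ.δ k x)) =
      Lg - ∑ k, Δ.δ k p * Real.log (Δ.δ k x) := fun x hx => by rw [Finset.sum_sub_distrib]
  refine ⟨-C - Lg, C + Lg, fun x hx => ⟨?_, fun k => ?_⟩⟩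
  · have h1 := (abs_le.1 (hC x hx)).1
    have h2 := Finset.sum_nonneg fun k (_ : k ∈ Finset.univ) => hle x hx k
    rw [hsum x hx] at h2
    linarith
  · have h1 := (abs_le.1 (hC x hx)).1
    have h2 := Finset.single_le_sum (fun k (_ : k ∈ Finset.univ) => hle x hx k)
      (Finset.mem_univ k)
    rw [hsum x hx] at h2
    have : 0 ≤ Δ.δ k p * Real.log R := mul_nonneg (hp k).le (Real.log_nonneg hR1)
    linarith

/-- If some `δ_k` is small, the lower bound by its logarithm alone makes `η` large. Hence cutoffs in
`η` have compact support in the polytope. -/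
theorem exists_isCompact_legendre (hv : Δ.MemS v) (hp : p ∈ Δ.int) (c : ℝ) :
    ∃ K : Set (EuclideanSpace ℝ (Fin n)), IsCompact K ∧ K ⊆ Δ.int ∧
      ∀ x ∈ Δ.int, x ∉ K → c ≤ legendre p v x := by
  obtain ⟨η₀, C, h⟩ := hv.exists_legendre_lower hp
  refine ⟨_, Δ.isCompact_le_δ fun k => Real.exp (-(c + C) / Δ.δ k p),
    fun x hx k => (Real.exp_pos _).trans_le (hx.2 k), fun x hx hxK => ?_⟩
  have : ∃ k, Δ.δ k x < Real.exp (-(c + C) / Δ.δ k p) := by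
    by_contra! hcon
    exact hxK ⟨Δ.int_subset_closed hx, hcon⟩
  obtain ⟨k, hk⟩ := this
  have h1 := Real.log_le_log (hx k) hk.le
  rw [Real.log_exp, le_div_iff₀ (hp k)] at h1
  have h2 := (h x hx).2 k
  linarith

/-- If the radial Hessian stays below `M`, then its leading term `(δ_k - δ_k(p))²/δ_k` keeps every
`δ_k` away from 0, and `η` is bounded above. -/
theorem exists_le_radialHess (hv : Δ.MemS v) (hp : p ∈ Δ.int) (M : ℝ) :
    ∃ c : ℝ, ∀ x ∈ Δ.int, c ≤ legendre p v x → M ≤ radialHess p v x := by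
  obtain ⟨C, hC0, hC⟩ := hv.exists_legendre_bound hp
  obtain ⟨C', hC0', hC'⟩ := hv.exists_radialHess_bound p
  set M' := |M| + C' with hM'
  have hM'0 : 0 ≤ M' := by positivity
  -- Expanding `(δ_k - δ_k(p))² ≤ M' δ_k` gives `δ_k(p)² ≤ (M' + 2 δ_k(p)) δ_k`.
  set e : Fin m → ℝ := fun k => Δ.δ k p ^ 2 / (M' + 2 * Δ.δ k p) with he
  refine ⟨C - ∑ k, Δ.δ k p * Real.log (e k) + 1, fun x hx hcx => ?_⟩
  by_contra! hlt
  have h1 := (abs_le.1 (hC' x hx)).1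
  have h2 : ∀ k, e k ≤ Δ.δ k x := fun k => by
    have hk := hx k
    have hpk := hp k
    have h3 := Finset.single_le_sum (f := fun k => (Δ.δ k x - Δ.δ k p) ^ 2 / Δ.δ k x)
      (fun k _ => div_nonneg (sq_nonneg _) (hx k).le) (Finset.mem_univ k)
    have h4 : (Δ.δ k x - Δ.δ k p) ^ 2 / Δ.δ k x ≤ M' := by
      have := le_abs_self M
      linarith
    rw [div_le_iff₀ hk] at h4
    rw [he]
    rw [div_le_iff₀ (by positivity)]
    nlinarith [sq_nonneg (Δ.δ k x)]
  have h3 := (abs_le.1 (hC x hx)).2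
  have h4 : ∑ k, Δ.δ k p * Real.log (e k) ≤ ∑ k, Δ.δ k p * Real.log (Δ.δ k x) :=
    Finset.sum_le_sum fun k _ => mul_le_mul_of_nonneg_left (Real.log_le_log (by
      have := hp k
      positivity) (h2 k)) (hp k).le
  linarith

theorem exists_radialHess_le (hv : Δ.MemS v) (hp : p ∈ Δ.int) :
    ∃ C : ℝ, 0 ≤ C ∧ ∀ x ∈ Δ.int,
      radialHess p v x ≤ ∑ k, Δ.δ k p * (Δ.δ k p / Δ.δ k x) + C := by
  obtain ⟨C, hC0, hC⟩ := hv.exists_radialHess_bound p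
  obtain ⟨R, hR1, hR⟩ := Δ.exists_δ_le
  refine ⟨C + m * R, by positivity, fun x hx => ?_⟩
  have h1 := (abs_le.1 (hC x hx)).2
  have h2 : ∑ k, (Δ.δ k x - Δ.δ k p) ^ 2 / Δ.δ k x ≤
      ∑ k, (Δ.δ k p * (Δ.δ k p / Δ.δ k x) + R) := by
    refine Finset.sum_le_sum fun k _ => ?_
    have h3 := hR x (Δ.int_subset_closed hx) k
    have h4 := hx k
    have h5 := hp k
    have : (Δ.δ k x - Δ.δ k p) ^ 2 / Δ.δ k x =
        Δ.δ k p * (Δ.δ k p / Δ.δ k x) + (Δ.δ k x - 2 * Δ.δ k p) := by field_simp; ring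
    rw [this]; linarith
  rw [Finset.sum_add_distrib] at h2
  simp only [Finset.sum_const, Finset.card_univ, Fintype.card_fin, nsmul_eq_mul] at h2
  linarith

end MemS

/-- Comparison of the cutoff density of the Legendre transform with the logarithmic density of
the distance to a facet. -/
theorem cutoffDensity_mul_le {η₀ C S : ℝ} (hS : 0 < S) (hp : p ∈ Δ.int)
    {x : EuclideanSpace ℝ (Fin n)} (hx : x ∈ Δ.int) (k : Fin m)
    (h : -(Δ.δ k p * Real.log (Δ.δ k x)) - C ≤ legendre p v x) :
    cutoffDensity η₀ S (legendre p v x) * (Δ.δ k p / Δ.δ k x) ≤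
      logDensity (Δ.δ k p) (C + η₀) S (Δ.δ k x) := by
  unfold cutoffDensity logDensity
  have h1 := hx k
  have h2 := hp k
  refine mul_le_mul_of_nonneg_right (mul_le_mul_of_nonneg_left ?_ (by positivity)) (by positivity)
  refine pow_le_pow_left₀ (le_max_right _ _) (max_le_max ?_ le_rfl) 2
  have : -((legendre p v x - η₀) / S) ≤ (Δ.δ k p * Real.log (Δ.δ k x) + (C + η₀)) / S := by
    rw [← neg_div, div_le_div_iff_of_pos_right hS]
    linarith
  linarith

theorem eventually_integral_logDensity_le (hp : p ∈ Δ.int) (C : ℝ)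
    {u : EuclideanSpace ℝ (Fin n) → ℝ} (hu : ContinuousOn u Δ.closed)
    (hu0 : ∀ x ∈ Δ.int, 0 ≤ u x) {ε : ℝ} (hε : 0 < ε) :
    ∀ᶠ S in atTop, ∀ k, ∫ x in Δ.int, logDensity (Δ.δ k p) C S (Δ.δ k x) * u x ≤
      ∫ x, u x ∂Δ.facetMeasure k + ε :=
  eventually_all.2 fun k => Δ.exists_integral_logDensity_le k (hp k) C hu hu0 hε

theorem integrableOn_logDensity (hp : p ∈ Δ.int) (k : Fin m) {C S : ℝ} (hS : 0 < S)
    {u : EuclideanSpace ℝ (Fin n) → ℝ} (hu : ContinuousOn u Δ.closed) :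
    IntegrableOn (fun x => logDensity (Δ.δ k p) C S (Δ.δ k x) * u x) Δ.int :=
  ((Δ.continuousOn_logDensity_δ_mul k (hp k) hS hu).integrableOn_compact
    Δ.isCompact_closed).mono_set Δ.int_subset_closed

theorem integrableOn_int {u : EuclideanSpace ℝ (Fin n) → ℝ} (hu : ContinuousOn u Δ.closed) :
    IntegrableOn u Δ.int :=
  (hu.integrableOn_compact Δ.isCompact_closed).mono_set Δ.int_subset_closed

theorem tendsto_setIntegral_cutoff {f η : EuclideanSpace ℝ (Fin n) → ℝ} {η₀ : ℝ}
    (hf : IntegrableOn f Δ.int) (hη : ContinuousOn η Δ.int) (hη₀ : ∀ x ∈ Δ.int, η₀ ≤ η x) :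
    Tendsto (fun S => ∫ x in Δ.int, cutoff η₀ S (η x) * f x) atTop (𝓝 (∫ x in Δ.int, f x)) := by
  refine tendsto_integral_filter_of_dominated_convergence (fun x => ‖f x‖) ?_ ?_ hf.norm ?_
  · filter_upwards with S
    refine AEStronglyMeasurable.mul ?_ hf.aestronglyMeasurable
    exact (contDiff_cutoff.continuous.comp_continuousOn hη).aestronglyMeasurable
      Δ.isOpen_int.measurableSet
  · filter_upwards [eventually_gt_atTop 0] with S hS
    filter_upwards [ae_restrict_mem Δ.isOpen_int.measurableSet] with x hx
    rw [norm_mul, Real.norm_of_nonneg (cutoff_nonneg _)]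
    exact mul_le_of_le_one_left (norm_nonneg _) (cutoff_le_one hS (hη₀ x hx))
  · filter_upwards with x
    simpa using (tendsto_cutoff η₀ (η x)).mul_const (f x)

end Polytope
end Abreu

/-! ### The trace inequality -/

namespace Abreu
namespace Polytope

variable {n m : ℕ} {Δ : Polytope n m} {v A : EuclideanSpace ℝ (Fin n) → ℝ}
  {p : EuclideanSpace ℝ (Fin n)}

theorem radialDeriv_δ (k : Fin m) (x : EuclideanSpace ℝ (Fin n)) :
    radialDeriv p (Δ.δ k) x = Δ.δ k x - Δ.δ k p := by
  simp only [radialDeriv, pderiv_δ]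
  rw [Δ.δ_eq_add k x p, add_sub_cancel_left]
  exact Finset.sum_congr rfl fun i _ => by ring

theorem exists_abs_radialDeriv_le {u : EuclideanSpace ℝ (Fin n) → ℝ}
    (hu : ContDiffOn ℝ ∞ u Δ.closed) (p : EuclideanSpace ℝ (Fin n)) :
    ∃ C : ℝ, 0 ≤ C ∧ ∀ x ∈ Δ.int, |u x| ≤ C ∧ |radialDeriv p u x| ≤ C := by
  obtain ⟨C, hC0, hC⟩ := exists_abs_le_of_contDiffOn_closed hu
  obtain ⟨B, hB0, hB⟩ := exists_coord_sub_le (Δ := Δ) p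
  refine ⟨C + n * (B * C), by positivity, fun x hx => ?_⟩
  obtain ⟨c0, c1, -⟩ := hC x hx
  have h1 : |radialDeriv p u x| ≤ n * (B * C) := by
    refine (Finset.abs_sum_le_sum_abs _ _).trans ?_
    refine (Finset.sum_le_card_nsmul _ _ (B * C) fun j _ => ?_).trans (by simp)
    rw [abs_mul]
    exact mul_le_mul (hB x (Δ.int_subset_closed hx) j) (c1 j) (abs_nonneg _) hB0
  have : 0 ≤ n * (B * C) := by positivity
  constructor <;> linarith

/-- A trace inequality: the solid integral of a function which is radially nondecreasing is
controlled by its integral over the boundary. -/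
theorem MemS.integral_le_sum_facet (hv : Δ.MemS v) (hp : p ∈ Δ.int)
    {w : EuclideanSpace ℝ (Fin n) → ℝ} (hw : ContDiffOn ℝ ∞ w Δ.closed)
    (hw0 : ∀ x ∈ Δ.int, 0 ≤ w x) (hrad : ∀ x ∈ Δ.int, 0 ≤ radialDeriv p w x) :
    n * ∫ x in Δ.int, w x ≤ ∑ k, Δ.δ k p * ∫ x, w x ∂Δ.facetMeasure k := by
  obtain ⟨η₀, C, hη⟩ := hv.exists_legendre_lower hp
  obtain ⟨D, hD0, hD⟩ := hv.exists_radialHess_le hp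
  have hs := Δ.isOpen_int
  have hvs := hv.contDiffOn_int
  have hwi := hw.mono Δ.int_subset_closed
  have hηs := contDiffOn_legendre (p := p) hs hvs
  have hd : ∀ {f : EuclideanSpace ℝ (Fin n) → ℝ}, ContDiffOn ℝ ∞ f Δ.int → ∀ x ∈ Δ.int,
      DifferentiableAt ℝ f x :=
    fun hf x hx => (hf.contDiffAt (hs.mem_nhds hx)).differentiableAt (by simp)
  have hwint : IntegrableOn w Δ.int := integrableOn_int hw.continuousOn
  have step : ∀ S, 0 < S → n * ∫ x in Δ.int, cutoff η₀ S (legendre p v x) * w x ≤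
      ∑ k, Δ.δ k p * (∫ x in Δ.int, logDensity (Δ.δ k p) (C + η₀) S (Δ.δ k x) * w x) +
        D * (3 / S) * ∫ x in Δ.int, w x := by
    intro S hS
    obtain ⟨K, hK, hKs, hK0⟩ := hv.exists_isCompact_legendre hp (η₀ + S)
    have hG0 : ∀ x ∈ Δ.int, x ∉ K → cutoff η₀ S (legendre p v x) = 0 := fun x hx hxK => by
      unfold cutoff; rw [max_cutoff_eq_zero hS (hK0 x hx hxK)]; simp
    have hGs : ContDiffOn ℝ 1 (fun x => cutoff η₀ S (legendre p v x)) Δ.int :=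
      contDiff_cutoff.comp_contDiffOn (hηs.of_le (by norm_cast))
    have hw1 : ContDiffOn ℝ 1 w Δ.int := hwi.of_le (by norm_cast)
    obtain ⟨hI1, hI2⟩ := setIntegral_radial_eq_zero (p := p) hK hKs hs (hGs.mul hw1)
      fun x hx hxK => by simp [hG0 x hx hxK]
    have hGw : IntegrableOn (fun x => cutoff η₀ S (legendre p v x) * w x) Δ.int :=
      integrableOn_of_continuousOn_of_eqOn_zero hK hKs hs (hGs.mul hw1).continuousOn
        fun x hx hxK => by simp [hG0 x hx hxK]
    have hq : ∀ k, IntegrableOn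
        (fun x => logDensity (Δ.δ k p) (C + η₀) S (Δ.δ k x) * w x) Δ.int :=
      fun k => integrableOn_logDensity hp k hS hw.continuousOn
    have hqs : IntegrableOn (fun x => ∑ k, Δ.δ k p *
        (logDensity (Δ.δ k p) (C + η₀) S (Δ.δ k x) * w x)) Δ.int :=
      integrable_finsetSum _ fun k _ => (hq k).const_mul _
    have hsum : IntegrableOn (fun x => ∑ k, Δ.δ k p *
        (logDensity (Δ.δ k p) (C + η₀) S (Δ.δ k x) * w x) + D * (3 / S) * w x) Δ.int :=
      hqs.add (hwint.const_mul _)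
    -- The divergence of `G w (x - p)` is `n G w + G rad w - ρ D w`, with `D` the radial Hessian.
    -- The middle term is nonnegative, and `ρ D` is bounded by the facet densities plus an `O(1/S)`
    -- term.
    have hmono : ∫ x in Δ.int, n * (cutoff η₀ S (legendre p v x) * w x) ≤
        ∫ x in Δ.int, ((n * (cutoff η₀ S (legendre p v x) * w x) +
          radialDeriv p (fun x => cutoff η₀ S (legendre p v x) * w x) x) +
          (∑ k, Δ.δ k p * (logDensity (Δ.δ k p) (C + η₀) S (Δ.δ k x) * w x) +
            D * (3 / S) * w x)) := by
      refine setIntegral_mono_on (hGw.const_mul _)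
        (hI1.add hsum) hs.measurableSet fun x hx => ?_
      have hηx := hd hηs x hx
      have hGd : DifferentiableAt ℝ (fun x => cutoff η₀ S (legendre p v x)) x :=
        (hGs.contDiffAt (hs.mem_nhds hx)).differentiableAt one_ne_zero
      rw [radialDeriv_mul hGd (hd hwi x hx), radialDeriv_comp (hasDerivAt_cutoff hS _) hηx,
        radialDeriv_legendre hs hvs hx]
      have hw0x := hw0 x hx
      have h1 : 0 ≤ cutoff η₀ S (legendre p v x) * radialDeriv p w x :=
        mul_nonneg (cutoff_nonneg _) (hrad x hx)
      have hρ0 := cutoffDensity_nonneg (η₀ := η₀) hS (legendre p v x)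
      have h2 : cutoffDensity η₀ S (legendre p v x) * radialHess p v x * w x ≤
          ∑ k, Δ.δ k p * (logDensity (Δ.δ k p) (C + η₀) S (Δ.δ k x) * w x) +
            D * (3 / S) * w x := by
        have h3 : cutoffDensity η₀ S (legendre p v x) * radialHess p v x ≤
            ∑ k, Δ.δ k p * logDensity (Δ.δ k p) (C + η₀) S (Δ.δ k x) + D * (3 / S) := by
          refine (mul_le_mul_of_nonneg_left (hD x hx) hρ0).trans ?_
          rw [mul_add, Finset.mul_sum]
          refine add_le_add (Finset.sum_le_sum fun k _ => ?_) ?_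
          · have := cutoffDensity_mul_le (η₀ := η₀) hS hp hx k ((hη x hx).2 k)
            have := mul_le_mul_of_nonneg_left this (hp k).le
            linarith
          · rw [mul_comm]
            exact mul_le_mul_of_nonneg_left (cutoffDensity_le hS (hη x hx).1) hD0
        refine (mul_le_mul_of_nonneg_right h3 hw0x).trans_eq ?_
        rw [add_mul, Finset.sum_mul]
        congr 1
        exact Finset.sum_congr rfl fun k _ => by ring
      linarith
    rw [integral_const_mul, integral_add hI1 hsum, hI2, zero_add,
      integral_add hqs (hwint.const_mul _), integral_const_mul,
      integral_finsetSum _ fun k _ => (hq k).const_mul _] at hmono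
    simpa only [integral_const_mul] using hmono
  have hlimL : Tendsto (fun S => n * ∫ x in Δ.int, cutoff η₀ S (legendre p v x) * w x) atTop
      (𝓝 (n * ∫ x in Δ.int, w x)) :=
    (tendsto_setIntegral_cutoff hwint hηs.continuousOn fun x hx => (hη x hx).1).const_mul _
  refine le_of_forall_pos_le_add fun ε hε => ?_
  set T := ∑ k, Δ.δ k p with hT
  have hT0 : 0 ≤ T := Finset.sum_nonneg fun k _ => (hp k).le
  set ε' := ε / (T + 1) with hε'
  have hε'0 : 0 < ε' := by positivity
  have hlimR : Tendsto (fun S : ℝ => ∑ k, Δ.δ k p * (∫ x, w x ∂Δ.facetMeasure k + ε') +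
      D * (3 / S) * ∫ x in Δ.int, w x) atTop
      (𝓝 (∑ k, Δ.δ k p * (∫ x, w x ∂Δ.facetMeasure k + ε') + D * 0 * ∫ x in Δ.int, w x)) :=
    tendsto_const_nhds.add (((tendsto_const_nhds.div_atTop tendsto_id).const_mul _).mul_const _)
  have := le_of_tendsto_of_tendsto hlimL hlimR (by
    filter_upwards [eventually_gt_atTop 0,
      eventually_integral_logDensity_le hp (C + η₀) hw.continuousOn hw0 hε'0] with S hS hS2
    refine (step S hS).trans (add_le_add (Finset.sum_le_sum fun k _ => ?_) le_rfl)
    exact mul_le_mul_of_nonneg_left (hS2 k) (hp k).le)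
  refine this.trans ?_
  simp only [mul_add, Finset.sum_add_distrib, ← Finset.sum_mul]
  have : T * ε' ≤ ε := by
    rw [hε', mul_div_assoc', div_le_iff₀ (by positivity)]
    nlinarith
  rw [← hT]
  linarith

end Polytope
-- The logarithmic barrier and the main estimate
section LogBarrier

variable {n m : ℕ} {p x : EuclideanSpace ℝ (Fin n)} {f : EuclideanSpace ℝ (Fin n) → ℝ}

theorem radialDeriv_const (c : ℝ) : radialDeriv p (fun _ => c) x = 0 := by
  simp [radialDeriv, pderiv_const]

theorem radialDeriv_sum {ι : Type*} {s : Finset ι} {F : ι → EuclideanSpace ℝ (Fin n) → ℝ}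
    (hF : ∀ a ∈ s, DifferentiableAt ℝ (F a) x) :
    radialDeriv p (fun y => ∑ a ∈ s, F a y) x = ∑ a ∈ s, radialDeriv p (F a) x := by
  simp only [radialDeriv]
  rw [Finset.sum_comm]
  refine Finset.sum_congr rfl fun i _ => ?_
  rw [pderiv_sum hF, Finset.mul_sum]

namespace Polytope

/-- The logarithmic barrier function of a polytope, up to an additive constant. -/
def logBarrier (Δ : Polytope n m) (C : ℝ) (x : EuclideanSpace ℝ (Fin n)) : ℝ :=
  C - ∑ k, Real.log (Δ.δ k x)

variable {Δ : Polytope n m} {C : ℝ}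

theorem contDiffOn_logBarrier : ContDiffOn ℝ ∞ (Δ.logBarrier C) Δ.int :=
  contDiffOn_const.sub (ContDiffOn.sum fun k _ => (Δ.contDiff_δ k).contDiffOn.log
    fun _ hx => (hx k).ne')

theorem integrableOn_logBarrier : IntegrableOn (Δ.logBarrier C) Δ.int := by
  have h1 : IntegrableOn (fun _ : EuclideanSpace ℝ (Fin n) => C) Δ.int :=
    integrableOn_int continuousOn_const
  have h2 : IntegrableOn (fun x => ∑ k, Real.log (Δ.δ k x)) Δ.int :=
    integrable_finsetSum _ fun k _ => Δ.integrableOn_log_δ k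
  exact h1.sub h2

/-- The singular terms `δ_k(p)/δ_k` are exactly the factors in `cutoffDensity_mul_le`, which turn
the cutoff density of `η` into a density concentrating on the facet `k`. All of them have weight 1,
so their sum gives `σ` itself. -/
theorem radialDeriv_logBarrier (hx : x ∈ Δ.int) :
    radialDeriv p (Δ.logBarrier C) x = ∑ k, (Δ.δ k p / Δ.δ k x - 1) := by
  have hd : ∀ k, DifferentiableAt ℝ (fun y => Real.log (Δ.δ k y)) x := fun k =>
    (Δ.differentiableAt_δ k x).log (hx k).ne'
  have : radialDeriv p (Δ.logBarrier C) x = -∑ k, (Δ.δ k x)⁻¹ * (Δ.δ k x - Δ.δ k p) := by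
    unfold logBarrier
    rw [radialDeriv_sub (differentiableAt_const _) (DifferentiableAt.fun_sum fun k _ => hd k),
      radialDeriv_const, radialDeriv_sum fun k _ => hd k, zero_sub]
    congr 1
    refine Finset.sum_congr rfl fun k _ => ?_
    rw [radialDeriv_comp (Real.hasDerivAt_log (hx k).ne') (Δ.differentiableAt_δ k x),
      radialDeriv_δ]
  rw [this, ← Finset.sum_neg_distrib]
  refine Finset.sum_congr rfl fun k _ => ?_
  have := (hx k).ne'
  field_simp
  ring

end Polytope

end LogBarrier

namespace Polytope

variable {n m : ℕ} {Δ : Polytope n m} {v A u φ : EuclideanSpace ℝ (Fin n) → ℝ}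
  {p : EuclideanSpace ℝ (Fin n)}

theorem sum_pderiv_divInvHess (hv : Δ.MemS v) (hsol : Δ.SolvesAbreu A v)
    {x : EuclideanSpace ℝ (Fin n)} (hx : x ∈ Δ.int) :
    ∑ i, pderiv i (divInvHess v i) x = -A x := by
  rw [← (hsol x hx).2]
  refine Finset.sum_congr rfl fun i _ => ?_
  unfold divInvHess
  refine pderiv_sum fun j _ => ?_
  have := ContDiffOn.pderiv_of_isOpen Δ.isOpen_int
    (contDiffOn_hess_inv Δ.isOpen_int hv.contDiffOn_int (fun y hy => (hsol y hy).1) i j) j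
  exact (this.contDiffAt (Δ.isOpen_int.mem_nhds hx)).differentiableAt (by simp)

/-- Pointwise bookkeeping for the main estimate. Here `G` is the cutoff, `ρ` its density, `τ` minus
the derivative of the density, `d` the radial Hessian, `t` the trace `tr(V⁻¹ D²u)`, `w` the function
`u`, `b = B - Λ` with `Λ = log det V`, and the prefix `r` marks radial derivatives. The terms in
`rΛ` cancel between the two divergences. The terms in `b` collect into `b` times the bracket bounded
by `ε G`, and the part `(ε/κ) G t` of the resulting error is paid for by the factor `1 - ε/κ`. -/
theorem absorbed_integrand_le {G ρ t a w rw rΛ rB d b B K Q κ ε f τ N : ℝ} (hG0 : 0 ≤ G)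
    (hG1 : G ≤ 1) (hf : f ≤ 1) (ht : 0 ≤ t) (hκ : 0 < κ) (hε0 : 0 ≤ ε) (hε : ε ≤ κ)
    (hb0 : 0 ≤ b) (hb : b ≤ |B| + κ⁻¹ * t) (hbr : N * ρ * w + ρ * rw - τ * d * w ≤ ε * G)
    (hK : ρ * rw ≤ K) (hQ : ρ * w * rB ≤ Q) :
    G * ((1 - ε / κ) * (f * t) + a * w) + ((G * (w * -a - t) + ρ * (w * rΛ + rw)) +
      (N * (ρ * (w * b)) + (ρ * (w * (rB - rΛ) + rw * b) - τ * d * (w * b)))) ≤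
      K + (Q + ε * |B|) := by
  have h1 : b * (N * ρ * w + ρ * rw - τ * d * w) ≤ b * (ε * G) :=
    mul_le_mul_of_nonneg_left hbr hb0
  have h2 : b * (ε * G) ≤ (|B| + κ⁻¹ * t) * (ε * G) :=
    mul_le_mul_of_nonneg_right hb (mul_nonneg hε0 hG0)
  have h3 : 0 ≤ 1 - ε / κ := by
    rw [sub_nonneg, div_le_one hκ]; exact hε
  have h4 : G * ((1 - ε / κ) * (f * t)) ≤ G * ((1 - ε / κ) * t) :=
    mul_le_mul_of_nonneg_left (mul_le_mul_of_nonneg_left (mul_le_of_le_one_left ht hf) h3) hG0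
  have h5 : ε * |B| * G ≤ ε * |B| := mul_le_of_le_one_right (by positivity) hG1
  have h6 : ε / κ = ε * κ⁻¹ := div_eq_mul_inv _ _
  rw [h6] at h4 ⊢
  linarith

/-- Two compactly supported fields are integrated together: `G (u div V⁻¹ - V⁻¹∇u)` and `ρ u (B -
log det V)(x - p)`, with `B` the barrier. The second removes the uncontrolled radial derivative of
`log det V` from the first. Then `S → ∞`. -/
theorem MemS.setIntegral_trace_absorbed_le (hv : Δ.MemS v) (hsol : Δ.SolvesAbreu A v)
    (hA : ContinuousOn A Δ.closed) (hp : p ∈ Δ.int) (hu : ContDiffOn ℝ ∞ u Δ.closed) {κ : ℝ}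
    (hκ : 0 < κ) (huκ : ∀ x ∈ Δ.int, κ ≤ u x)
    (hU : ∀ x ∈ Δ.int, (hess u x - κ • (1 : Matrix (Fin n) (Fin n) ℝ)).PosSemidef)
    {K : Set (EuclideanSpace ℝ (Fin n))} (hK : IsCompact K) (hKs : K ⊆ Δ.int)
    (hφ : ContinuousOn φ Δ.int) (hφ1 : ∀ x ∈ Δ.int, φ x ≤ 1)
    (hφK : ∀ x ∈ Δ.int, x ∉ K → φ x = 0) {C : ℝ}
    (hC : ∀ x ∈ Δ.int, Real.log (hess v x).det ≤ Δ.logBarrier C x) {ε : ℝ} (hε0 : 0 < ε)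
    (hε : ε ≤ κ) :
    (1 - ε / κ) * (∫ x in Δ.int, φ x * ((hess v x)⁻¹ * hess u x).trace) +
      (∫ x in Δ.int, A x * u x) ≤
      (∫ x, u x ∂Δ.σ) + ε * ∫ x in Δ.int, |Δ.logBarrier C x| := by
  obtain ⟨η₀, Cη, hη⟩ := hv.exists_legendre_lower hp
  obtain ⟨K₁, hK₁0, hK₁⟩ := exists_abs_radialDeriv_le hu p
  -- A bound for `n u + rad u`, made positive by the extra 1.
  set Kb : ℝ := n * K₁ + K₁ + 1 with hKb
  have hKb0 : 0 < Kb := by positivity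
  obtain ⟨c, hc⟩ := hv.exists_le_radialHess hp (9 * Kb ^ 2 / (6 * κ * ε))
  have hs := Δ.isOpen_int
  have hvs := hv.contDiffOn_int
  have hpd : ∀ x ∈ Δ.int, (hess v x).PosDef := fun x hx => (hsol x hx).1
  have hui := hu.mono Δ.int_subset_closed
  have hηs := contDiffOn_legendre (p := p) hs hvs
  have hΛs := contDiffOn_log_det hs hvs hpd
  have hBs := contDiffOn_logBarrier (Δ := Δ) (C := C)
  have hd : ∀ {f : EuclideanSpace ℝ (Fin n) → ℝ}, ContDiffOn ℝ ∞ f Δ.int → ∀ x ∈ Δ.int,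
      DifferentiableAt ℝ f x :=
    fun hf x hx => (hf.contDiffAt (hs.mem_nhds hx)).differentiableAt (by simp)
  set tr : EuclideanSpace ℝ (Fin n) → ℝ := fun x => ((hess v x)⁻¹ * hess u x).trace with htr
  have htrc : ContinuousOn tr Δ.int := by
    have : ContDiffOn ℝ ∞ tr Δ.int := by
      simp only [htr, Matrix.trace, Matrix.diag_apply, Matrix.mul_apply]
      exact ContDiffOn.sum fun i _ => ContDiffOn.sum fun j _ =>
        (contDiffOn_hess_inv hs hvs hpd i j).mul (contDiffOn_hess hs hui j i)
    exact this.continuousOn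
  have hκtr : ∀ x ∈ Δ.int, κ * ((hess v x)⁻¹).trace ≤ tr x := fun x hx => by
    have := (hpd x hx).inv.posSemidef.trace_mul_nonneg (hU x hx)
    rw [Matrix.mul_sub, Matrix.trace_sub, Matrix.mul_smul, Matrix.mul_one, Matrix.trace_smul,
      smul_eq_mul] at this
    linarith
  have htr0 : ∀ x ∈ Δ.int, 0 ≤ tr x := fun x hx =>
    (mul_nonneg hκ.le (hpd x hx).inv.posSemidef.trace_nonneg).trans (hκtr x hx)
  -- `-log det V = log det V⁻¹ ≤ tr V⁻¹ ≤ κ⁻¹ tr(V⁻¹ D²u)`: a possible degeneration of `det V` is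
  -- charged to the trace being estimated.
  have hΛ : ∀ x ∈ Δ.int, Δ.logBarrier C x - Real.log (hess v x).det ≤
      |Δ.logBarrier C x| + κ⁻¹ * tr x := fun x hx => by
    have h1 := (hpd x hx).inv.log_det_le_trace_sub_card
    rw [Matrix.det_nonsing_inv, Ring.inverse_eq_inv', Real.log_inv] at h1
    have h2 : ((hess v x)⁻¹).trace ≤ κ⁻¹ * tr x := by
      rw [inv_mul_eq_div, le_div_iff₀ hκ, mul_comm]; exact hκtr x hx
    have h3 : (0 : ℝ) ≤ Fintype.card (Fin n) := by positivity
    linarith [le_abs_self (Δ.logBarrier C x)]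
  have hφtr : IntegrableOn (fun x => φ x * tr x) Δ.int :=
    integrableOn_of_continuousOn_of_eqOn_zero hK hKs hs (hφ.mul htrc)
      fun x hx hxK => by simp [hφK x hx hxK]
  have hAu : IntegrableOn (fun x => A x * u x) Δ.int := integrableOn_int (hA.mul hu.continuousOn)
  have hF : IntegrableOn (fun x => (1 - ε / κ) * (φ x * tr x) + A x * u x) Δ.int :=
    (hφtr.const_mul _).add hAu
  have step : ∀ S, 1 ≤ S → 6 * Kb / ε ≤ S → 2 * (c - η₀) ≤ S →
      ∫ x in Δ.int, cutoff η₀ S (legendre p v x) * ((1 - ε / κ) * (φ x * tr x) + A x * u x) ≤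
      3 / S * K₁ * (volume.real Δ.int) +
        ((∑ k, ∫ x in Δ.int, logDensity (Δ.δ k p) (Cη + η₀) S (Δ.δ k x) * u x) +
        ε * ∫ x in Δ.int, |Δ.logBarrier C x|) := by
    intro S hS1 hS2 hS3
    have hS : 0 < S := by linarith
    obtain ⟨Kc, hKc, hKcs, hKc0⟩ := hv.exists_isCompact_legendre hp (η₀ + S)
    have hG0 : ∀ x ∈ Δ.int, x ∉ Kc → cutoff η₀ S (legendre p v x) = 0 := fun x hx hxK => by
      unfold cutoff; rw [max_cutoff_eq_zero hS (hKc0 x hx hxK)]; simp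
    have hρ0 : ∀ x ∈ Δ.int, x ∉ Kc → cutoffDensity η₀ S (legendre p v x) = 0 :=
      fun x hx hxK => by
        unfold cutoffDensity; rw [max_cutoff_eq_zero hS (hKc0 x hx hxK)]; simp
    have hη1 : ContDiffOn ℝ 1 (legendre p v) Δ.int := hηs.of_le (by norm_cast)
    have hGs : ContDiffOn ℝ 1 (fun x => cutoff η₀ S (legendre p v x)) Δ.int :=
      contDiff_cutoff.comp_contDiffOn hη1
    have hρs : ContDiffOn ℝ 1 (fun x => cutoffDensity η₀ S (legendre p v x)) Δ.int :=
      contDiff_cutoffDensity.comp_contDiffOn hη1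
    have hX : ∀ i, ContDiffOn ℝ 1 (fun y => cutoff η₀ S (legendre p v y) *
        (u y * divInvHess v i y - ∑ j, (hess v y)⁻¹ j i * pderiv j u y)) Δ.int := fun i => by
      refine hGs.mul (ContDiffOn.of_le (n := ∞) ?_ (by norm_cast))
      exact (hui.mul (contDiffOn_divInvHess hs hvs hpd i)).sub (ContDiffOn.sum fun j _ =>
        (contDiffOn_hess_inv hs hvs hpd j i).mul (ContDiffOn.pderiv_of_isOpen hs hui j))
    obtain ⟨hI1, hI1'⟩ := setIntegral_divergence_eq_zero hKc hKcs hs hX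
      fun i x hx hxK => by simp [hG0 x hx hxK]
    have hub : ContDiffOn ℝ ∞
        (fun y => u y * (Δ.logBarrier C y - Real.log (hess v y).det)) Δ.int :=
      hui.mul (hBs.sub hΛs)
    obtain ⟨hI2, hI2'⟩ := setIntegral_radial_eq_zero (p := p) hKc hKcs hs
      (hρs.mul (hub.of_le (by norm_cast))) fun x hx hxK => by simp [hρ0 x hx hxK]
    have hGF : IntegrableOn (fun x => cutoff η₀ S (legendre p v x) *
        ((1 - ε / κ) * (φ x * tr x) + A x * u x)) Δ.int := by
      refine integrableOn_of_continuousOn_of_eqOn_zero hKc hKcs hs ?_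
        fun x hx hxK => by simp [hG0 x hx hxK]
      exact hGs.continuousOn.mul ((continuousOn_const.mul (hφ.mul htrc)).add
        ((hA.mono Δ.int_subset_closed).mul hui.continuousOn))
    have hq : ∀ k, IntegrableOn
        (fun x => logDensity (Δ.δ k p) (Cη + η₀) S (Δ.δ k x) * u x) Δ.int :=
      fun k => integrableOn_logDensity hp k hS hu.continuousOn
    have hqs : IntegrableOn (fun x => ∑ k,
        logDensity (Δ.δ k p) (Cη + η₀) S (Δ.δ k x) * u x) Δ.int :=
      integrable_finsetSum _ fun k _ => hq k
    have hBi : IntegrableOn (fun x => ε * |Δ.logBarrier C x|) Δ.int :=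
      integrableOn_logBarrier.abs.const_mul _
    have hci : IntegrableOn (fun _ : EuclideanSpace ℝ (Fin n) => 3 / S * K₁) Δ.int :=
      integrableOn_int continuousOn_const
    have hR1 : IntegrableOn (fun x => (∑ k,
        logDensity (Δ.δ k p) (Cη + η₀) S (Δ.δ k x) * u x) + ε * |Δ.logBarrier C x|) Δ.int :=
      hqs.add hBi
    have hmono := setIntegral_mono_on (hGF.add (hI1.add hI2)) (hci.add hR1) hs.measurableSet
      fun x hx => by
        have hηx := hd hηs x hx
        have hux := hd hui x hx
        have hρd : DifferentiableAt ℝ (fun x => cutoffDensity η₀ S (legendre p v x)) x :=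
          (hρs.contDiffAt (hs.mem_nhds hx)).differentiableAt one_ne_zero
        have e1 := divergence_identity (p := p) hs hvs hpd hui hx
          (hasDerivAt_cutoff (η₀ := η₀) hS _)
        have hbd : DifferentiableAt ℝ
          (fun y => Δ.logBarrier C y - Real.log (hess v y).det) x := hd (hBs.sub hΛs) x hx
        have e2 : radialDeriv p (fun x => cutoffDensity η₀ S (legendre p v x) *
            (u x * (Δ.logBarrier C x - Real.log (hess v x).det))) x =
            cutoffDensity η₀ S (legendre p v x) *
              (u x * (radialDeriv p (Δ.logBarrier C) x -
                radialDeriv p (fun y => Real.log (hess v y).det) x) +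
                radialDeriv p u x * (Δ.logBarrier C x - Real.log (hess v x).det)) -
            6 / S ^ 2 * max (1 - (legendre p v x - η₀) / S) 0 * radialHess p v x *
              (u x * (Δ.logBarrier C x - Real.log (hess v x).det)) := by
          rw [radialDeriv_mul hρd (hd hub x hx), radialDeriv_mul hux hbd,
            radialDeriv_sub (hd hBs x hx) (hd hΛs x hx),
            radialDeriv_comp (hasDerivAt_cutoffDensity hS _) hηx,
            radialDeriv_legendre hs hvs hx]
          ring
        have hρ := cutoffDensity_nonneg (η₀ := η₀) hS (legendre p v x)
        have hu0 : 0 ≤ u x := hκ.le.trans (huκ x hx)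
        have hD0 := radialHess_nonneg (p := p) (hpd x hx).posSemidef
        obtain ⟨k1, k2⟩ := hK₁ x hx
        -- The lower bound `u ≥ κ` lets the negative term with the radial Hessian absorb the rest of
        -- the bracket.
        have hbr : n * cutoffDensity η₀ S (legendre p v x) * u x +
            cutoffDensity η₀ S (legendre p v x) * radialDeriv p u x -
            6 / S ^ 2 * max (1 - (legendre p v x - η₀) / S) 0 * radialHess p v x * u x ≤
            ε * cutoff η₀ S (legendre p v x) := by
          refine le_trans ?_ (cutoffDensity_absorb hKb0 hκ hε0 hS hS2 hS3 hD0 (hc x hx))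
          have h1 : n * u x + radialDeriv p u x ≤ Kb := by
            have := mul_le_mul_of_nonneg_left ((le_abs_self _).trans k1) (Nat.cast_nonneg (α := ℝ) n)
            linarith [(le_abs_self _).trans k2]
          have h2 := mul_le_mul_of_nonneg_left h1 hρ
          have h3 : 6 / S ^ 2 * max (1 - (legendre p v x - η₀) / S) 0 * radialHess p v x * κ ≤
              6 / S ^ 2 * max (1 - (legendre p v x - η₀) / S) 0 * radialHess p v x * u x :=
            mul_le_mul_of_nonneg_left (huκ x hx) (by positivity)
          linarith
        have hQ : cutoffDensity η₀ S (legendre p v x) * u x *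
            radialDeriv p (Δ.logBarrier C) x ≤
            ∑ k, logDensity (Δ.δ k p) (Cη + η₀) S (Δ.δ k x) * u x := by
          rw [radialDeriv_logBarrier hx, Finset.mul_sum]
          refine Finset.sum_le_sum fun k _ => ?_
          have h1 := cutoffDensity_mul_le (η₀ := η₀) hS hp hx k ((hη x hx).2 k)
          have h2 := mul_le_mul_of_nonneg_right h1 hu0
          have h3 := mul_nonneg hρ hu0
          linarith
        have hKx : cutoffDensity η₀ S (legendre p v x) * radialDeriv p u x ≤ 3 / S * K₁ :=
          (mul_le_mul_of_nonneg_left ((le_abs_self _).trans k2) hρ).trans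
            (mul_le_mul_of_nonneg_right (cutoffDensity_le hS (hη x hx).1) hK₁0)
        have := absorbed_integrand_le (a := A x)
          (rΛ := radialDeriv p (fun y => Real.log (hess v y).det) x)
          (cutoff_nonneg (η₀ := η₀) (S := S) (legendre p v x))
          (cutoff_le_one hS (hη x hx).1) (hφ1 x hx) (htr0 x hx) hκ hε0.le hε
          (sub_nonneg.2 (hC x hx)) (hΛ x hx) hbr hKx hQ
        simp only [Pi.add_apply]
        rw [e1, e2, sum_pderiv_divInvHess hv hsol hx]
        refine le_trans (le_of_eq ?_) this
        simp only [htr]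
        ring
    simp only [Pi.add_apply] at hmono
    have hI12 : IntegrableOn (fun x => (∑ i, pderiv i (fun y => cutoff η₀ S (legendre p v y) *
        (u y * divInvHess v i y - ∑ j, (hess v y)⁻¹ j i * pderiv j u y)) x) +
        (n * (cutoffDensity η₀ S (legendre p v x) *
          (u x * (Δ.logBarrier C x - Real.log (hess v x).det))) +
        radialDeriv p (fun x => cutoffDensity η₀ S (legendre p v x) *
          (u x * (Δ.logBarrier C x - Real.log (hess v x).det))) x)) Δ.int := hI1.add hI2
    rw [integral_add hGF hI12, integral_add hI1 hI2, hI1', hI2', add_zero, add_zero,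
      integral_add hci hR1, integral_add hqs hBi, integral_finsetSum _ fun k _ => hq k,
      setIntegral_const, smul_eq_mul, integral_const_mul] at hmono
    rw [mul_comm (3 / S * K₁)]
    exact hmono
  have hlimL := tendsto_setIntegral_cutoff (η₀ := η₀) hF hηs.continuousOn
    fun x hx => (hη x hx).1
  rw [integral_add (hφtr.const_mul _) hAu, integral_const_mul] at hlimL
  refine le_of_forall_pos_le_add fun e he => ?_
  -- The error is shared among the `m` facets; `m + 1` avoids a division by zero.
  set e' := e / (m + 1) with he'
  have he'0 : 0 < e' := by positivity
  have hlimR : Tendsto (fun S : ℝ => 3 / S * K₁ * (volume.real Δ.int) +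
      ((∑ k, (∫ x, u x ∂Δ.facetMeasure k + e')) + ε * ∫ x in Δ.int, |Δ.logBarrier C x|)) atTop
      (𝓝 (0 * K₁ * (volume.real Δ.int) +
      ((∑ k, (∫ x, u x ∂Δ.facetMeasure k + e')) + ε * ∫ x in Δ.int, |Δ.logBarrier C x|))) :=
    (((tendsto_const_nhds.div_atTop tendsto_id).mul_const _).mul_const _).add tendsto_const_nhds
  have := le_of_tendsto_of_tendsto hlimL hlimR (by
    filter_upwards [eventually_ge_atTop 1, eventually_ge_atTop (6 * Kb / ε),
      eventually_ge_atTop (2 * (c - η₀)),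
      eventually_integral_logDensity_le hp (Cη + η₀) hu.continuousOn
        (fun x hx => hκ.le.trans (huκ x hx)) he'0] with S h1 h2 h3 h4
    refine (step S h1 h2 h3).trans (add_le_add le_rfl (add_le_add ?_ le_rfl))
    exact Finset.sum_le_sum fun k _ => h4 k)
  refine this.trans ?_
  rw [Finset.sum_add_distrib, ← integral_σ_eq_sum _ (Δ.integrable_σ_of_continuousOn hu.continuousOn)]
  have : ∑ _k : Fin m, e' ≤ e := by
    rw [Finset.sum_const, Finset.card_univ, Fintype.card_fin, nsmul_eq_mul, he', mul_div_assoc',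
      div_le_iff₀ (by positivity)]
    nlinarith
  linarith

end Polytope
-- Convex functions and their Hessians
section Convex

theorem hasDerivAt_line {E : Type*} [NormedAddCommGroup E] [NormedSpace ℝ E] {f : E → ℝ}
    {x : E} (hf : DifferentiableAt ℝ f x) (h : E) :
    HasDerivAt (fun t : ℝ => f (x + t • h)) (fderiv ℝ f x h) 0 := by
  have h1 : HasDerivAt (fun t : ℝ => x + t • h) h 0 := by
    simpa using ((hasDerivAt_id (0 : ℝ)).smul_const h).const_add x
  have h2 : HasFDerivAt f (fderiv ℝ f x) (x + (0 : ℝ) • h) := by simpa using hf.hasFDerivAt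
  exact h2.comp_hasDerivAt 0 h1

theorem tendsto_line_slope {E : Type*} [NormedAddCommGroup E] [NormedSpace ℝ E] {f : E → ℝ}
    {x : E} (hf : DifferentiableAt ℝ f x) (h : E) :
    Tendsto (fun t : ℝ => t⁻¹ * (f (x + t • h) - f x)) (𝓝[>] 0) (𝓝 (fderiv ℝ f x h)) := by
  have := (hasDerivAt_line hf h).tendsto_slope_zero_right
  simpa using this

theorem ConvexOn.fderiv_sub_le {E : Type*} [NormedAddCommGroup E] [NormedSpace ℝ E] {f : E → ℝ}
    {s : Set E} (hf : ConvexOn ℝ s f) {x y : E} (hx : x ∈ s) (hy : y ∈ s)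
    (hd : DifferentiableAt ℝ f x) : fderiv ℝ f x (y - x) ≤ f y - f x := by
  refine le_of_tendsto (tendsto_line_slope hd (y - x)) ?_
  filter_upwards [Ioo_mem_nhdsGT (zero_lt_one' ℝ)] with t ht
  have h1 := hf.2 hx hy (sub_nonneg.2 ht.2.le) ht.1.le (by ring)
  rw [show (1 - t) • x + t • y = x + t • (y - x) by module, smul_eq_mul, smul_eq_mul] at h1
  rw [inv_mul_le_iff₀ ht.1]
  linarith

variable {n : ℕ} {s : Set (EuclideanSpace ℝ (Fin n))} {w q : EuclideanSpace ℝ (Fin n) → ℝ}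
  {x p : EuclideanSpace ℝ (Fin n)}

/-- The quadratic form in the direction `h` is the derivative along `h` of the slope `∇w·h`. The
tangent inequalities at `x` and at `x + t h`, added together, show that this slope does not
decrease. -/
theorem ConvexOn.posSemidef_hess (hf : ConvexOn ℝ s w) (hs : IsOpen s)
    (hw : ContDiffOn ℝ ∞ w s) (hx : x ∈ s) : (hess w x).PosSemidef := by
  have hd : ∀ {f : EuclideanSpace ℝ (Fin n) → ℝ}, ContDiffOn ℝ ∞ f s → ∀ x ∈ s,
      DifferentiableAt ℝ f x :=
    fun hf x hx => (hf.contDiffAt (hs.mem_nhds hx)).differentiableAt (by simp)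
  refine Matrix.PosSemidef.of_dotProduct_mulVec_nonneg ?_ fun h' => ?_
  · ext i j
    simpa using hess_comm hs hw hx j i
  · set h : EuclideanSpace ℝ (Fin n) := WithLp.toLp 2 h' with hh
    have hcd : ContDiffOn ℝ ∞ (fun y => ∑ j, h j * pderiv j w y) s :=
      ContDiffOn.sum fun j _ => contDiffOn_const.mul (ContDiffOn.pderiv_of_isOpen hs hw j)
    have hquad : star h' ⬝ᵥ (hess w x).mulVec h' =
        fderiv ℝ (fun y => ∑ j, h j * pderiv j w y) x h := by
      rw [fderiv_eq_sum_pderiv]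
      simp only [star_trivial, dotProduct, Matrix.mulVec]
      refine Finset.sum_congr rfl fun i _ => ?_
      rw [pderiv_sum fun j _ => (hd (ContDiffOn.pderiv_of_isOpen hs hw j) x hx).const_mul _]
      congr 1
      refine Finset.sum_congr rfl fun j _ => ?_
      rw [pderiv_mul (differentiableAt_const _) (hd (ContDiffOn.pderiv_of_isOpen hs hw j) x hx),
        pderiv_const, zero_mul, add_zero, mul_comm]
      rfl
    rw [hquad]
    refine ge_of_tendsto (tendsto_line_slope (hd hcd x hx) h) ?_
    have hcont : ContinuousAt (fun t : ℝ => x + t • h) 0 := by fun_prop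
    have hmem : ∀ᶠ t : ℝ in 𝓝[>] 0, x + t • h ∈ s :=
      (hcont.eventually_mem (by simpa using hs.mem_nhds hx)).filter_mono nhdsWithin_le_nhds
    filter_upwards [hmem, self_mem_nhdsWithin] with t ht ht0
    have ht0 : 0 < t := ht0
    have h1 := ConvexOn.fderiv_sub_le hf hx ht (hd hw x hx)
    have h2 := ConvexOn.fderiv_sub_le hf ht hx (hd hw _ ht)
    rw [show x + t • h - x = t • h by abel, map_smul, smul_eq_mul, fderiv_eq_sum_pderiv] at h1
    rw [show x - (x + t • h) = -(t • h) by abel, map_neg, map_smul, smul_eq_mul,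
      fderiv_eq_sum_pderiv] at h2
    have h3 : 0 ≤ t * ((∑ i, h i * pderiv i w (x + t • h)) - ∑ i, h i * pderiv i w x) := by
      linarith
    exact mul_nonneg (inv_nonneg.2 ht0.le) (nonneg_of_mul_nonneg_right h3 ht0)

/-- The tangent plane at `x`, evaluated at `p`, lies below the graph. -/
theorem ConvexOn.radialDeriv_ge (hf : ConvexOn ℝ s w) (hp : p ∈ s) (hx : x ∈ s)
    (hd : DifferentiableAt ℝ w x) : w x - w p ≤ radialDeriv p w x := by
  have := ConvexOn.fderiv_sub_le hf hx hp hd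
  rw [radialDeriv_eq_fderiv]
  rw [show p - x = -(x - p) by abel, map_neg] at this
  linarith

theorem hess_add (hs : IsOpen s) (hw : ContDiffOn ℝ ∞ w s) (hq : ContDiffOn ℝ ∞ q s)
    (hx : x ∈ s) : hess (fun y => w y + q y) x = hess w x + hess q x := by
  have hd : ∀ {f : EuclideanSpace ℝ (Fin n) → ℝ}, ContDiffOn ℝ ∞ f s → ∀ x ∈ s,
      DifferentiableAt ℝ f x :=
    fun hf x hx => (hf.contDiffAt (hs.mem_nhds hx)).differentiableAt (by simp)
  ext i j
  simp only [hess, Matrix.of_apply, Matrix.add_apply]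
  rw [← pderiv_add (hd (ContDiffOn.pderiv_of_isOpen hs hw j) x hx)
    (hd (ContDiffOn.pderiv_of_isOpen hs hq j) x hx)]
  refine pderiv_congr ?_
  filter_upwards [hs.mem_nhds hx] with y hy
  exact pderiv_add (hd hw y hy) (hd hq y hy)

/-- A strictly convex quadratic polynomial centred at `p`, bounded below by `κ`. -/
def quadratic (p : EuclideanSpace ℝ (Fin n)) (κ : ℝ) (x : EuclideanSpace ℝ (Fin n)) : ℝ :=
  κ * (1 + ∑ i, (x i - p i) * (x i - p i))

theorem contDiff_quadratic (κ : ℝ) : ContDiff ℝ ∞ (quadratic p κ) :=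
  contDiff_const.mul (contDiff_const.add
    (ContDiff.sum fun i _ => (contDiff_coord i).mul (contDiff_coord i)))

theorem pderiv_quadratic (κ : ℝ) (j : Fin n) (x : EuclideanSpace ℝ (Fin n)) :
    pderiv j (quadratic p κ) x = 2 * κ * (x j - p j) := by
  have hd : ∀ i, DifferentiableAt ℝ
      (fun x : EuclideanSpace ℝ (Fin n) => (x i - p i) * (x i - p i)) x :=
    fun i => (differentiableAt_coord i).mul (differentiableAt_coord i)
  unfold quadratic
  rw [pderiv_mul (differentiableAt_const _)
    ((differentiableAt_const _).fun_add (DifferentiableAt.fun_sum fun i _ => hd i)), pderiv_const,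
    pderiv_add (differentiableAt_const _) (DifferentiableAt.fun_sum fun i _ => hd i),
    pderiv_const, pderiv_sum fun i _ => hd i]
  simp only [pderiv_mul (differentiableAt_coord _) (differentiableAt_coord _), pderiv_coord_sub]
  simp only [mul_ite, mul_one, mul_zero, ite_mul, one_mul, zero_mul, Finset.sum_add_distrib,
    Finset.sum_ite_eq, Finset.mem_univ, if_true]
  ring

theorem hess_quadratic (κ : ℝ) (x : EuclideanSpace ℝ (Fin n)) :
    hess (quadratic p κ) x = (2 * κ) • (1 : Matrix (Fin n) (Fin n) ℝ) := by
  ext i j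
  have : pderiv j (quadratic p κ) = fun x => 2 * κ * (x j - p j) :=
    funext fun x => pderiv_quadratic κ j x
  simp only [hess, Matrix.of_apply, this]
  rw [pderiv_mul (differentiableAt_const _) (differentiableAt_coord _), pderiv_const,
    pderiv_coord_sub]
  simp [Matrix.one_apply]

end Convex

/-! ### The basic inequality for functions smooth up to the boundary -/

namespace Polytope

variable {n m : ℕ} {Δ : Polytope n m} {v A w φ : EuclideanSpace ℝ (Fin n) → ℝ}
  {p : EuclideanSpace ℝ (Fin n)}

theorem le_of_forall_mul_add_le {a b s L κ : ℝ} (hκ : 0 < κ)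
    (h : ∀ ε, 0 < ε → ε ≤ κ → (1 - ε / κ) * a + b ≤ s + ε * L) : a + b ≤ s := by
  have h1 : Tendsto (fun ε : ℝ => (1 - ε / κ) * a + b) (𝓝[>] 0) (𝓝 ((1 - 0 / κ) * a + b)) :=
    Tendsto.mono_left (Continuous.tendsto (by fun_prop) 0) nhdsWithin_le_nhds
  have h2 : Tendsto (fun ε : ℝ => s + ε * L) (𝓝[>] 0) (𝓝 (s + 0 * L)) :=
    Tendsto.mono_left (Continuous.tendsto (by fun_prop) 0) nhdsWithin_le_nhds
  have := le_of_tendsto_of_tendsto h1 h2 (by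
    filter_upwards [Ioc_mem_nhdsGT hκ] with ε hε using h ε hε.1 hε.2)
  simpa using this

/-- The basic inequality for convex functions which are smooth up to the boundary: the functional
`ℒ_A` dominates the integral of `u^{ij} w_ij` over compact subsets of the polytope. -/
theorem MemS.setIntegral_trace_le_L (hv : Δ.MemS v) (hsol : Δ.SolvesAbreu A v)
    (hA : ContinuousOn A Δ.closed) (hp : p ∈ Δ.int) (hw : ContDiffOn ℝ ∞ w Δ.closed)
    (hwc : ConvexOn ℝ Δ.int w) (hw0 : ∀ x ∈ Δ.int, 0 ≤ w x)
    {K : Set (EuclideanSpace ℝ (Fin n))} (hK : IsCompact K) (hKs : K ⊆ Δ.int)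
    (hφ : ContinuousOn φ Δ.int) (hφ0 : ∀ x ∈ Δ.int, 0 ≤ φ x) (hφ1 : ∀ x ∈ Δ.int, φ x ≤ 1)
    (hφK : ∀ x ∈ Δ.int, x ∉ K → φ x = 0) :
    (∫ x in Δ.int, φ x * ((hess v x)⁻¹ * hess w x).trace) ≤ Δ.L A w := by
  obtain ⟨C, hC⟩ := hv.exists_log_det_le
  have hs := Δ.isOpen_int
  have hvs := hv.contDiffOn_int
  have hpd : ∀ x ∈ Δ.int, (hess v x).PosDef := fun x hx => (hsol x hx).1
  have hwi := hw.mono Δ.int_subset_closed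
  have htri : ∀ {f : EuclideanSpace ℝ (Fin n) → ℝ}, ContDiffOn ℝ ∞ f Δ.int →
      IntegrableOn (fun x => φ x * ((hess v x)⁻¹ * hess f x).trace) Δ.int := fun {f} hf => by
    refine integrableOn_of_continuousOn_of_eqOn_zero hK hKs hs (hφ.mul ?_)
      fun x hx hxK => by simp [hφK x hx hxK]
    have : ContDiffOn ℝ ∞ (fun x => ((hess v x)⁻¹ * hess f x).trace) Δ.int := by
      simp only [Matrix.trace, Matrix.diag_apply, Matrix.mul_apply]
      exact ContDiffOn.sum fun i _ => ContDiffOn.sum fun j _ =>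
        (contDiffOn_hess_inv hs hvs hpd i j).mul (contDiffOn_hess hs hf j i)
    exact this.continuousOn
  have hq : ContinuousOn (quadratic p 1) Δ.closed := (contDiff_quadratic 1).continuous.continuousOn
  have hscale : ∀ κ x, quadratic p κ x = κ * quadratic p 1 x := fun κ x => by
    simp [quadratic]
  -- Adding `κ (1 + |x - p|²)` supplies the lower bounds on the function and on its Hessian that the
  -- absorption needs; it changes `ℒ_A` by a multiple of `κ`.
  have key : ∀ κ : ℝ, 0 < κ → (∫ x in Δ.int, φ x * ((hess v x)⁻¹ * hess w x).trace) ≤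
      Δ.L A w + κ * Δ.L A (quadratic p 1) := fun κ hκ => by
    have hqs : ContDiff ℝ ∞ (quadratic p κ) := contDiff_quadratic κ
    have hu : ContDiffOn ℝ ∞ (fun x => w x + quadratic p κ x) Δ.closed := hw.add hqs.contDiffOn
    have hhess : ∀ x ∈ Δ.int, hess (fun x => w x + quadratic p κ x) x =
        hess w x + (2 * κ) • (1 : Matrix (Fin n) (Fin n) ℝ) := fun x hx => by
      rw [hess_add hs hwi hqs.contDiffOn hx, hess_quadratic]
    have h1 := le_of_forall_mul_add_le hκ fun ε hε0 hε =>
      hv.setIntegral_trace_absorbed_le hsol hA hp hu hκ (fun x hx => ?_) (fun x hx => ?_) hK hKs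
        hφ hφ1 hφK (fun x hx => hC x hx (hpd x hx)) hε0 hε
    · have h2 : (∫ x in Δ.int, φ x * ((hess v x)⁻¹ * hess w x).trace) ≤
          ∫ x in Δ.int, φ x *
            ((hess v x)⁻¹ * hess (fun x => w x + quadratic p κ x) x).trace := by
        refine setIntegral_mono_on (htri hwi) (htri (hu.mono Δ.int_subset_closed))
          hs.measurableSet fun x hx => mul_le_mul_of_nonneg_left ?_ (hφ0 x hx)
        rw [hhess x hx, Matrix.mul_add, Matrix.trace_add, Matrix.mul_smul, Matrix.mul_one,
          Matrix.trace_smul, smul_eq_mul]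
        have := (hpd x hx).inv.posSemidef.trace_nonneg
        have : 0 ≤ 2 * κ * (hess v x)⁻¹.trace := by positivity
        linarith
      have e1 : ∫ x, (w x + quadratic p κ x) ∂Δ.σ =
          (∫ x, w x ∂Δ.σ) + κ * ∫ x, quadratic p 1 x ∂Δ.σ := by
        simp only [hscale κ]
        rw [integral_add (Δ.integrable_σ_of_continuousOn hw.continuousOn)
          ((Δ.integrable_σ_of_continuousOn hq).const_mul _), integral_const_mul]
      have e2 : ∫ x in Δ.int, A x * (w x + quadratic p κ x) =
          (∫ x in Δ.int, A x * w x) + κ * ∫ x in Δ.int, A x * quadratic p 1 x := by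
        have i1 : IntegrableOn (fun x => A x * w x) Δ.int :=
          integrableOn_int (hA.mul hw.continuousOn)
        have i2 : IntegrableOn (fun x => A x * quadratic p 1 x) Δ.int :=
          integrableOn_int (hA.mul hq)
        rw [← integral_const_mul, ← integral_add i1 (i2.const_mul _)]
        refine integral_congr_ae (Eventually.of_forall fun x => ?_)
        simp only [hscale κ x]
        ring
      rw [e1, e2] at h1
      unfold L
      linarith
    · have h3 : 0 ≤ ∑ i, (x i - p i) * (x i - p i) :=
        Finset.sum_nonneg fun i _ => mul_self_nonneg _
      have h4 := hw0 x hx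
      simp only [quadratic]
      nlinarith
    · rw [hhess x hx, add_sub_assoc, ← sub_smul]
      refine (ConvexOn.posSemidef_hess hwc hs hwi hx).add (Matrix.PosSemidef.one.smul ?_)
      linarith
  have h1 : Tendsto (fun κ : ℝ => Δ.L A w + κ * Δ.L A (quadratic p 1)) (𝓝[>] 0)
      (𝓝 (Δ.L A w + 0 * Δ.L A (quadratic p 1))) :=
    Tendsto.mono_left (Continuous.tendsto (by fun_prop) 0) nhdsWithin_le_nhds
  have := ge_of_tendsto h1 (by filter_upwards [self_mem_nhdsWithin] with κ hκ using key κ hκ)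
  simpa using this

end Polytope
-- Dilations and passage to the class `𝒞_*`
/-- The dilation with centre `p` and ratio `t`. -/
def dilate {n : ℕ} (p : EuclideanSpace ℝ (Fin n)) (t : ℝ) (x : EuclideanSpace ℝ (Fin n)) :
    EuclideanSpace ℝ (Fin n) :=
  p + t • (x - p)

theorem contDiff_dilate {n : ℕ} (p : EuclideanSpace ℝ (Fin n)) (t : ℝ) :
    ContDiff ℝ ∞ (dilate p t) := by
  unfold dilate; fun_prop

theorem continuous_dilate {n : ℕ} (p : EuclideanSpace ℝ (Fin n)) (t : ℝ) :
    Continuous (dilate p t) := (contDiff_dilate p t).continuous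

theorem dilate_self {n : ℕ} (p : EuclideanSpace ℝ (Fin n)) (t : ℝ) : dilate p t p = p := by
  simp [dilate]

/-- Fatou's lemma for the norms. -/
theorem integrable_of_tendsto_of_liminf {X : Type*} [MeasurableSpace X] {μ : Measure X}
    {G : ℕ → X → ℝ} {f : X → ℝ} (hGf : ∀ᵐ x ∂μ, Tendsto (fun j => G j x) atTop (𝓝 (f x)))
    (hG : ∀ j, AEStronglyMeasurable (G j) μ)
    (hG' : liminf (fun j => ∫⁻ x, ‖G j x‖ₑ ∂μ) atTop ≠ ⊤) : Integrable f μ := by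
  refine ⟨aestronglyMeasurable_of_tendsto_ae _ hG hGf, lt_of_le_of_lt ?_ hG'.lt_top⟩
  calc ∫⁻ x, ‖f x‖ₑ ∂μ = ∫⁻ x, liminf (fun j => ‖G j x‖ₑ) atTop ∂μ :=
        lintegral_congr_ae (by filter_upwards [hGf] with x hx using hx.enorm.liminf_eq.symm)
    _ ≤ liminf (fun j => ∫⁻ x, ‖G j x‖ₑ ∂μ) atTop :=
        lintegral_liminf_le' fun j => (hG j).enorm

namespace Polytope

variable {n m : ℕ} {Δ : Polytope n m} {A u : EuclideanSpace ℝ (Fin n) → ℝ}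
  {p x : EuclideanSpace ℝ (Fin n)} {t : ℝ}

theorem dilate_mem_int (hp : p ∈ Δ.int) (ht0 : 0 ≤ t) (ht1 : t < 1) (hx : x ∈ Δ.closed) :
    dilate p t x ∈ Δ.int :=
  Δ.lineMap_mem_int hp (Δ.mem_closed_iff.1 hx) ht0 ht1

namespace MemCTilde

/-- For `t < 1` the dilation maps the closed polytope into the open one, so interior smoothness
becomes smoothness up to the boundary. -/
theorem contDiffOn_dilate (hu : Δ.MemCTilde p u) (hp : p ∈ Δ.int) (ht0 : 0 ≤ t) (ht1 : t < 1) :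
    ContDiffOn ℝ ∞ (fun x => u (dilate p t x)) Δ.closed :=
  hu.memCInfty.smooth.comp (contDiff_dilate p t).contDiffOn
    fun _ hx => dilate_mem_int hp ht0 ht1 hx

theorem convexOn_dilate (hu : Δ.MemCTilde p u) (hp : p ∈ Δ.int) (ht0 : 0 ≤ t) (ht1 : t < 1) :
    ConvexOn ℝ Δ.int (fun x => u (dilate p t x)) := by
  refine ⟨Δ.convex_int, fun x hx y hy a b ha hb hab => ?_⟩
  have hmem := fun {x} (hx : x ∈ Δ.int) => Δ.int_subset_closed
    (dilate_mem_int hp ht0 ht1 (Δ.int_subset_closed hx))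
  have := hu.memCInfty.convexOn.2 (hmem hx) (hmem hy) ha hb hab
  have e : dilate p t (a • x + b • y) = a • dilate p t x + b • dilate p t y := by
    unfold dilate
    rw [show a = 1 - b by linarith]
    module
  simp only [e]
  exact this

theorem dilate_nonneg (hu : Δ.MemCTilde p u) (hp : p ∈ Δ.int) (ht0 : 0 ≤ t) (ht1 : t < 1)
    (hx : x ∈ Δ.closed) : 0 ≤ u (dilate p t x) :=
  hu.nonneg _ (Δ.int_subset_closed (dilate_mem_int hp ht0 ht1 hx))

end MemCTilde

section UniformLimit

variable {F : ℕ → EuclideanSpace ℝ (Fin n) → ℝ} {f g : EuclideanSpace ℝ (Fin n) → ℝ}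
  {ν : Measure (EuclideanSpace ℝ (Fin n))}

theorem aestronglyMeasurable_of_continuousOn (hν : ∀ᵐ x ∂ν, x ∈ Δ.closed)
    (hf : ContinuousOn f Δ.closed) : AEStronglyMeasurable f ν := by
  have := hf.aestronglyMeasurable (μ := ν) Δ.isCompact_closed.isClosed.measurableSet
  rwa [Measure.restrict_eq_self_of_ae_mem hν] at this

instance : IsFiniteMeasure (volume.restrict Δ.int) :=
  ⟨by rw [Measure.restrict_apply_univ]; exact Δ.isBounded_int.measure_lt_top⟩

theorem ae_int_mem_closed : ∀ᵐ x ∂(volume.restrict Δ.int), x ∈ Δ.closed := by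
  filter_upwards [ae_restrict_mem Δ.isOpen_int.measurableSet] with x hx
    using Δ.int_subset_closed hx

theorem tendsto_integral_mul_of_tendstoUniformlyOn [IsFiniteMeasure ν]
    (hν : ∀ᵐ x ∂ν, x ∈ Δ.closed) (hg : ContinuousOn g Δ.closed)
    (hF : ∀ j, ContinuousOn (F j) Δ.closed) (hf : ContinuousOn f Δ.closed)
    (h : TendstoUniformlyOn F f atTop Δ.closed) :
    Tendsto (fun j => ∫ x, g x * F j x ∂ν) atTop (𝓝 (∫ x, g x * f x ∂ν)) := by
  obtain ⟨B, hB⟩ := Δ.isCompact_closed.exists_bound_of_continuousOn hg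
  obtain ⟨D, hD⟩ := Δ.isCompact_closed.exists_bound_of_continuousOn hf
  refine tendsto_integral_filter_of_dominated_convergence (fun _ => |B| * (|D| + 1))
    (Eventually.of_forall fun j => aestronglyMeasurable_of_continuousOn hν (hg.mul (hF j)))
    ?_ (integrable_const _) ?_
  · filter_upwards [Metric.tendstoUniformlyOn_iff.1 h 1 one_pos] with j hj
    filter_upwards [hν] with x hx
    have h1 := hj x hx
    rw [Real.dist_eq] at h1
    have h2 := hB x hx
    have h3 := hD x hx
    rw [Real.norm_eq_abs] at *
    rw [abs_mul]
    refine mul_le_mul (h2.trans (le_abs_self B)) ?_ (abs_nonneg _) (abs_nonneg _)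
    have h4 := abs_sub_abs_le_abs_sub (F j x) (f x)
    rw [abs_sub_comm] at h4
    linarith [le_abs_self D]
  · filter_upwards [hν] with x hx
    exact (h.tendsto_at hx).const_mul _

theorem tendsto_L_of_tendstoUniformlyOn (hA : ContinuousOn A Δ.closed)
    (hF : ∀ j, ContinuousOn (F j) Δ.closed) (hf : ContinuousOn f Δ.closed)
    (h : TendstoUniformlyOn F f atTop Δ.closed) :
    Tendsto (fun j => Δ.L A (F j)) atTop (𝓝 (Δ.L A f)) := by
  have h1 := tendsto_integral_mul_of_tendstoUniformlyOn (ν := Δ.σ) Δ.ae_σ_mem_closed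
    (g := fun _ => 1) continuousOn_const hF hf h
  simp only [one_mul] at h1
  exact h1.sub (tendsto_integral_mul_of_tendstoUniformlyOn ae_int_mem_closed hA hF hf h)

end UniformLimit

theorem neBot_nhdsWithin_int (hx : x ∈ Δ.star) : (𝓝[Δ.int] x).NeBot :=
  mem_closure_iff_nhdsWithin_neBot.1 (Δ.star_subset_closed hx)

namespace MemCStar

theorem continuousOn (hu : Δ.MemCStar p u) : ContinuousOn u Δ.int := by
  obtain ⟨C, -, U, hU, -, hlim⟩ := hu.approx
  exact hlim.continuousOn (Frequently.of_forall fun j => (hU j).memCInfty.smooth.continuousOn)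

theorem convexOn (hu : Δ.MemCStar p u) : ConvexOn ℝ Δ.int u := by
  obtain ⟨C, -, U, hU, -, hlim⟩ := hu.approx
  refine ⟨Δ.convex_int, fun x hx y hy a b ha hb hab => ?_⟩
  refine le_of_tendsto_of_tendsto (hlim.tendsto_at (Δ.convex_int hx hy ha hb hab))
    (((hlim.tendsto_at hx).const_mul a).add ((hlim.tendsto_at hy).const_mul b))
    (Eventually.of_forall fun j => ?_)
  exact (hU j).memCInfty.convexOn.2 (Δ.int_subset_closed hx) (Δ.int_subset_closed hy) ha hb hab

theorem base (hu : Δ.MemCStar p u) (hp : p ∈ Δ.int) : u p = 0 := by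
  obtain ⟨C, -, U, hU, -, hlim⟩ := hu.approx
  refine tendsto_nhds_unique (hlim.tendsto_at hp) ?_
  simp only [fun j => (hU j).base, tendsto_const_nhds]

theorem nonneg (hu : Δ.MemCStar p u) (hx : x ∈ Δ.int) : 0 ≤ u x := by
  obtain ⟨C, -, U, hU, -, hlim⟩ := hu.approx
  exact ge_of_tendsto' (hlim.tendsto_at hx) fun j => (hU j).nonneg x (Δ.int_subset_closed hx)

theorem tendsto_nhdsWithin (hu : Δ.MemCStar p u) (hx : x ∈ Δ.star) :
    Tendsto u (𝓝[Δ.int] x) (𝓝 (u x)) := by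
  rcases hx with hx | hx
  · exact hu.continuousOn x hx
  · obtain ⟨k, hk⟩ := mem_iUnion.1 hx
    exact hu.boundary k x hk

theorem continuousOn_dilate (hu : Δ.MemCStar p u) (hp : p ∈ Δ.int) (ht0 : 0 ≤ t) (ht1 : t < 1) :
    ContinuousOn (fun x => u (dilate p t x)) Δ.closed :=
  hu.continuousOn.comp (continuous_dilate p t).continuousOn
    fun _ hx => dilate_mem_int hp ht0 ht1 hx

/-- Convexity along the segment from `p`, where `u = 0`, together with `u ≥ 0`; facet points follow
by taking limits. This makes `u` itself the dominating function for its dilations. -/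
theorem dilate_le (hu : Δ.MemCStar p u) (hp : p ∈ Δ.int) (ht0 : 0 ≤ t) (ht1 : t < 1)
    (hx : x ∈ Δ.star) : u (dilate p t x) ≤ u x := by
  have key : ∀ y ∈ Δ.int, u (dilate p t y) ≤ u y := fun y hy => by
    have h1 := hu.convexOn.2 hp hy (sub_nonneg.2 ht1.le) ht0 (by ring)
    rw [show (1 - t) • p + t • y = dilate p t y by unfold dilate; module, hu.base hp, smul_zero,
      zero_add, smul_eq_mul] at h1
    exact h1.trans (mul_le_of_le_one_left (hu.nonneg hy) ht1.le)
  have := neBot_nhdsWithin_int hx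
  have h1 : Tendsto (fun y => u (dilate p t y)) (𝓝[Δ.int] x) (𝓝 (u (dilate p t x))) :=
    (hu.continuousOn_dilate hp ht0 ht1 x (Δ.star_subset_closed hx)).mono_left
      (nhdsWithin_mono _ Δ.int_subset_closed)
  exact le_of_tendsto_of_tendsto h1 (hu.tendsto_nhdsWithin hx)
    (by filter_upwards [self_mem_nhdsWithin] with y hy using key y hy)

theorem tendsto_dilate (hu : Δ.MemCStar p u) (hp : p ∈ Δ.int) (hx : x ∈ Δ.star) :
    Tendsto (fun t => u (dilate p t x)) (𝓝[<] 1) (𝓝 (u x)) := by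
  refine (hu.tendsto_nhdsWithin hx).comp (tendsto_nhdsWithin_iff.2 ⟨?_, ?_⟩)
  · have h : Continuous fun t : ℝ => dilate p t x := by unfold dilate; fun_prop
    have h1 : dilate p 1 x = x := by simp [dilate]
    have h2 := h.tendsto 1
    rw [h1] at h2
    exact h2.mono_left nhdsWithin_le_nhds
  · filter_upwards [Ioo_mem_nhdsLT (zero_lt_one' ℝ)] with t ht
      using dilate_mem_int hp ht.1.le ht.2 (Δ.star_subset_closed hx)

theorem tendsto_integral_dilate {ν : Measure (EuclideanSpace ℝ (Fin n))}
    {g : EuclideanSpace ℝ (Fin n) → ℝ} (hu : Δ.MemCStar p u) (hp : p ∈ Δ.int)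
    (hν : ∀ᵐ x ∂ν, x ∈ Δ.star) (hg : ContinuousOn g Δ.closed) (hint : Integrable u ν) :
    Tendsto (fun t => ∫ x, g x * u (dilate p t x) ∂ν) (𝓝[<] 1) (𝓝 (∫ x, g x * u x ∂ν)) := by
  obtain ⟨B, hB⟩ := Δ.isCompact_closed.exists_bound_of_continuousOn hg
  have hνc : ∀ᵐ x ∂ν, x ∈ Δ.closed := by
    filter_upwards [hν] with x hx using Δ.star_subset_closed hx
  have hI : ∀ᶠ t : ℝ in 𝓝[<] 1, t ∈ Ioo (0 : ℝ) 1 := Ioo_mem_nhdsLT zero_lt_one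
  refine tendsto_integral_filter_of_dominated_convergence (fun x => |B| * u x) ?_ ?_
    (hint.const_mul _) ?_
  · filter_upwards [hI] with t ht
    exact aestronglyMeasurable_of_continuousOn hνc
      (hg.mul (hu.continuousOn_dilate hp ht.1.le ht.2))
  · filter_upwards [hI] with t ht
    filter_upwards [hν] with x hx
    have hxc := Δ.star_subset_closed hx
    rw [norm_mul, Real.norm_of_nonneg (hu.nonneg (dilate_mem_int hp ht.1.le ht.2 hxc))]
    exact mul_le_mul ((hB x hxc).trans (le_abs_self B)) (hu.dilate_le hp ht.1.le ht.2 hx)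
      (hu.nonneg (dilate_mem_int hp ht.1.le ht.2 hxc)) (abs_nonneg _)
  · filter_upwards [hν] with x hx using (hu.tendsto_dilate hp hx).const_mul _

/-- The dilated closed polytope is a compact subset of the open one, where locally uniform
convergence is uniform. -/
theorem exists_approx_dilate (hu : Δ.MemCStar p u) (hp : p ∈ Δ.int) (ht0 : 0 ≤ t) (ht1 : t < 1) :
    ∃ W : ℕ → EuclideanSpace ℝ (Fin n) → ℝ,
      (∀ j, ContDiffOn ℝ ∞ (W j) Δ.closed ∧ ConvexOn ℝ Δ.int (W j) ∧
        (∀ x ∈ Δ.closed, 0 ≤ W j x) ∧ W j p = 0) ∧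
      TendstoUniformlyOn W (fun x => u (dilate p t x)) atTop Δ.closed := by
  obtain ⟨C, -, U, hU, -, hlim⟩ := hu.approx
  refine ⟨fun j x => U j (dilate p t x), fun j => ⟨(hU j).contDiffOn_dilate hp ht0 ht1,
    (hU j).convexOn_dilate hp ht0 ht1, fun x hx => (hU j).dilate_nonneg hp ht0 ht1 hx, ?_⟩, ?_⟩
  · simp only [dilate_self, (hU j).base]
  · have h1 := (tendstoLocallyUniformlyOn_iff_forall_isCompact Δ.isOpen_int).1 hlim
      (dilate p t '' Δ.closed) (image_subset_iff.2 fun x hx => dilate_mem_int hp ht0 ht1 hx)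
      (Δ.isCompact_closed.image (continuous_dilate p t))
    exact (h1.comp (dilate p t)).mono (subset_preimage_image _ _)

end MemCStar

theorem ae_int_mem_star : ∀ᵐ x ∂(volume.restrict Δ.int), x ∈ Δ.star := by
  filter_upwards [ae_restrict_mem Δ.isOpen_int.measurableSet] with x hx using Or.inl hx

theorem ae_σ_mem_star : ∀ᵐ x ∂Δ.σ, x ∈ Δ.star := by
  filter_upwards [Δ.ae_σ_mem] with x ⟨k, hx⟩ using Or.inr (mem_iUnion.2 ⟨k, hx⟩)

/-- Elements of `𝒞_*` with integrable boundary values are integrable on the polytope. -/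
theorem MemS.integrableOn_of_memCStar {v : EuclideanSpace ℝ (Fin n) → ℝ} (hv : Δ.MemS v)
    (hp : p ∈ Δ.int) (hu : Δ.MemCStar p u) (hint : Integrable u Δ.σ) : IntegrableOn u Δ.int := by
  -- The trace inequality is divided by `n`; in dimension 0 the space is a point.
  rcases Nat.eq_zero_or_pos n with rfl | hn
  · have : u = fun _ => u p := funext fun x => by rw [Subsingleton.elim x p]
    rw [this]
    exact integrableOn_int continuousOn_const
  have hs := Δ.isOpen_int
  set T := ∑ k, Δ.δ k p with hT
  have hT0 : 0 ≤ T := Finset.sum_nonneg fun k _ => (hp k).le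
  -- The trace inequality holds for the smooth approximants, which are radially nondecreasing, and
  -- passes to the dilation of `u`, whose boundary integral is at most that of `u`.
  have h1 : ∀ t : ℝ, 0 ≤ t → t < 1 →
      n * ∫ x in Δ.int, u (dilate p t x) ≤ T * ∫ x, u x ∂Δ.σ := fun t ht0 ht1 => by
    obtain ⟨W, hW, hWlim⟩ := hu.exists_approx_dilate hp ht0 ht1
    have hWc := fun j => (hW j).1.continuousOn
    have huc := hu.continuousOn_dilate hp ht0 ht1
    have hstep : ∀ j, n * ∫ x in Δ.int, W j x ≤ T * ∫ x, W j x ∂Δ.σ := fun j => by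
      obtain ⟨w1, w2, w3, w4⟩ := hW j
      refine (hv.integral_le_sum_facet hp w1 (fun x hx => w3 x (Δ.int_subset_closed hx))
        fun x hx => ?_).trans ?_
      · have hd : DifferentiableAt ℝ (W j) x :=
          ((w1.mono Δ.int_subset_closed).contDiffAt (hs.mem_nhds hx)).differentiableAt (by simp)
        have := ConvexOn.radialDeriv_ge w2 hp hx hd
        rw [w4, sub_zero] at this
        exact (w3 x (Δ.int_subset_closed hx)).trans this
      · rw [integral_σ_eq_sum _ (Δ.integrable_σ_of_continuousOn (hWc j)), Finset.mul_sum]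
        refine Finset.sum_le_sum fun k _ => mul_le_mul_of_nonneg_right ?_ ?_
        · exact Finset.single_le_sum (f := fun k => Δ.δ k p) (fun k _ => (hp k).le)
            (Finset.mem_univ k)
        · refine integral_nonneg_of_ae ?_
          filter_upwards [Δ.ae_facetMeasure_mem k] with x hx
            using w3 x (Δ.openFacet_subset_closed k hx)
    have l1 := tendsto_integral_mul_of_tendstoUniformlyOn (ν := volume.restrict Δ.int)
      ae_int_mem_closed (g := fun _ => 1) continuousOn_const hWc huc hWlim
    have l2 := tendsto_integral_mul_of_tendstoUniformlyOn (ν := Δ.σ)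
      Δ.ae_σ_mem_closed (g := fun _ => 1) continuousOn_const hWc huc hWlim
    simp only [one_mul] at l1 l2
    refine (le_of_tendsto_of_tendsto' (l1.const_mul _) (l2.const_mul _) hstep).trans ?_
    refine mul_le_mul_of_nonneg_left ?_ hT0
    refine integral_mono_ae (Δ.integrable_σ_of_continuousOn huc) hint ?_
    filter_upwards [ae_σ_mem_star] with x hx using hu.dilate_le hp ht0 ht1 hx
  -- Fatou requires a sequence; the shift by 2 keeps every ratio in `[1/2, 1)`.
  set t : ℕ → ℝ := fun j => 1 - 1 / ((j : ℝ) + 2) with ht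
  have ht0 : ∀ j, 0 ≤ t j := fun j => by
    have : 1 / ((j : ℝ) + 2) ≤ 1 := by
      rw [div_le_one (by positivity)]; linarith [Nat.cast_nonneg (α := ℝ) j]
    simp only [ht]; linarith
  have ht1 : ∀ j, t j < 1 := fun j => by
    have : 0 < 1 / ((j : ℝ) + 2) := by positivity
    simp only [ht]; linarith
  have htlim : Tendsto t atTop (𝓝[<] 1) := by
    refine tendsto_nhdsWithin_iff.2 ⟨?_, Eventually.of_forall ht1⟩
    have h2 : Tendsto (fun j : ℕ => (j : ℝ) + 2) atTop atTop :=
      tendsto_natCast_atTop_atTop.atTop_add tendsto_const_nhds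
    have h3 := (tendsto_const_nhds (x := (1 : ℝ))).sub
      ((tendsto_const_nhds (x := (1 : ℝ))).div_atTop h2)
    simpa [ht] using h3
  change Integrable u (volume.restrict Δ.int)
  refine integrable_of_tendsto_of_liminf
    (G := fun (j : ℕ) (x : EuclideanSpace ℝ (Fin n)) => u (dilate p (t j) x)) ?_ (fun j => ?_) ?_
  · filter_upwards [ae_int_mem_star] with x hx using (hu.tendsto_dilate hp hx).comp htlim
  · exact aestronglyMeasurable_of_continuousOn ae_int_mem_closed
      (hu.continuousOn_dilate hp (ht0 j) (ht1 j))
  · refine ne_top_of_le_ne_top (ENNReal.ofReal_ne_top (r := (T * ∫ x, u x ∂Δ.σ) / n)) ?_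
    refine liminf_le_of_le (by isBoundedDefault) fun b hb => ?_
    obtain ⟨j, hj⟩ := hb.exists
    refine hj.trans ?_
    have hc := hu.continuousOn_dilate hp (ht0 j) (ht1 j)
    have hnn : 0 ≤ᵐ[volume.restrict Δ.int] fun x => u (dilate p (t j) x) := by
      filter_upwards [ae_int_mem_closed] with x hx
        using hu.nonneg (dilate_mem_int hp (ht0 j) (ht1 j) hx)
    have e : ∫⁻ x in Δ.int, ‖u (dilate p (t j) x)‖ₑ =
        ENNReal.ofReal (∫ x in Δ.int, u (dilate p (t j) x)) := by
      rw [ofReal_integral_eq_lintegral_ofReal (integrableOn_int hc) hnn]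
      refine lintegral_congr_ae ?_
      filter_upwards [hnn] with x hx
      exact Real.enorm_of_nonneg hx
    rw [e]
    refine ENNReal.ofReal_le_ofReal ?_
    rw [le_div_iff₀ (by positivity), mul_comm]
    exact h1 _ (ht0 j) (ht1 j)

end Polytope
-- A quadratic bump on a ball
section Bump

variable {n : ℕ} {z x : EuclideanSpace ℝ (Fin n)} {r : ℝ}

/-- The positive part of `r² - |x - z|²`. -/
def bump (z : EuclideanSpace ℝ (Fin n)) (r : ℝ) (x : EuclideanSpace ℝ (Fin n)) : ℝ :=
  max (r ^ 2 + 1 - quadratic z 1 x) 0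

theorem quadratic_one_eq : quadratic z 1 x = 1 + ‖x - z‖ ^ 2 := by
  rw [EuclideanSpace.real_norm_sq_eq]
  simp [quadratic, sq]

theorem bump_eq : bump z r x = max (r ^ 2 - ‖x - z‖ ^ 2) 0 := by
  rw [bump, quadratic_one_eq]; congr 1; ring

theorem continuous_bump : Continuous (bump z r) :=
  (continuous_const.sub (contDiff_quadratic 1).continuous).max continuous_const

theorem bump_nonneg : 0 ≤ bump z r x := le_max_right _ _

theorem bump_le : bump z r x ≤ r ^ 2 := by
  rw [bump_eq]
  exact max_le (by linarith [sq_nonneg ‖x - z‖]) (sq_nonneg r)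

theorem bump_eq_zero (hr : 0 < r) (hx : x ∉ Metric.closedBall z r) : bump z r x = 0 := by
  rw [Metric.mem_closedBall, dist_eq_norm, not_le] at hx
  rw [bump_eq]
  exact max_eq_right (by nlinarith)

theorem bump_pos (hx : x ∈ Metric.ball z r) : 0 < bump z r x := by
  rw [Metric.mem_ball, dist_eq_norm] at hx
  rw [bump_eq]
  exact lt_max_of_lt_left (by nlinarith [norm_nonneg (x - z)])

theorem contDiff_bump_sq : ContDiff ℝ 1 (fun x => bump z r x ^ 2) :=
  (contDiff_max_zero_pow 0).comp
    (contDiff_const.sub ((contDiff_quadratic 1).of_le (by norm_cast)))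

theorem pderiv_bump_sq (i : Fin n) (x : EuclideanSpace ℝ (Fin n)) :
    pderiv i (fun x => bump z r x ^ 2) x = -(4 * bump z r x * (x i - z i)) := by
  have hq : DifferentiableAt ℝ (quadratic z 1) x :=
    (contDiff_quadratic 1).differentiable (by simp) x
  have h := pderiv_comp (i := i)
    (hasDerivAt_max_zero_pow 0 (r ^ 2 + 1 - quadratic z 1 x))
    ((differentiableAt_const (r ^ 2 + 1)).fun_sub hq)
  rw [pderiv_sub (differentiableAt_const _) hq, pderiv_const, pderiv_quadratic] at h
  refine h.trans ?_
  simp only [bump, zero_add, pow_one]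
  push_cast
  ring

end Bump

/-! ### Nonnegativity and rigidity -/

namespace Polytope

variable {n m : ℕ} {Δ : Polytope n m} {v A u w : EuclideanSpace ℝ (Fin n) → ℝ}
  {p z : EuclideanSpace ℝ (Fin n)} {r : ℝ}

/-- Integrating by parts moves one derivative of `tr D²w` onto the squared bump and yields `4 bump
(x - z)·∇w`; convexity gives `(x - z)·∇w ≥ w - w(z)`. -/
theorem setIntegral_bump_mul_sub_le (hr : 0 < r) (hzr : Metric.closedBall z r ⊆ Δ.int)
    (hw : ContDiffOn ℝ ∞ w Δ.closed) (hwc : ConvexOn ℝ Δ.int w) :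
    (∫ x in Δ.int, 4 * bump z r x * (w x - w z)) ≤
      ∫ x in Δ.int, bump z r x ^ 2 * (hess w x).trace := by
  have hs := Δ.isOpen_int
  have hwi := hw.mono Δ.int_subset_closed
  have hz : z ∈ Δ.int := hzr (Metric.mem_closedBall_self hr.le)
  have hK : IsCompact (Metric.closedBall z r) := isCompact_closedBall z r
  have hd : ∀ {f : EuclideanSpace ℝ (Fin n) → ℝ}, ContDiffOn ℝ ∞ f Δ.int → ∀ x ∈ Δ.int,
      DifferentiableAt ℝ f x :=
    fun hf x hx => (hf.contDiffAt (hs.mem_nhds hx)).differentiableAt (by simp)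
  obtain ⟨hI, hI0⟩ := setIntegral_divergence_eq_zero hK hzr hs
    (X := fun i x => bump z r x ^ 2 * pderiv i w x)
    (fun i => contDiff_bump_sq.contDiffOn.mul
      ((ContDiffOn.pderiv_of_isOpen hs hwi i).of_le (by norm_cast)))
    fun i x _ hxK => by simp [bump_eq_zero hr hxK]
  have htr : IntegrableOn (fun x => bump z r x ^ 2 * (hess w x).trace) Δ.int := by
    refine integrableOn_of_continuousOn_of_eqOn_zero hK hzr hs ?_
      fun x _ hxK => by simp [bump_eq_zero hr hxK]
    have : ContDiffOn ℝ ∞ (fun x => (hess w x).trace) Δ.int := by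
      simp only [Matrix.trace, Matrix.diag_apply]
      exact ContDiffOn.sum fun i _ => contDiffOn_hess hs hwi i i
    exact (continuous_bump.pow 2).continuousOn.mul this.continuousOn
  have hb : IntegrableOn (fun x => 4 * bump z r x * (w x - w z)) Δ.int := by
    refine integrableOn_int (ContinuousOn.mul ?_ (hw.continuousOn.sub continuousOn_const))
    exact (continuous_const.mul continuous_bump).continuousOn
  have h := setIntegral_mono_on hb (htr.sub hI) hs.measurableSet fun x hx => by
    have h1 : ∀ i, pderiv i (fun x => bump z r x ^ 2 * pderiv i w x) x =
        bump z r x ^ 2 * hess w x i i - 4 * bump z r x * ((x i - z i) * pderiv i w x) :=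
      fun i => by
        rw [pderiv_mul (contDiff_bump_sq.differentiable one_ne_zero x)
          (hd (ContDiffOn.pderiv_of_isOpen hs hwi i) x hx), pderiv_bump_sq]
        simp only [hess, Matrix.of_apply]
        ring
    have h2 := ConvexOn.radialDeriv_ge hwc hz hx (hd hwi x hx)
    have h3 := mul_le_mul_of_nonneg_left h2
      (mul_nonneg zero_le_four (bump_nonneg (z := z) (r := r) (x := x)))
    simp only [Pi.sub_apply, h1, Finset.sum_sub_distrib, ← Finset.mul_sum]
    refine h3.trans_eq ?_
    simp only [radialDeriv, Matrix.trace, Matrix.diag_apply]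
    ring
  simp only [Pi.sub_apply] at h
  rwa [integral_sub htr hI, hI0, sub_zero] at h

/-- On a ball in the interior, `ℒ_A` controls the oscillation of a convex function which is smooth
up to the boundary. -/
theorem MemS.exists_bump_le_L (hv : Δ.MemS v) (hsol : Δ.SolvesAbreu A v)
    (hA : ContinuousOn A Δ.closed) (hp : p ∈ Δ.int) (hr : 0 < r)
    (hzr : Metric.closedBall z r ⊆ Δ.int) : ∃ B : ℝ, 0 ≤ B ∧
      ∀ w, ContDiffOn ℝ ∞ w Δ.closed → ConvexOn ℝ Δ.int w → (∀ x ∈ Δ.closed, 0 ≤ w x) →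
        (∫ x in Δ.int, 4 * bump z r x * (w x - w z)) ≤ B * Δ.L A w := by
  have hs := Δ.isOpen_int
  have hvs := hv.contDiffOn_int
  have hpd : ∀ x ∈ Δ.int, (hess v x).PosDef := fun x hx => (hsol x hx).1
  have hK : IsCompact (Metric.closedBall z r) := isCompact_closedBall z r
  have htrV : ContDiffOn ℝ ∞ (fun x => (hess v x).trace) Δ.int := by
    simp only [Matrix.trace, Matrix.diag_apply]
    exact ContDiffOn.sum fun i _ => contDiffOn_hess hs hvs i i
  obtain ⟨T, hT⟩ := hK.exists_bound_of_continuousOn (htrV.continuousOn.mono hzr)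
  refine ⟨r ^ 4 * |T|, by positivity, fun w hw hwc hw0 => ?_⟩
  have hwi := hw.mono Δ.int_subset_closed
  refine (setIntegral_bump_mul_sub_le hr hzr hw hwc).trans ?_
  -- The bump is at most `r²`, so this normalization satisfies `0 ≤ φ ≤ 1`.
  set φ : EuclideanSpace ℝ (Fin n) → ℝ := fun x => bump z r x ^ 2 / r ^ 4 with hφ
  have hφc : Continuous φ := (continuous_bump.pow 2).div_const _
  have hφ1 : ∀ x, φ x ≤ 1 := fun x => by
    simp only [hφ]
    rw [div_le_one (by positivity)]
    calc bump z r x ^ 2 ≤ (r ^ 2) ^ 2 := pow_le_pow_left₀ bump_nonneg bump_le 2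
      _ = r ^ 4 := by ring
  have hφ0 : ∀ x, x ∉ Metric.closedBall z r → φ x = 0 := fun x hx => by
    simp [hφ, bump_eq_zero hr hx]
  have hmain := hv.setIntegral_trace_le_L hsol hA hp hw hwc
    (fun x hx => hw0 x (Δ.int_subset_closed hx)) hK hzr hφc.continuousOn
    (fun x _ => by positivity) (fun x _ => hφ1 x) fun x _ hxK => hφ0 x hxK
  refine le_trans ?_ (mul_le_mul_of_nonneg_left hmain (by positivity))
  rw [← integral_const_mul]
  have htr : ContDiffOn ℝ ∞ (fun x => (hess w x).trace) Δ.int := by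
    simp only [Matrix.trace, Matrix.diag_apply]
    exact ContDiffOn.sum fun i _ => contDiffOn_hess hs hwi i i
  have htr' : ContDiffOn ℝ ∞ (fun x => ((hess v x)⁻¹ * hess w x).trace) Δ.int := by
    simp only [Matrix.trace, Matrix.diag_apply, Matrix.mul_apply]
    exact ContDiffOn.sum fun i _ => ContDiffOn.sum fun j _ =>
      (contDiffOn_hess_inv hs hvs hpd i j).mul (contDiffOn_hess hs hwi j i)
  refine setIntegral_mono_on ?_ ?_ hs.measurableSet fun x hx => ?_
  · exact integrableOn_of_continuousOn_of_eqOn_zero hK hzr hs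
      ((continuous_bump.pow 2).continuousOn.mul htr.continuousOn)
      fun x _ hxK => by simp [bump_eq_zero hr hxK]
  · refine Integrable.const_mul ?_ _
    exact integrableOn_of_continuousOn_of_eqOn_zero hK hzr hs
      (hφc.continuousOn.mul htr'.continuousOn) fun x _ hxK => by simp [hφ0 x hxK]
  · by_cases hxK : x ∈ Metric.closedBall z r
    swap
    · simp [hφ0 x hxK, bump_eq_zero hr hxK]
    have hU := ConvexOn.posSemidef_hess hwc hs hwi hx
    have h1 := (hpd x hx).trace_le_trace_mul_trace_inv_mul hU
    have h0 : 0 ≤ ((hess v x)⁻¹ * hess w x).trace :=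
      (hpd x hx).inv.posSemidef.trace_mul_nonneg hU
    have h2 : (hess v x).trace ≤ |T| :=
      ((le_abs_self _).trans (hT x hxK)).trans (le_abs_self T)
    have h3 := h1.trans (mul_le_mul_of_nonneg_right h2 h0)
    have h4 := mul_le_mul_of_nonneg_left h3 (sq_nonneg (bump z r x))
    refine h4.trans_eq ?_
    simp only [hφ]
    field_simp

theorem tendsto_L_dilate (hA : ContinuousOn A Δ.closed) (hp : p ∈ Δ.int) (hu : Δ.MemCStar p u)
    (hσ : Integrable u Δ.σ) (hint : IntegrableOn u Δ.int) :
    Tendsto (fun t => Δ.L A (fun x => u (dilate p t x))) (𝓝[<] 1) (𝓝 (Δ.L A u)) := by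
  have h1 := hu.tendsto_integral_dilate hp ae_σ_mem_star (g := fun _ => 1) continuousOn_const hσ
  simp only [one_mul] at h1
  exact h1.sub (hu.tendsto_integral_dilate hp ae_int_mem_star hA hint)

/-- The basic inequality passes first to uniform limits on the closed polytope, which include the
dilations of `u`, and then to `u` as the ratio tends to 1. -/
theorem MemS.L_nonneg (hv : Δ.MemS v) (hsol : Δ.SolvesAbreu A v)
    (hA : ContinuousOn A Δ.closed) (hp : p ∈ Δ.int) (hu : Δ.MemCStar p u)
    (hσ : Integrable u Δ.σ) : 0 ≤ Δ.L A u := by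
  refine ge_of_tendsto
    (tendsto_L_dilate hA hp hu hσ (hv.integrableOn_of_memCStar hp hu hσ)) ?_
  filter_upwards [Ioo_mem_nhdsLT (zero_lt_one' ℝ)] with t ht
  obtain ⟨W, hW, hWlim⟩ := hu.exists_approx_dilate hp ht.1.le ht.2
  refine ge_of_tendsto' (tendsto_L_of_tendstoUniformlyOn hA (fun j => (hW j).1.continuousOn)
    (hu.continuousOn_dilate hp ht.1.le ht.2) hWlim) fun j => ?_
  -- With `φ = 0` and an empty compact set the basic inequality reads `0 ≤ ℒ_A`.
  have := hv.setIntegral_trace_le_L (φ := fun _ => 0) hsol hA hp (hW j).1 (hW j).2.1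
    (fun x hx => (hW j).2.2.1 x (Δ.int_subset_closed hx)) isCompact_empty (empty_subset _)
    continuousOn_const (fun _ _ => le_rfl) (fun _ _ => zero_le_one) fun _ _ _ => rfl
  simpa using this

/-- The estimate contains no derivatives of the function, so it survives both limits, with the same
constant. -/
theorem MemS.exists_bump_le_L_of_memCStar (hv : Δ.MemS v) (hsol : Δ.SolvesAbreu A v)
    (hA : ContinuousOn A Δ.closed) (hp : p ∈ Δ.int) (hr : 0 < r)
    (hzr : Metric.closedBall z r ⊆ Δ.int) : ∃ B : ℝ, 0 ≤ B ∧
      ∀ u, Δ.MemCStar p u → Integrable u Δ.σ →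
        (∫ x in Δ.int, 4 * bump z r x * u x) - u z * (∫ x in Δ.int, 4 * bump z r x) ≤
          B * Δ.L A u := by
  obtain ⟨B, hB0, hB⟩ := hv.exists_bump_le_L hsol hA hp hr hzr
  refine ⟨B, hB0, fun u hu hσ => ?_⟩
  have hz : z ∈ Δ.int := hzr (Metric.mem_closedBall_self hr.le)
  have hint := hv.integrableOn_of_memCStar hp hu hσ
  have hb : ContinuousOn (fun x => 4 * bump z r x) Δ.closed :=
    (continuous_const.mul continuous_bump).continuousOn
  refine le_of_tendsto_of_tendsto
    ((hu.tendsto_integral_dilate hp ae_int_mem_star hb hint).sub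
      ((hu.tendsto_dilate hp (Or.inl hz)).mul_const _))
    ((tendsto_L_dilate hA hp hu hσ hint).const_mul B) ?_
  filter_upwards [Ioo_mem_nhdsLT (zero_lt_one' ℝ)] with t ht
  obtain ⟨W, hW, hWlim⟩ := hu.exists_approx_dilate hp ht.1.le ht.2
  have hWc := fun j => (hW j).1.continuousOn
  have huc := hu.continuousOn_dilate hp ht.1.le ht.2
  refine le_of_tendsto_of_tendsto'
    ((tendsto_integral_mul_of_tendstoUniformlyOn ae_int_mem_closed hb hWc huc hWlim).sub
      ((hWlim.tendsto_at (Δ.int_subset_closed hz)).mul_const _))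
    ((tendsto_L_of_tendstoUniformlyOn hA hWc huc hWlim).const_mul B) fun j => ?_
  refine le_trans (le_of_eq ?_) (hB (W j) (hW j).1 (hW j).2.1 (hW j).2.2.1)
  have i1 : IntegrableOn (fun x => 4 * bump z r x * W j x) Δ.int :=
    integrableOn_int (hb.mul (hWc j))
  have i2 : IntegrableOn (fun x => W j z * (4 * bump z r x)) Δ.int :=
    (integrableOn_int hb).const_mul _
  rw [← integral_const_mul, ← integral_sub i1 i2]
  refine integral_congr_ae (Eventually.of_forall fun x => ?_)
  simp only
  ring

/-- The bump-weighted integral of the nonnegative continuous function `u` is at most 0, and the bump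
is positive on the open ball. -/
theorem MemS.eqOn_ball_of_L_eq_zero (hv : Δ.MemS v) (hsol : Δ.SolvesAbreu A v)
    (hA : ContinuousOn A Δ.closed) (hp : p ∈ Δ.int) (hr : 0 < r)
    (hzr : Metric.closedBall z r ⊆ Δ.int) (hu : Δ.MemCStar p u) (hσ : Integrable u Δ.σ)
    (hL : Δ.L A u = 0) (huz : u z = 0) : ∀ x ∈ Metric.ball z r, u x = 0 := by
  obtain ⟨B, -, hB⟩ := hv.exists_bump_le_L_of_memCStar hsol hA hp hr hzr
  have h := hB u hu hσ
  rw [hL, huz, mul_zero, zero_mul, sub_zero] at h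
  have hs := Δ.isOpen_int
  have hb : Continuous (fun x => 4 * bump z r x) := continuous_const.mul continuous_bump
  have hc : ContinuousOn (fun x => 4 * bump z r x * u x) Δ.int :=
    hb.continuousOn.mul hu.continuousOn
  have hint : IntegrableOn (fun x => 4 * bump z r x * u x) Δ.int :=
    integrableOn_of_continuousOn_of_eqOn_zero (isCompact_closedBall z r) hzr hs hc
      fun x _ hxK => by simp [bump_eq_zero hr hxK]
  have hnn : ∀ x ∈ Δ.int, 0 ≤ 4 * bump z r x * u x := fun x hx =>
    mul_nonneg (mul_nonneg zero_le_four bump_nonneg) (hu.nonneg hx)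
  have hnn' : 0 ≤ᵐ[volume.restrict Δ.int] fun x => 4 * bump z r x * u x := by
    filter_upwards [ae_restrict_mem hs.measurableSet] with x hx using hnn x hx
  have h0 := le_antisymm h (integral_nonneg_of_ae hnn')
  have hae := (integral_eq_zero_iff_of_nonneg_ae hnn' hint).1 h0
  have heq := Measure.eqOn_open_of_ae_eq hae hs hc continuousOn_const
  intro x hx
  have h1 := heq (hzr (Metric.ball_subset_closedBall hx))
  simp only [Pi.zero_apply] at h1
  have h2 := bump_pos hx
  rcases mul_eq_zero.1 h1 with h3 | h3
  · linarith
  · exact h3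

/-- The zero set in the interior is open by the ball statement, its complement there is open by
continuity, and it contains `p`; the interior is connected. Facet values are limits from the
interior. -/
theorem MemS.eq_zero_of_L_eq_zero (hv : Δ.MemS v) (hsol : Δ.SolvesAbreu A v)
    (hA : ContinuousOn A Δ.closed) (hp : p ∈ Δ.int) (hu : Δ.MemCStar p u)
    (hσ : Integrable u Δ.σ) (hL : Δ.L A u = 0) : ∀ x ∈ Δ.star, u x = 0 := by
  have hs := Δ.isOpen_int
  have hint : ∀ x ∈ Δ.int, u x = 0 := by
    have hZ : IsOpen {x | x ∈ Δ.int ∧ u x = 0} := by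
      rw [Metric.isOpen_iff]
      rintro z ⟨hz, huz⟩
      obtain ⟨r, hr, hzr⟩ := Metric.nhds_basis_closedBall.mem_iff.1 (hs.mem_nhds hz)
      exact ⟨r, hr, fun x hx => ⟨hzr (Metric.ball_subset_closedBall hx),
        hv.eqOn_ball_of_L_eq_zero hsol hA hp hr hzr hu hσ hL huz x hx⟩⟩
    have hN : IsOpen (Δ.int ∩ u ⁻¹' {0}ᶜ) :=
      hu.continuousOn.isOpen_inter_preimage hs isOpen_compl_singleton
    have := Δ.convex_int.isPreconnected.subset_left_of_subset_union hZ hN ?_ ?_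
      ⟨p, hp, hp, hu.base hp⟩
    · exact fun x hx => (this hx).2
    · exact disjoint_left.2 fun x hx hx' => hx'.2 hx.2
    · intro x hx
      by_cases h : u x = 0
      · exact Or.inl ⟨hx, h⟩
      · exact Or.inr ⟨hx, h⟩
  intro x hx
  have := neBot_nhdsWithin_int hx
  refine tendsto_nhds_unique (hu.tendsto_nhdsWithin hx) (tendsto_const_nhds.congr' ?_)
  filter_upwards [self_mem_nhdsWithin] with y hy using (hint y hy).symm

end Polytope
end Abreu

end

theorem theorem1p2p7 {n m : ℕ} (Δ : Abreu.Polytope n m)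
    (A : EuclideanSpace ℝ (Fin n) → ℝ) (hA : ContDiffOn ℝ ∞ A Δ.closed)
    (p : EuclideanSpace ℝ (Fin n)) (hp : p ∈ Δ.int)
    (hsol : ∃ v : EuclideanSpace ℝ (Fin n) → ℝ, Δ.MemS v ∧ Δ.SolvesAbreu A v) :
    Δ.RelStrongKStable p A := by
  obtain ⟨v, hv, hvsol⟩ := hsol
  have hAc := hA.continuousOn
  -- Any positive threshold would do: the estimates hold uniformly in `P`.
  refine ⟨1, one_pos, fun P _ => ⟨fun u hu => ⟨?_, ?_⟩, fun u hu hL => ?_⟩⟩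
  · exact (hv.integrableOn_of_memCStar hp hu.memCStar hu.integrable).continuousOn_mul_of_subset hAc
      Δ.isCompact_closed Δ.isOpen_int.measurableSet Δ.int_subset_closed
  · exact hv.L_nonneg hvsol hAc hp hu.memCStar hu.integrable
  -- The normalization `u ≥ u(p) = 0` leaves only the zero function among affine candidates.
  · refine ⟨0, 0, fun x hx => ?_⟩
    rw [hv.eq_zero_of_L_eq_zero hvsol hAc hp hu.memCStar hu.integrable hL x hx]
    simp
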